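/- Let $\mathfrak H=\{z\in\mathbb C:\operatorname{Im}z>0\}$ and $\Gamma_0(4)=\{\left(\begin{smallmatrix}a&b\\c&d\end{smallmatrix}\right)\in SL(2,\mathbb Z): 4\mid c\}$. For $w\in\mathfrak H$ and $\operatorname{Re}s>1$ put $$E^{\Gamma_0(4)}(w,s)=\sum_{\gamma\in\left(\begin{smallmatrix}*&*\\0&*\end{smallmatrix}\right)\backslash\Gamma_0(4)}[\operatorname{Im}(\gamma w)]^s .$$ Let $\mathbf K(\sqrt t)=\int_0^{\pi/2}\frac{d\theta}{\sqrt{1-t\sin^2\theta}}$ for $t\in\mathbb C\smallsetminus[1,\infty)$ (principal square root), and for $w\in\mathfrak H$ let $\lambda(w)=16\,\eta(w/2)^8\eta(2w)^{16}/\eta(w)^{24}$, where $\eta(w)=e^{\pi iw/12}\prod_{n\ge1}(1-e^{2\pi inw})$. Write $\rho(t)=\dfrac{i\,\mathbf K(\sqrt{1-t})}{\mathbf K(\sqrt t)}$. Theorem. Suppose that $z\in\mathfrak H$ satisfies $|\operatorname{Re}(2z+1)|<1$, $\left|2z+\tfrac12\right|>\tfrac12$ and $\left|2z+\tfrac32\right|>\tfrac12$.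 Then $\lambda(2z+1)\in(\mathbb C\smallsetminus\mathbb R)\cup(0,1)$, the series defining $E^{\Gamma_0(4)}(-1/(4z),s)$ and the integrals below (taken along the straight-line segment from $0$ to $\lambda(2z+1)$) converge absolutely, and $$E^{\Gamma_0(4)}\!\left(-\tfrac1{4z},2\right)-\frac{21\,\zeta(3)}{8\pi^3\operatorname{Im}z}=\operatorname{Re}\int_0^{\lambda(2z+1)}\frac{3\,\mathbf K(\sqrt t)^2}{4\pi^3\operatorname{Im}z}\,[\rho(t)-2z-1]\,[\rho(t)-2\bar z-1]\,dt,$$ $$E^{\Gamma_0(4)}\!\left(-\tfrac1{4z},3\right)-\frac{1395\,\zeta(5)}{256\pi^5(\operatorname{Im}z)^2}=\operatorname{Re}\int_0^{\lambda(2z+1)}\frac{15(2t-1)\mathbf K(\sqrt t)^4}{32\pi^5(\operatorname{Im}z)^2}\,[\rho(t)-2z-1]^2[\rho(t)-2\bar z-1]^2\,dt,$$ $$E^{\Gamma_0(4)}\!\left(-\tfrac1{4z},4\right)-\frac{200025\,\zeta(7)}{17408\pi^7(\operatorname{Im}z)^3}=\operatorname{Re}\int_0^{\lambda(2z+1)}\frac{70[2-17t(1-t)]\mathbf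 K(\sqrt t)^6}{1088\pi^7(\operatorname{Im}z)^3}\,[\rho(t)-2z-1]^3[\rho(t)-2\bar z-1]^3\,dt,$$ $$E^{\Gamma_0(4)}\!\left(-\tfrac1{4z},5\right)-\frac{50703975\,\zeta(9)}{2031616\pi^9(\operatorname{Im}z)^4}=\operatorname{Re}\int_0^{\lambda(2z+1)}\frac{315(2t-1)[1-31t(1-t)]\mathbf K(\sqrt t)^8}{15872\pi^9(\operatorname{Im}z)^4}\,[\rho(t)-2z-1]^4[\rho(t)-2\bar z-1]^4\,dt,$$ $$E^{\Gamma_0(4)}\!\left(-\tfrac1{4z},7\right)-\frac{11506129710075\,\zeta(13)}{91620376576\pi^{13}(\operatorname{Im}z)^6}=\operatorname{Re}\int_0^{\lambda(2z+1)}\frac{3003(2t-1)[1-512t(1-t)+5461t^2(1-t)^2]\mathbf K(\sqrt t)^{12}}{22368256\pi^{13}(\operatorname{Im}z)^6}\,[\rho(t)-2z-1]^6[\rho(t)-2\bar z-1]^6\,dt.$$ -/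

import Mathlib

open scoped MatrixGroups

namespace EpsteinRepn

/-- The upper triangular subgroup of `SL(2, ℤ)`: the matrices whose lower left entry is `0`. -/
def upperTriangular : Subgroup SL(2, ℤ) where
  carrier := { g | g 1 0 = 0 }
  one_mem' := by simp
  mul_mem' {a} {b} ha hb := by
    have h := (Matrix.two_mul_expl a.1 b.1).2.2.1
    simp only [Matrix.SpecialLinearGroup.coe_mul, Set.mem_ofPred_eq] at *
    simp [h, ha, hb]
  inv_mem' {a} ha := by
    have ha' : a 1 0 = 0 := ha
    change (a⁻¹) 1 0 = 0
    simp [Matrix.SpecialLinearGroup.SL2_inv_expl a, ha']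

/-- The set of right cosets `(* *; 0 *) \ Γ₀(N)`. -/
abbrev CuspCosets (N : ℕ) : Type :=
  Quotient (QuotientGroup.rightRel (upperTriangular.subgroupOf (CongruenceSubgroup.Gamma0 N)))

theorem im_smul_of_mem_upperTriangular {g : SL(2, ℤ)} (hg : g ∈ upperTriangular)
    (z : UpperHalfPlane) : (g • z).im = z.im := by
  have hc : g 1 0 = 0 := hg
  have hdet := g.det_coe
  rw [Matrix.det_fin_two, hc, mul_zero, sub_zero] at hdet
  have hd : g 1 1 = 1 ∨ g 1 1 = -1 := Int.isUnit_iff.mp (IsUnit.of_mul_eq_one_right _ hdet)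
  rw [ModularGroup.im_smul_eq_div_normSq, ModularGroup.denom_apply, hc]
  rcases hd with hd | hd <;> rw [hd] <;> simp

/-- The term `(Im (γ z)) ^ s`, as a function on the right cosets. -/
noncomputable def epsteinTerm (N : ℕ) (z : UpperHalfPlane) (s : ℂ) : CuspCosets N → ℂ :=
  Quotient.lift
    (fun γ : CongruenceSubgroup.Gamma0 N => ((((γ : SL(2, ℤ)) • z).im : ℝ) : ℂ) ^ s)
    (by
      intro a b hab
      have h : ((b : SL(2, ℤ)) * (a : SL(2, ℤ))⁻¹) ∈ upperTriangular := by
        have h' := QuotientGroup.rightRel_apply.mp hab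
        simpa [Subgroup.mem_subgroupOf] using h'
      have e := im_smul_of_mem_upperTriangular h ((a : SL(2, ℤ)) • z)
      rw [smul_smul, inv_mul_cancel_right] at e
      simp only [e])

/-- The Epstein zeta function `E^{Γ₀(N)}(z, s)`: the sum of `(Im (γ z)) ^ s` over all cosets. -/
noncomputable def epsteinZeta (N : ℕ) (z : UpperHalfPlane) (s : ℂ) : ℂ :=
  ∑' γ : CuspCosets N, epsteinTerm N z s γ

/-- The point `-1 / (4 z)` of the upper half-plane. -/
noncomputable def negInvFour (z : UpperHalfPlane) : UpperHalfPlane :=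
  ⟨-1 / (4 * (z : ℂ)), by
    have hz : (0 : ℝ) < (z : ℂ).im := z.im_pos
    have hn : 0 < Complex.normSq (4 * (z : ℂ)) :=
      Complex.normSq_pos.mpr (mul_ne_zero (by norm_num) z.ne_zero)
    have e : (-1 / (4 * (z : ℂ))).im = 4 * (z : ℂ).im / Complex.normSq (4 * (z : ℂ)) := by
      rw [neg_div, Complex.neg_im, one_div, Complex.inv_im, neg_div, neg_neg]
      simp
    rw [e]
    positivity⟩

/-- The complete elliptic integral of the first kind `K(√t)`, as a function of `t = k ^ 2`
(the square root in the integrand is the principal one). -/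
noncomputable def ellipticKsqrt (t : ℂ) : ℂ :=
  ∫ θ in (0 : ℝ)..(Real.pi / 2), 1 / (1 - t * (Real.sin θ : ℂ) ^ 2) ^ (1 / 2 : ℂ)

/-- The ratio `i K(√(1 - t)) / K(√t)`. -/
noncomputable def periodRatio (t : ℂ) : ℂ :=
  Complex.I * ellipticKsqrt (1 - t) / ellipticKsqrt t

/-- The modular lambda function `16 η(z/2)^8 η(2z)^16 / η(z)^24`. -/
noncomputable def modularLambda (z : ℂ) : ℂ :=
  16 * ModularForm.eta (z / 2) ^ 8 * ModularForm.eta (2 * z) ^ 16 / ModularForm.eta z ^ 24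

/-- `f` is absolutely integrable along the straight-line segment from `a` to `b`, and its
integral `∫ f(t) dt` along this segment is `J`. -/
def HasSegmentIntegral (f : ℂ → ℂ) (a b J : ℂ) : Prop :=
  IntervalIntegrable (fun u : ℝ => f (a + (u : ℂ) * (b - a)) * (b - a)) MeasureTheory.volume 0 1 ∧
    ∫ u in (0 : ℝ)..1, f (a + (u : ℂ) * (b - a)) * (b - a) = J

end EpsteinRepn

open EpsteinRepn

/-! ### Rigidity of functions on the upper half-plane under the modular group -/

namespace EpsteinRepn
open Complex Filter Topology
open UpperHalfPlane hiding I
open scoped Real ModularForm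

/-! Put m = s - 1 and τ = 2z + 1. The two sides are two evaluations of one Eichler integral of an
Eisenstein series of weight 2m + 2 = 2s.

Epstein side. A coset is a bottom row (4c, d) up to sign, and its term is (Im z / 4)^s / |dz -
c|^(2s). Multiplying the series by ∑ k^(-2s) over odd k replaces primitive rows by all pairs (c, d)
with d odd and positive (`cuspMul_bijective`). For fixed d = 2a + 1 the sum over c is ∑ |w +
n|^(-2s) with w = `oddPoint τ a`. Partial fractions and the Lipschitz formula give its Fourier
expansion (`hasSum_lipschitz`). Summed over a, the constant terms produce ζ(2s - 1), and the rest is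
a multiple of the imaginary part of `eichPhi m τ τ` (`hasSum_normSum`).

Eisenstein series. `eichPhi m τ` is the primitive, vanishing at i∞, of `qs (2 * m + 1) 0` times ((v
- τ)(v - τ̄))^m. That q-series is a multiple of `latSum 1 1 (2 * m + 2)`, the lattice sum over pairs
of odd integers, which is also a derivative of ℘ for the lattice 2ℤτ + 2ℤ at the half period τ + 1.
Differentiating ℘'' = 6℘² - g₂/2 gives a recursion in the weight, started by identities with theta
constants. So each of these sums is θ₃^(4(m + 1)) λ(1 - λ) times a polynomial in λ; these are the
polynomials in the integrands.

Integral side. Substitute t = λ(v). On the fundamental domain of Γ(2) one has K(√λ) = (π/2) θ₃²,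
ρ(λ(v)) = v and λ' = πi λ(1 - λ) θ₃⁴, so the integrand becomes the Eichler integrand
(`hasSegmentIntegral_eichPhi`). The formula for K comes from the arithmetic-geometric mean on the
imaginary axis and analytic continuation. The hypotheses on z say that τ lies in that domain. The
segment lifts to a path from i∞ to τ because the image of the domain under λ is open and relatively
closed in the plane cut along (-∞, 0] and [1, ∞).

The modular identities between theta constants, eta quotients and weight-four sums share one
mechanism: three ratios minus 1 are permuted by T and S and vanish at i∞, so their symmetric
functions are modular of weight 0 and vanish (`eq_zero_of_permuted`). -/

/-- The filter of complex numbers whose imaginary part tends to infinity. -/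
abbrev imTop : Filter ℂ := comap Complex.im atTop

theorem neg_one_div_im_pos {z : ℂ} (hz : 0 < z.im) : 0 < (-1 / z).im := by
  have h : z ≠ 0 := by rintro rfl; simp at hz
  have hn : 0 < normSq z := normSq_pos.mpr h
  rw [neg_div, neg_im, one_div, inv_im, neg_div, neg_neg]
  positivity

theorem ne_zero_of_im_pos {z : ℂ} (hz : 0 < z.im) : z ≠ 0 := by
  rintro rfl; simp at hz

/-- Such a function is a level-one modular form of weight 0, and these are constant. Boundedness at
every cusp reduces to the limit at i∞, because all slashes of the function coincide with it. -/
theorem exists_const_of_invariant {f : ℂ → ℂ} (hd : DifferentiableOn ℂ f {z | 0 < z.im})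
    (hT : ∀ z : ℂ, 0 < z.im → f (z + 1) = f z) (hS : ∀ z : ℂ, 0 < z.im → f (-1 / z) = f z)
    {c : ℂ} (hc : Tendsto f imTop (𝓝 c)) {z : ℂ} (hz : 0 < z.im) : f z = c := by
  set g : ℍ → ℂ := fun τ => f τ with hg
  have gT : g ∣[(0 : ℤ)] ModularGroup.T = g := by
    ext τ
    rw [ModularForm.SL_slash_apply]
    simp only [neg_zero, zpow_zero, mul_one, hg]
    rw [modular_T_smul]
    simpa [add_comm] using hT τ τ.2
  have gS : g ∣[(0 : ℤ)] ModularGroup.S = g := by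
    ext τ
    rw [ModularForm.SL_slash_apply]
    simp only [neg_zero, zpow_zero, mul_one, hg]
    rw [modular_S_smul]
    have := hS τ τ.2
    simpa [neg_div, inv_neg] using this
  have ginv : ∀ γ : SL(2, ℤ), g ∣[(0 : ℤ)] γ = g := SlashInvariantForm.slash_action_generators_SL2Z gS gT
  have hbd : IsBoundedAtImInfty g := by
    have h1 : Tendsto g atImInfty (𝓝 c) := hc.comp (by
      rw [tendsto_comap_iff]; exact tendsto_comap)
    exact h1.isBigO_one ℝ
  let F : ModularForm 𝒮ℒ 0 :=
    { toFun := g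
      slash_action_eq' := fun _ ⟨γ, hγ⟩ ↦ hγ ▸ ginv γ
      holo' := by
        rw [UpperHalfPlane.mdifferentiable_iff]
        refine hd.congr fun w hw => ?_
        simp [hg, ofComplex_apply_of_im_pos hw]
      bdd_at_cusps' := by
        intro c hc
        rw [Subgroup.IsArithmetic.isCusp_iff_isCusp_SL2Z] at hc
        rw [OnePoint.isBoundedAt_iff_forall_SL2Z hc]
        intro γ _
        rw [ginv γ]
        exact hbd }
  obtain ⟨d, hd⟩ := ModularFormClass.levelOne_weight_zero_const F
  have hgd : ∀ τ : ℍ, f τ = d := fun τ => congrFun hd τ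
  have h2 : Tendsto f imTop (𝓝 d) := by
    refine tendsto_const_nhds.congr' ?_
    have : ∀ᶠ w : ℂ in imTop, 0 < w.im := tendsto_comap.eventually (eventually_gt_atTop 0)
    filter_upwards [this] with w hw
    exact (hgd ⟨w, hw⟩).symm
  have : (imTop).NeBot := by
    refine comap_neBot_iff_frequently.mpr (Filter.Eventually.frequently ?_)
    exact Eventually.of_forall fun y => ⟨⟨0, y⟩, rfl⟩
  rw [tendsto_nhds_unique hc h2]
  exact hgd ⟨z, hz⟩

/-- Three functions that are permuted by the generators of the modular group and that tend
to `0` at infinity vanish. -/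
theorem eq_zero_of_permuted {f₁ f₂ f₃ : ℂ → ℂ}
    (hd₁ : DifferentiableOn ℂ f₁ {z | 0 < z.im}) (hd₂ : DifferentiableOn ℂ f₂ {z | 0 < z.im})
    (hd₃ : DifferentiableOn ℂ f₃ {z | 0 < z.im})
    (hT₁ : ∀ z : ℂ, 0 < z.im → f₁ (z + 1) = f₁ z) (hT₂ : ∀ z : ℂ, 0 < z.im → f₂ (z + 1) = f₃ z)
    (hT₃ : ∀ z : ℂ, 0 < z.im → f₃ (z + 1) = f₂ z)
    (hS₁ : ∀ z : ℂ, 0 < z.im → f₁ (-1 / z) = f₃ z) (hS₂ : ∀ z : ℂ, 0 < z.im → f₂ (-1 / z) = f₂ z)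
    (hS₃ : ∀ z : ℂ, 0 < z.im → f₃ (-1 / z) = f₁ z)
    (h₁ : Tendsto f₁ imTop (𝓝 0)) (h₂ : Tendsto f₂ imTop (𝓝 0)) (h₃ : Tendsto f₃ imTop (𝓝 0))
    {z : ℂ} (hz : 0 < z.im) : f₁ z = 0 ∧ f₂ z = 0 ∧ f₃ z = 0 := by
  -- The elementary symmetric functions of the triple are invariant and tend to 0, so they vanish
  -- identically; the three values are then roots of `X ^ 3`.
  have e1 : f₁ z + f₂ z + f₃ z = 0 := by
    refine exists_const_of_invariant (f := fun z => f₁ z + f₂ z + f₃ z)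
      ((hd₁.add hd₂).add hd₃) (fun z hz => ?_) (fun z hz => ?_) (c := 0) ?_ hz
    · simp only [hT₁ z hz, hT₂ z hz, hT₃ z hz]; ring
    · simp only [hS₁ z hz, hS₂ z hz, hS₃ z hz]; ring
    · simpa using (h₁.add h₂).add h₃
  have e2 : f₁ z * f₂ z + f₁ z * f₃ z + f₂ z * f₃ z = 0 := by
    refine exists_const_of_invariant (f := fun z => f₁ z * f₂ z + f₁ z * f₃ z + f₂ z * f₃ z)
      (((hd₁.mul hd₂).add (hd₁.mul hd₃)).add (hd₂.mul hd₃)) (fun z hz => ?_) (fun z hz => ?_)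
      (c := 0) ?_ hz
    · simp only [hT₁ z hz, hT₂ z hz, hT₃ z hz]; ring
    · simp only [hS₁ z hz, hS₂ z hz, hS₃ z hz]; ring
    · simpa using ((h₁.mul h₂).add (h₁.mul h₃)).add (h₂.mul h₃)
  have e3 : f₁ z * f₂ z * f₃ z = 0 := by
    refine exists_const_of_invariant (f := fun z => f₁ z * f₂ z * f₃ z)
      ((hd₁.mul hd₂).mul hd₃) (fun z hz => ?_) (fun z hz => ?_)
      (c := 0) ?_ hz
    · simp only [hT₁ z hz, hT₂ z hz, hT₃ z hz]; ring
    · simp only [hS₁ z hz, hS₂ z hz, hS₃ z hz]; ring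
    · simpa using (h₁.mul h₂).mul h₃
  have key : ∀ x : ℂ, x ^ 3 = (f₁ z + f₂ z + f₃ z) * x ^ 2
      - (f₁ z * f₂ z + f₁ z * f₃ z + f₂ z * f₃ z) * x + f₁ z * f₂ z * f₃ z → x = 0 := by
    intro x hx
    rw [e1, e2, e3] at hx
    simpa using hx
  exact ⟨key _ (by ring), key _ (by ring), key _ (by ring)⟩

end EpsteinRepn

/-! ### Theta constants: duplication formulas, modular transformations, behaviour at i∞ -/

namespace EpsteinRepn
open Complex Filter Topology
open scoped Real

theorem eventually_imTop_lt (M : ℝ) : ∀ᶠ w : ℂ in imTop, M < w.im :=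
  tendsto_comap.eventually (eventually_gt_atTop M)

theorem norm_exp_pi_I_mul (k : ℝ) (τ : ℂ) :
    ‖cexp (π * I * k * τ)‖ = Real.exp (-π * k * τ.im) := by
  rw [Complex.norm_exp]
  congr 1
  simp [mul_re, mul_im]

/-- A series of exponentials with nonnegative frequencies tends to its constant term. -/
theorem tendsto_tsum_exp_imTop {ι : Type*} {c : ι → ℂ} {e : ι → ℕ}
    (h : Summable fun i => ‖c i‖ * Real.exp (-π * e i)) :
    Tendsto (fun τ : ℂ => ∑' i, c i * cexp (π * I * (e i : ℝ) * τ)) imTop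
      (𝓝 (∑' i, if e i = 0 then c i else 0)) := by
  refine tendsto_tsum_of_dominated_convergence h (fun i => ?_) ?_
  · by_cases hi : e i = 0
    · simpa [hi] using tendsto_const_nhds
    · simp only [hi, if_false]
      rw [tendsto_zero_iff_norm_tendsto_zero]
      simp only [norm_mul _ (cexp _), norm_exp_pi_I_mul]
      have h1 : Tendsto (fun τ : ℂ => -π * (e i : ℝ) * τ.im) imTop atBot := by
        refine Tendsto.const_mul_atTop_of_neg ?_ tendsto_comap
        have : (0 : ℝ) < e i := by exact_mod_cast Nat.pos_of_ne_zero hi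
        nlinarith [Real.pi_pos]
      simpa using (Real.tendsto_exp_atBot.comp h1).const_mul ‖c i‖
  -- Beyond height 1 each term is bounded by its size at height 1, which is the summable bound `h`.
  · filter_upwards [eventually_imTop_lt 1] with τ hτ i
    rw [norm_mul, norm_exp_pi_I_mul]
    have : (0 : ℝ) ≤ π * e i := by positivity
    exact mul_le_mul_of_nonneg_left (Real.exp_le_exp.mpr (by nlinarith)) (norm_nonneg _)

/-- The pairs (m, n) split by the parity of m + n into (p + q, p - q) and (p + q + 1, p - q). Since
m² + n² is 2(p² + q²), respectively 2(p² + q²) + 2(p + q) + 1, the exponents separate in p and q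
with τ doubled. The duplication formulas below are special cases. -/
theorem jacobiTheta₂_mul {a b τ : ℂ} (hτ : 0 < τ.im) :
    jacobiTheta₂ a τ * jacobiTheta₂ b τ =
      jacobiTheta₂ (a + b) (2 * τ) * jacobiTheta₂ (a - b) (2 * τ) +
        cexp (π * I * τ + 2 * π * I * a) *
          (jacobiTheta₂ (a + b + τ) (2 * τ) * jacobiTheta₂ (a - b + τ) (2 * τ)) := by
  have h2 : 0 < (2 * τ).im := by simpa using hτ
  have hs (z : ℂ) {τ : ℂ} (hτ : 0 < τ.im) : Summable fun n => ‖jacobiTheta₂_term n z τ‖ :=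
    ((summable_jacobiTheta₂_term_iff z τ).mpr hτ).norm
  have hprod (z z' : ℂ) {τ : ℂ} (hτ : 0 < τ.im) :
      HasSum (fun p : ℤ × ℤ => jacobiTheta₂_term p.1 z τ * jacobiTheta₂_term p.2 z' τ)
        (jacobiTheta₂ z τ * jacobiTheta₂ z' τ) := by
    unfold jacobiTheta₂
    rw [tsum_mul_tsum_of_summable_norm (hs z hτ) (hs z' hτ)]
    exact (summable_mul_of_summable_norm (hs z hτ) (hs z' hτ)).hasSum
  let e : (ℤ × ℤ) ⊕ (ℤ × ℤ) → ℤ × ℤ :=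
    Sum.elim (fun p => (p.1 + p.2, p.1 - p.2)) (fun p => (p.1 + p.2 + 1, p.1 - p.2))
  have he : Function.Bijective e := by
    constructor
    · rintro (⟨p, q⟩ | ⟨p, q⟩) (⟨p', q'⟩ | ⟨p', q'⟩) h <;>
        simp only [e, Sum.elim_inl, Sum.elim_inr, Prod.mk.injEq] at h
      · congr 2 <;> omega
      · omega
      · omega
      · congr 2 <;> omega
    · rintro ⟨m, n⟩
      rcases Int.even_or_odd' (m + n) with ⟨k, hk | hk⟩
      · exact ⟨Sum.inl (k, m - k), by simp only [e, Sum.elim_inl, Prod.mk.injEq]; omega⟩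
      · exact ⟨Sum.inr (k, m - k - 1), by simp only [e, Sum.elim_inr, Prod.mk.injEq]; omega⟩
  have h1 := (Equiv.ofBijective e he).hasSum_iff.mpr (hprod a b hτ)
  refine h1.unique (HasSum.sum ?_ ?_)
  · convert hprod (a + b) (a - b) h2 using 1
    ext ⟨p, q⟩
    simp only [Function.comp, Equiv.ofBijective_apply, e, Sum.elim_inl, jacobiTheta₂_term,
      ← Complex.exp_add]
    congr 1
    push_cast
    ring
  · refine ((hprod (a + b + τ) (a - b + τ) h2).mul_left
      (cexp (π * I * τ + 2 * π * I * a))).congr_fun fun ⟨p, q⟩ => ?_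
    simp only [Function.comp, Equiv.ofBijective_apply, e, Sum.elim_inr, jacobiTheta₂_term,
      ← Complex.exp_add]
    congr 1
    push_cast
    ring

/-- The Jacobi theta constant `θ₂`. -/
noncomputable def theta2 (τ : ℂ) : ℂ := cexp (π * I * τ / 4) * jacobiTheta₂ (τ / 2) τ

/-- The Jacobi theta constant `θ₃`. -/
noncomputable def theta3 (τ : ℂ) : ℂ := jacobiTheta₂ 0 τ

/-- The Jacobi theta constant `θ₄`. -/
noncomputable def theta4 (τ : ℂ) : ℂ := jacobiTheta₂ (1 / 2) τ

theorem two_mul_half' (τ : ℂ) : 2 * τ / 2 = τ := by ring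

theorem theta2_two_mul_sq (τ : ℂ) :
    theta2 (2 * τ) ^ 2 = cexp (π * I * τ) * jacobiTheta₂ τ (2 * τ) ^ 2 := by
  rw [theta2, mul_pow, ← Complex.exp_nat_mul, two_mul_half']
  congr 2
  push_cast
  ring

theorem theta3_sq {τ : ℂ} (hτ : 0 < τ.im) :
    theta3 τ ^ 2 = theta3 (2 * τ) ^ 2 + theta2 (2 * τ) ^ 2 := by
  have := jacobiTheta₂_mul (a := 0) (b := 0) hτ
  rw [theta2_two_mul_sq, theta3, theta3, sq, this]
  simp
  ring

theorem theta4_sq {τ : ℂ} (hτ : 0 < τ.im) :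
    theta4 τ ^ 2 = theta3 (2 * τ) ^ 2 - theta2 (2 * τ) ^ 2 := by
  have := jacobiTheta₂_mul (a := 1 / 2) (b := 1 / 2) hτ
  have e1 : (1 / 2 + 1 / 2 : ℂ) = 0 + 1 := by norm_num
  have e2 : (1 / 2 + 1 / 2 : ℂ) + τ = τ + 1 := by ring
  rw [theta2_two_mul_sq, theta3, theta4, sq, this, e2, e1, jacobiTheta₂_add_left,
    jacobiTheta₂_add_left, sub_self, zero_add,
    show π * I * τ + 2 * π * I * (1 / 2) = π * I * τ + π * I by ring, Complex.exp_add,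
    Complex.exp_pi_mul_I]
  ring

theorem theta3_mul_theta4 {τ : ℂ} (hτ : 0 < τ.im) :
    theta3 τ * theta4 τ = theta4 (2 * τ) ^ 2 := by
  have := jacobiTheta₂_mul (a := 0) (b := 1 / 2) hτ
  have h1 : jacobiTheta₂ (-(1 / 2) + τ) (2 * τ) = jacobiTheta₂ (1 / 2 + τ) (2 * τ) := by
    rw [← jacobiTheta₂_add_left (-(1 / 2) + τ)]
    congr 1
    ring
  -- The zero of the theta function at the half period: quasi-periodicity, evenness and period 1
  -- make the value equal to its own negative.
  have h0 : jacobiTheta₂ (1 / 2 + τ) (2 * τ) = 0 := by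
    have h2 := jacobiTheta₂_add_left' (-(1 / 2) - τ) (2 * τ)
    rw [show -(1 / 2 : ℂ) - τ + 2 * τ = -(1 / 2) + τ by ring, h1,
      show -(1 / 2 : ℂ) - τ = -(1 / 2 + τ) by ring, jacobiTheta₂_neg_left,
      show -π * I * (2 * τ + 2 * -(1 / 2 + τ)) = π * I by ring, Complex.exp_pi_mul_I] at h2
    linear_combination h2 / 2
  rw [theta3, theta4, theta4, this, zero_sub, zero_add, h0, jacobiTheta₂_neg_left]
  ring

theorem theta2_sq {τ : ℂ} (hτ : 0 < τ.im) :
    theta2 τ ^ 2 = 2 * theta2 (2 * τ) * theta3 (2 * τ) := by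
  have := jacobiTheta₂_mul (a := τ / 2) (b := τ / 2) hτ
  have h1 := jacobiTheta₂_add_left' 0 (2 * τ)
  rw [zero_add, mul_zero, add_zero] at h1
  rw [theta2, mul_pow, sq (jacobiTheta₂ _ _), this, add_halves, sub_self, zero_add,
    show τ + τ = 2 * τ by ring, h1, theta2, two_mul_half', theta3, ← Complex.exp_nat_mul]
  have e1 : cexp (π * I * τ + 2 * π * I * (τ / 2)) * cexp (-π * I * (2 * τ)) = 1 := by
    rw [← Complex.exp_add, ← Complex.exp_zero]
    congr 1
    ring
  have e2 : cexp ((2 : ℕ) * (π * I * τ / 4)) = cexp (π * I * (2 * τ) / 4) := by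
    congr 1
    push_cast
    ring
  rw [e2]
  linear_combination (cexp (π * I * (2 * τ) / 4) * jacobiTheta₂ 0 (2 * τ) *
    jacobiTheta₂ τ (2 * τ)) * e1

theorem theta3_sq_add_theta4_sq {τ : ℂ} (hτ : 0 < τ.im) :
    theta3 τ ^ 2 + theta4 τ ^ 2 = 2 * theta3 (2 * τ) ^ 2 := by
  rw [theta3_sq hτ, theta4_sq hτ]; ring

/-- Jacobi's identity between the fourth powers of the theta constants. -/
theorem theta3_pow_four {τ : ℂ} (hτ : 0 < τ.im) :
    theta3 τ ^ 4 = theta2 τ ^ 4 + theta4 τ ^ 4 := by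
  have h3 := theta3_sq hτ
  have h4 := theta4_sq hτ
  have h2 := theta2_sq hτ
  rw [show theta3 τ ^ 4 = (theta3 τ ^ 2) ^ 2 by ring, show theta2 τ ^ 4 = (theta2 τ ^ 2) ^ 2 by ring,
    show theta4 τ ^ 4 = (theta4 τ ^ 2) ^ 2 by ring, h2, h3, h4]
  ring

theorem exp_pi_I_mul_even {k : ℤ} (hk : Even k) : cexp (π * I * k) = 1 := by
  obtain ⟨j, rfl⟩ := hk
  rw [Complex.exp_eq_one_iff]
  exact ⟨j, by push_cast; ring⟩

theorem even_sq_sub (n : ℤ) : Even (n ^ 2 - n) := by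
  rw [sq, show n * n - n = (n - 1) * n by ring]
  simpa using Int.even_mul_succ_self (n - 1)

theorem theta3_add_one (τ : ℂ) : theta3 (τ + 1) = theta4 τ := by
  simp only [theta3, theta4, jacobiTheta₂, jacobiTheta₂_term]
  refine tsum_congr fun n => ?_
  have h := exp_pi_I_mul_even (even_sq_sub n)
  have e : 2 * π * I * n * 0 + π * I * n ^ 2 * (τ + 1) =
      2 * π * I * n * (1 / 2) + π * I * n ^ 2 * τ + π * I * (n ^ 2 - n : ℤ) := by
    push_cast
    ring
  rw [e, Complex.exp_add, h, mul_one]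

theorem theta4_add_one (τ : ℂ) : theta4 (τ + 1) = theta3 τ := by
  rw [← theta3_add_one, theta3, theta3, add_assoc, one_add_one_eq_two, jacobiTheta₂_add_right]

theorem theta2_add_one (τ : ℂ) : theta2 (τ + 1) = cexp (π * I / 4) * theta2 τ := by
  simp only [theta2, jacobiTheta₂, jacobiTheta₂_term, ← tsum_mul_left]
  refine tsum_congr fun n => ?_
  have h := exp_pi_I_mul_even (Int.even_mul_succ_self n)
  rw [← Complex.exp_add, ← Complex.exp_add, ← Complex.exp_add]
  have e : π * I * (τ + 1) / 4 + (2 * π * I * n * ((τ + 1) / 2) + π * I * n ^ 2 * (τ + 1)) =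
      π * I / 4 + (π * I * τ / 4 + (2 * π * I * n * (τ / 2) + π * I * n ^ 2 * τ)) +
        π * I * (n * (n + 1) : ℤ) := by
    push_cast
    ring
  rw [e, Complex.exp_add, h, mul_one]

theorem theta2_add_one_pow_four (τ : ℂ) : theta2 (τ + 1) ^ 4 = -theta2 τ ^ 4 := by
  rw [theta2_add_one, mul_pow, ← Complex.exp_nat_mul,
    show ((4 : ℕ) : ℂ) * (π * I / 4) = π * I by push_cast; ring, Complex.exp_pi_mul_I]
  ring

theorem cpow_half_sq {x : ℂ} : (x ^ (1 / 2 : ℂ)) ^ 2 = x := by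
  rw [← Complex.cpow_nat_mul]
  norm_num

/-- Squaring removes the factor `(-I * τ) ^ (1 / 2)` of the functional equation, so no branch of the
square root has to be followed. -/
theorem theta3_sq_neg_one_div {τ : ℂ} (hτ : 0 < τ.im) :
    theta3 (-1 / τ) ^ 2 = -I * τ * theta3 τ ^ 2 := by
  have h := jacobiTheta₂_functional_equation 0 τ
  have hτ0 := ne_zero_of_im_pos hτ
  have h0 : -I * τ ≠ 0 := mul_ne_zero (neg_ne_zero.mpr I_ne_zero) hτ0
  rw [theta3, theta3, h]
  simp only [zero_div, mul_pow, div_pow, cpow_half_sq]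
  simp
  field_simp
  simp [I_sq]

theorem theta4_sq_neg_one_div {τ : ℂ} (hτ : 0 < τ.im) :
    theta4 (-1 / τ) ^ 2 = -I * τ * theta2 τ ^ 2 := by
  have h := jacobiTheta₂_functional_equation (τ / 2) τ
  have hτ0 := ne_zero_of_im_pos hτ
  have h0 : -I * τ ≠ 0 := mul_ne_zero (neg_ne_zero.mpr I_ne_zero) hτ0
  have e1 : τ / 2 / τ = 1 / 2 := by field_simp
  have e2 : -π * I * (τ / 2) ^ 2 / τ = -(π * I * τ / 4) := by field_simp; ring
  rw [theta4, theta2, h, e1, e2, Complex.exp_neg]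
  simp only [mul_pow, div_pow, cpow_half_sq, inv_pow]
  have := Complex.exp_ne_zero (π * I * τ / 4)
  field_simp

theorem neg_one_div_neg_one_div {τ : ℂ} : -1 / (-1 / τ) = τ := by
  by_cases h : τ = 0
  · simp [h]
  · field_simp

theorem theta2_sq_neg_one_div {τ : ℂ} (hτ : 0 < τ.im) :
    theta2 (-1 / τ) ^ 2 = -I * τ * theta4 τ ^ 2 := by
  have h := theta4_sq_neg_one_div (neg_one_div_im_pos hτ)
  have hτ0 := ne_zero_of_im_pos hτ
  rw [neg_one_div_neg_one_div] at h
  rw [h]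
  field_simp
  rw [I_sq]
  ring

theorem pow_four_of_sq {a b c : ℂ} (h : a ^ 2 = -I * c * b ^ 2) : a ^ 4 = -c ^ 2 * b ^ 4 := by
  rw [show a ^ 4 = (a ^ 2) ^ 2 by ring, h]
  linear_combination (c ^ 2 * b ^ 4) * I_sq

theorem differentiableAt_theta3 {τ : ℂ} (hτ : 0 < τ.im) : DifferentiableAt ℂ theta3 τ :=
  differentiableAt_jacobiTheta₂_snd 0 hτ

theorem differentiableAt_theta4 {τ : ℂ} (hτ : 0 < τ.im) : DifferentiableAt ℂ theta4 τ :=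
  differentiableAt_jacobiTheta₂_snd _ hτ

theorem differentiableAt_theta2 {τ : ℂ} (hτ : 0 < τ.im) : DifferentiableAt ℂ theta2 τ := by
  refine DifferentiableAt.mul (by fun_prop) ?_
  exact (hasFDerivAt_jacobiTheta₂ (τ / 2) hτ).differentiableAt.comp τ
    (f := fun τ : ℂ => (τ / 2, τ)) (by fun_prop)

theorem tendsto_theta3 : Tendsto theta3 imTop (𝓝 1) := by
  rw [tendsto_iff_norm_sub_tendsto_zero]
  have h : Tendsto (fun τ : ℂ => 2 / (1 - Real.exp (-π * τ.im)) * Real.exp (-π * τ.im)) imTop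
      (𝓝 (2 / (1 - 0) * 0)) := by
    have h1 : Tendsto (fun τ : ℂ => Real.exp (-π * τ.im)) imTop (𝓝 0) :=
      Real.tendsto_exp_atBot.comp
        (Tendsto.const_mul_atTop_of_neg (neg_lt_zero.mpr Real.pi_pos) tendsto_comap)
    exact (tendsto_const_nhds.div (tendsto_const_nhds.sub h1) (by norm_num)).mul h1
  rw [mul_zero] at h
  refine squeeze_zero' (Eventually.of_forall fun _ => norm_nonneg _) ?_ h
  filter_upwards [eventually_imTop_lt 0] with τ hτ
  rw [theta3, ← jacobiTheta_eq_jacobiTheta₂]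
  exact norm_jacobiTheta_sub_one_le hτ

theorem tendsto_add_one_imTop : Tendsto (fun τ : ℂ => τ + 1) imTop imTop := by
  rw [tendsto_comap_iff]
  refine (tendsto_comap (f := Complex.im) (x := atTop)).congr fun τ => ?_
  simp

theorem tendsto_theta4 : Tendsto theta4 imTop (𝓝 1) :=
  (tendsto_theta3.comp tendsto_add_one_imTop).congr theta3_add_one

theorem tendsto_theta2_mul_exp :
    Tendsto (fun τ => theta2 τ * cexp (-(π * I * τ / 4))) imTop (𝓝 2) := by
  have h0 (n : ℤ) : 0 ≤ n ^ 2 + n := by nlinarith [sq_nonneg (2 * n + 1)]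
  have hs : Summable fun n : ℤ => ‖(1 : ℂ)‖ * Real.exp (-π * ((n ^ 2 + n).toNat : ℕ)) := by
    have := ((summable_jacobiTheta₂_term_iff (I / 2) I).mpr (by simp)).norm
    refine this.congr fun n => ?_
    have hc : (((n ^ 2 + n).toNat : ℕ) : ℝ) = n ^ 2 + n := by
      have : (((n ^ 2 + n).toNat : ℕ) : ℤ) = n ^ 2 + n := Int.toNat_of_nonneg (h0 n)
      exact_mod_cast this
    rw [norm_jacobiTheta₂_term, hc]
    simp
    ring
  have h := tendsto_tsum_exp_imTop hs
  -- The frequency n² + n vanishes exactly at n = 0 and n = -1.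
  have e : (∑' n : ℤ, if (n ^ 2 + n).toNat = 0 then (1 : ℂ) else 0) = 2 := by
    rw [tsum_eq_sum (s := {0, -1}), Finset.sum_insert (by norm_num), Finset.sum_singleton]
    · norm_num
    · intro n hn
      have : (n ^ 2 + n).toNat ≠ 0 := by
        simp only [Finset.mem_insert, Finset.mem_singleton, not_or] at hn
        have h1 : n ^ 2 + n ≠ 0 := by
          intro h
          have : n * (n + 1) = 0 := by linarith
          rcases mul_eq_zero.mp this with h | h <;> omega
        have := h0 n
        omega
      simp [this]
  rw [e] at h
  refine h.congr fun τ => ?_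
  rw [theta2, mul_right_comm, ← Complex.exp_add, add_neg_cancel, Complex.exp_zero, one_mul,
    jacobiTheta₂]
  refine tsum_congr fun n => ?_
  have hc : (((n ^ 2 + n).toNat : ℕ) : ℂ) = n ^ 2 + n := by
    have : (((n ^ 2 + n).toNat : ℕ) : ℤ) = n ^ 2 + n := Int.toNat_of_nonneg (h0 n)
    exact_mod_cast congrArg (Int.cast : ℤ → ℂ) this
  rw [one_mul, jacobiTheta₂_term]
  congr 1
  push_cast
  rw [hc]
  ring

end EpsteinRepn

/-! ### Eta quotients and their equality with fourth powers of theta constants -/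

namespace EpsteinRepn
open Complex hiding eta
open Filter Topology ModularForm
open scoped Real

/-- The Euler product `∏ (1 - q ^ n)`. -/
noncomputable def eulerProd (q : ℂ) : ℂ := ∏' n : ℕ, (1 - q ^ (n + 1))

theorem tendsto_eulerProd : Tendsto eulerProd (𝓝 0) (𝓝 1) := by
  have h := (differentiableOn_tprod_one_sub_pow.differentiableAt
    (Metric.isOpen_ball.mem_nhds (Metric.mem_ball_self one_pos))).continuousAt.tendsto
  simp only [ne_eq, Nat.add_eq_zero_iff, one_ne_zero, and_false, not_false_eq_true, zero_pow,
    sub_zero, tprod_one] at h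
  exact h

theorem eulerProd_ne_zero {q : ℂ} (hq : ‖q‖ < 1) : eulerProd q ≠ 0 := by
  have h := tprod_one_add_ne_zero_of_summable (f := fun n : ℕ ↦ -q ^ (n + 1)) (fun n => ?_) ?_
  · simpa [eulerProd, sub_eq_add_neg] using h
  · rw [← sub_eq_add_neg, sub_ne_zero]
    intro h
    have : ‖q‖ ^ (n + 1) < 1 := pow_lt_one₀ (norm_nonneg _) hq (by simp)
    rw [← norm_pow, ← h] at this
    simp at this
  · simpa using (summable_nat_add_iff 1).mpr (summable_geometric_of_lt_one (norm_nonneg _) hq)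

theorem multipliable_one_sub_pow_odd {q : ℂ} (hq : ‖q‖ < 1) :
    Multipliable fun n : ℕ => 1 - q ^ (2 * n + 1) := by
  simp only [sub_eq_add_neg]
  apply multipliable_one_add_of_summable
  have := (summable_nat_add_iff 1).mpr (summable_geometric_of_lt_one (norm_nonneg _) hq)
  simp only [norm_neg, norm_pow]
  exact this.comp_injective (i := fun n => 2 * n) (fun a b h => by simpa using h)

theorem norm_sq_lt_one {q : ℂ} (hq : ‖q‖ < 1) : ‖q ^ 2‖ < 1 := by
  rw [norm_pow]; exact pow_lt_one₀ (norm_nonneg _) hq (by simp)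

theorem eulerProd_eq_odd_mul {q : ℂ} (hq : ‖q‖ < 1) :
    eulerProd q = (∏' n : ℕ, (1 - q ^ (2 * n + 1))) * eulerProd (q ^ 2) := by
  have e (n : ℕ) : 1 - (q ^ 2) ^ (n + 1) = 1 - q ^ (2 * n + 1 + 1) := by
    rw [← pow_mul, mul_add, mul_one]
  have h2 : Multipliable fun n : ℕ => 1 - q ^ (2 * n + 1 + 1) :=
    (multipliable_one_sub_pow (norm_sq_lt_one hq)).congr e
  have h := tprod_even_mul_odd (f := fun n : ℕ => 1 - q ^ (n + 1))
    (multipliable_one_sub_pow_odd hq) h2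
  rw [eulerProd, eulerProd, ← h]
  congr 1
  exact tprod_congr fun n => (e n).symm

/-- Split each product into odd and even exponents: the odd factors at q and -q multiply to the odd
factors at q². As τ ↦ τ + 1 negates the nome, this identity is what makes that shift exchange
`etaQuot3` and `etaQuot4`. -/
theorem eulerProd_mul_neg {q : ℂ} (hq : ‖q‖ < 1) :
    eulerProd q * eulerProd (-q) * eulerProd (q ^ 4) = eulerProd (q ^ 2) ^ 3 := by
  have h1 := eulerProd_eq_odd_mul hq
  have h2 := eulerProd_eq_odd_mul (q := -q) (by simpa using hq)
  have h3 := eulerProd_eq_odd_mul (norm_sq_lt_one hq)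
  have h4 : (∏' n : ℕ, (1 - q ^ (2 * n + 1))) * (∏' n : ℕ, (1 - (-q) ^ (2 * n + 1))) =
      ∏' n : ℕ, (1 - (q ^ 2) ^ (2 * n + 1)) := by
    rw [← (multipliable_one_sub_pow_odd hq).tprod_mul
      (multipliable_one_sub_pow_odd (q := -q) (by simpa using hq))]
    refine tprod_congr fun n => ?_
    rw [(odd_two_mul_add_one n).neg_pow]
    ring
  rw [neg_sq] at h2
  rw [← pow_mul] at h3
  rw [h1, h2, show 4 = 2 * 2 from rfl]
  linear_combination (eulerProd (q ^ 2) ^ 2 * eulerProd (q ^ (2 * 2))) * h4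
    - eulerProd (q ^ 2) ^ 2 * h3

theorem eta_eq (z : ℂ) : eta z = cexp (π * I * z / 12) * eulerProd (cexp (2 * π * I * z)) := by
  rw [eta, eulerProd, Function.Periodic.qParam]
  congr 1
  · congr 1
    push_cast
    ring
  · simp [eta_q_eq_pow]

theorem eta_neg_one_div_sq {τ : ℂ} (hτ : 0 < τ.im) : eta (-1 / τ) ^ 2 = -I * τ * eta τ ^ 2 := by
  have h : eta (-1 / τ) = (sqrt I)⁻¹ * (sqrt τ * eta τ) := by
    simpa using eta_comp_eq_csqrt_I_inv hτ
  have hs (x : ℂ) : sqrt x ^ 2 = x := by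
    rw [Complex.sqrt]
    exact_mod_cast Complex.cpow_nat_inv_pow x two_ne_zero
  rw [h, mul_pow, mul_pow, inv_pow, hs, hs, Complex.inv_I]
  ring

/-- The nome `exp (π i τ)`. -/
noncomputable def nome (τ : ℂ) : ℂ := cexp (π * I * τ)

theorem nome_ne_zero (τ : ℂ) : nome τ ≠ 0 := Complex.exp_ne_zero _

theorem norm_nome (τ : ℂ) : ‖nome τ‖ = Real.exp (-π * τ.im) := by
  have := norm_exp_pi_I_mul 1 τ
  simpa [nome] using this

theorem norm_nome_lt_one {τ : ℂ} (hτ : 0 < τ.im) : ‖nome τ‖ < 1 := by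
  rw [norm_nome, Real.exp_lt_one_iff]
  nlinarith [Real.pi_pos]

theorem nome_add_one (τ : ℂ) : nome (τ + 1) = -nome τ := by
  rw [nome, mul_add, Complex.exp_add, mul_one, Complex.exp_pi_mul_I, nome]
  ring

theorem norm_pow_nome_lt_one {τ : ℂ} (hτ : 0 < τ.im) {k : ℕ} (hk : k ≠ 0) : ‖nome τ ^ k‖ < 1 := by
  rw [norm_pow]
  exact pow_lt_one₀ (norm_nonneg _) (norm_nome_lt_one hτ) hk

theorem tendsto_nome : Tendsto nome imTop (𝓝 0) := by
  rw [tendsto_zero_iff_norm_tendsto_zero]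
  simp only [norm_nome]
  exact Real.tendsto_exp_atBot.comp
    (Tendsto.const_mul_atTop_of_neg (neg_lt_zero.mpr Real.pi_pos) tendsto_comap)

theorem tendsto_eulerProd_nome_pow {k : ℕ} (hk : k ≠ 0) :
    Tendsto (fun τ => eulerProd (nome τ ^ k)) imTop (𝓝 1) := by
  refine tendsto_eulerProd.comp ?_
  simpa [hk] using tendsto_nome.pow k

theorem eta_half_pow_eight (τ : ℂ) :
    eta (τ / 2) ^ 8 = cexp (π * I * τ / 3) * eulerProd (nome τ) ^ 8 := by
  rw [eta_eq, mul_pow, ← Complex.exp_nat_mul, nome]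
  congr 2
  · push_cast; ring
  · congr 2; ring

theorem eta_two_mul_pow_eight (τ : ℂ) :
    eta (2 * τ) ^ 8 = cexp (4 * (π * I * τ) / 3) * eulerProd (nome τ ^ 4) ^ 8 := by
  rw [eta_eq, mul_pow, ← Complex.exp_nat_mul, nome, ← Complex.exp_nat_mul]
  congr 2
  · push_cast; ring
  · congr 2; push_cast; ring

theorem eta_pow_four (τ : ℂ) :
    eta τ ^ 4 = cexp (π * I * τ / 3) * eulerProd (nome τ ^ 2) ^ 4 := by
  rw [eta_eq, mul_pow, ← Complex.exp_nat_mul, nome, ← Complex.exp_nat_mul]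
  congr 2
  · push_cast; ring
  · congr 2; push_cast; ring

/-- The eta quotient that equals `θ₂ ^ 4`. -/
noncomputable def etaQuot2 (τ : ℂ) : ℂ := 16 * eta (2 * τ) ^ 8 / eta τ ^ 4

/-- The eta quotient that equals `θ₃ ^ 4`. -/
noncomputable def etaQuot3 (τ : ℂ) : ℂ := eta τ ^ 20 / (eta (τ / 2) ^ 8 * eta (2 * τ) ^ 8)

/-- The eta quotient that equals `θ₄ ^ 4`. -/
noncomputable def etaQuot4 (τ : ℂ) : ℂ := eta (τ / 2) ^ 8 / eta τ ^ 4

theorem etaQuot2_eq (τ : ℂ) :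
    etaQuot2 τ = 16 * nome τ * (eulerProd (nome τ ^ 4) ^ 8 / eulerProd (nome τ ^ 2) ^ 4) := by
  have h : cexp (4 * (π * I * τ) / 3) = nome τ * cexp (π * I * τ / 3) := by
    rw [nome, ← Complex.exp_add]
    congr 1
    ring
  have := Complex.exp_ne_zero (π * I * τ / 3)
  rw [etaQuot2, eta_two_mul_pow_eight, eta_pow_four, h]
  field_simp

theorem etaQuot4_eq (τ : ℂ) :
    etaQuot4 τ = eulerProd (nome τ) ^ 8 / eulerProd (nome τ ^ 2) ^ 4 := by
  have := Complex.exp_ne_zero (π * I * τ / 3)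
  rw [etaQuot4, eta_half_pow_eight, eta_pow_four]
  field_simp

theorem etaQuot3_eq (τ : ℂ) :
    etaQuot3 τ = eulerProd (nome τ ^ 2) ^ 20 / (eulerProd (nome τ) ^ 8 * eulerProd (nome τ ^ 4) ^ 8) := by
  have h0 := Complex.exp_ne_zero (π * I * τ / 3)
  have h : cexp (4 * (π * I * τ) / 3) = cexp (π * I * τ / 3) ^ 4 := by
    rw [← Complex.exp_nat_mul]
    congr 1
    push_cast
    ring
  rw [etaQuot3, show eta τ ^ 20 = (eta τ ^ 4) ^ 5 by ring, eta_half_pow_eight,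
    eta_two_mul_pow_eight, eta_pow_four, h]
  field_simp

theorem etaQuot2_add_one (τ : ℂ) : etaQuot2 (τ + 1) = -etaQuot2 τ := by
  rw [etaQuot2_eq, etaQuot2_eq, nome_add_one, (by decide : Even 4).neg_pow, neg_sq]
  ring

theorem etaQuot4_add_one {τ : ℂ} (hτ : 0 < τ.im) : etaQuot4 (τ + 1) = etaQuot3 τ := by
  have h := eulerProd_mul_neg (norm_nome_lt_one hτ)
  have h1 := eulerProd_ne_zero (norm_nome_lt_one hτ)
  have h2 := eulerProd_ne_zero (norm_pow_nome_lt_one hτ two_ne_zero)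
  have h4 := eulerProd_ne_zero (norm_pow_nome_lt_one hτ four_ne_zero)
  rw [etaQuot4_eq, etaQuot3_eq, nome_add_one, neg_sq]
  have h5 : eulerProd (-nome τ) = eulerProd (nome τ ^ 2) ^ 3 /
      (eulerProd (nome τ) * eulerProd (nome τ ^ 4)) := by
    rw [← h]; field_simp
  rw [h5]
  field_simp

theorem etaQuot3_add_one {τ : ℂ} (hτ : 0 < τ.im) : etaQuot3 (τ + 1) = etaQuot4 τ := by
  have h := eulerProd_mul_neg (norm_nome_lt_one hτ)
  have h1 := eulerProd_ne_zero (norm_nome_lt_one hτ)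
  have h2 := eulerProd_ne_zero (norm_pow_nome_lt_one hτ two_ne_zero)
  have h4 := eulerProd_ne_zero (norm_pow_nome_lt_one hτ four_ne_zero)
  rw [etaQuot3_eq, etaQuot4_eq, nome_add_one, neg_sq, (by decide : Even 4).neg_pow]
  have h5 : eulerProd (-nome τ) = eulerProd (nome τ ^ 2) ^ 3 /
      (eulerProd (nome τ) * eulerProd (nome τ ^ 4)) := by
    rw [← h]; field_simp
  rw [h5]
  field_simp

theorem eta_pow_four_neg_one_div {τ : ℂ} (hτ : 0 < τ.im) :
    eta (-1 / τ) ^ 4 = -τ ^ 2 * eta τ ^ 4 :=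
  pow_four_of_sq (eta_neg_one_div_sq hτ)

theorem eta_pow_eight_neg_one_div {τ : ℂ} (hτ : 0 < τ.im) :
    eta (-1 / τ) ^ 8 = τ ^ 4 * eta τ ^ 8 := by
  rw [show eta (-1 / τ) ^ 8 = (eta (-1 / τ) ^ 4) ^ 2 by ring, eta_pow_four_neg_one_div hτ]
  ring

theorem eta_two_mul_neg_one_div {τ : ℂ} (hτ : 0 < τ.im) :
    eta (2 * (-1 / τ)) ^ 8 = (τ / 2) ^ 4 * eta (τ / 2) ^ 8 := by
  rw [← eta_pow_eight_neg_one_div (by simpa using hτ)]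
  congr 2
  field_simp

theorem eta_half_neg_one_div {τ : ℂ} (hτ : 0 < τ.im) :
    eta (-1 / τ / 2) ^ 8 = (2 * τ) ^ 4 * eta (2 * τ) ^ 8 := by
  rw [← eta_pow_eight_neg_one_div (by simpa using hτ)]
  congr 2
  field_simp

theorem im_two_mul_pos {τ : ℂ} (hτ : 0 < τ.im) : 0 < (2 * τ).im := by simpa using hτ

theorem im_half_pos {τ : ℂ} (hτ : 0 < τ.im) : 0 < (τ / 2).im := by simpa using hτ

theorem etaQuot2_neg_one_div {τ : ℂ} (hτ : 0 < τ.im) :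
    etaQuot2 (-1 / τ) = -τ ^ 2 * etaQuot4 τ := by
  have h0 := ne_zero_of_im_pos hτ
  have h1 := eta_ne_zero hτ
  rw [etaQuot2, etaQuot4, eta_two_mul_neg_one_div hτ, eta_pow_four_neg_one_div hτ]
  field_simp
  norm_num

theorem etaQuot4_neg_one_div {τ : ℂ} (hτ : 0 < τ.im) :
    etaQuot4 (-1 / τ) = -τ ^ 2 * etaQuot2 τ := by
  have h0 := ne_zero_of_im_pos hτ
  have h1 := eta_ne_zero hτ
  rw [etaQuot2, etaQuot4, eta_half_neg_one_div hτ, eta_pow_four_neg_one_div hτ]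
  field_simp
  ring

theorem etaQuot3_neg_one_div {τ : ℂ} (hτ : 0 < τ.im) :
    etaQuot3 (-1 / τ) = -τ ^ 2 * etaQuot3 τ := by
  have h0 := ne_zero_of_im_pos hτ
  have h1 := eta_ne_zero hτ
  have h2 := eta_ne_zero (im_two_mul_pos hτ)
  have h3 := eta_ne_zero (im_half_pos hτ)
  rw [etaQuot3, etaQuot3, eta_half_neg_one_div hτ, eta_two_mul_neg_one_div hτ,
    show eta (-1 / τ) ^ 20 = (eta (-1 / τ) ^ 4) ^ 5 by ring, eta_pow_four_neg_one_div hτ]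
  field_simp

theorem etaQuot2_ne_zero {τ : ℂ} (hτ : 0 < τ.im) : etaQuot2 τ ≠ 0 :=
  div_ne_zero (mul_ne_zero (by norm_num) (pow_ne_zero _ (eta_ne_zero (im_two_mul_pos hτ))))
    (pow_ne_zero _ (eta_ne_zero hτ))

theorem etaQuot3_ne_zero {τ : ℂ} (hτ : 0 < τ.im) : etaQuot3 τ ≠ 0 :=
  div_ne_zero (pow_ne_zero _ (eta_ne_zero hτ))
    (mul_ne_zero (pow_ne_zero _ (eta_ne_zero (im_half_pos hτ)))
      (pow_ne_zero _ (eta_ne_zero (im_two_mul_pos hτ))))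

theorem etaQuot4_ne_zero {τ : ℂ} (hτ : 0 < τ.im) : etaQuot4 τ ≠ 0 :=
  div_ne_zero (pow_ne_zero _ (eta_ne_zero (im_half_pos hτ))) (pow_ne_zero _ (eta_ne_zero hτ))

theorem differentiableAt_eta_half {τ : ℂ} (hτ : 0 < τ.im) :
    DifferentiableAt ℂ (fun τ => eta (τ / 2)) τ :=
  (differentiableAt_eta_of_mem_upperHalfPlaneSet (im_half_pos hτ)).comp τ
    (f := fun τ : ℂ => τ / 2) (by fun_prop)

theorem differentiableAt_eta_two_mul {τ : ℂ} (hτ : 0 < τ.im) :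
    DifferentiableAt ℂ (fun τ => eta (2 * τ)) τ :=
  (differentiableAt_eta_of_mem_upperHalfPlaneSet (im_two_mul_pos hτ)).comp τ
    (f := fun τ : ℂ => 2 * τ) (by fun_prop)

theorem differentiableAt_etaQuot2 {τ : ℂ} (hτ : 0 < τ.im) : DifferentiableAt ℂ etaQuot2 τ :=
  (((differentiableAt_eta_two_mul hτ).pow 8).const_mul 16).div
    ((differentiableAt_eta_of_mem_upperHalfPlaneSet hτ).pow 4) (pow_ne_zero _ (eta_ne_zero hτ))

theorem differentiableAt_etaQuot3 {τ : ℂ} (hτ : 0 < τ.im) : DifferentiableAt ℂ etaQuot3 τ :=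
  ((differentiableAt_eta_of_mem_upperHalfPlaneSet hτ).pow 20).div
    (((differentiableAt_eta_half hτ).pow 8).mul ((differentiableAt_eta_two_mul hτ).pow 8))
    (mul_ne_zero (pow_ne_zero _ (eta_ne_zero (im_half_pos hτ)))
      (pow_ne_zero _ (eta_ne_zero (im_two_mul_pos hτ))))

theorem differentiableAt_etaQuot4 {τ : ℂ} (hτ : 0 < τ.im) : DifferentiableAt ℂ etaQuot4 τ :=
  ((differentiableAt_eta_half hτ).pow 8).div
    ((differentiableAt_eta_of_mem_upperHalfPlaneSet hτ).pow 4) (pow_ne_zero _ (eta_ne_zero hτ))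

theorem tendsto_etaQuot3 : Tendsto etaQuot3 imTop (𝓝 1) := by
  have h := (((tendsto_eulerProd_nome_pow two_ne_zero).pow 20).div
    (((tendsto_eulerProd_nome_pow one_ne_zero).pow 8).mul
      ((tendsto_eulerProd_nome_pow four_ne_zero).pow 8)) (by norm_num))
  refine (h.congr fun τ => ?_).trans (by simp)
  simp [etaQuot3_eq]

theorem tendsto_etaQuot4 : Tendsto etaQuot4 imTop (𝓝 1) := by
  have h := ((tendsto_eulerProd_nome_pow one_ne_zero).pow 8).div
    ((tendsto_eulerProd_nome_pow two_ne_zero).pow 4) (by norm_num)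
  refine (h.congr fun τ => ?_).trans (by simp)
  simp [etaQuot4_eq]

theorem tendsto_etaQuot2 : Tendsto (fun τ => etaQuot2 τ / nome τ) imTop (𝓝 16) := by
  have h := (((tendsto_eulerProd_nome_pow four_ne_zero).pow 8).div
    ((tendsto_eulerProd_nome_pow two_ne_zero).pow 4) (by norm_num)).const_mul 16
  refine (h.congr fun τ => ?_).trans (by simp)
  have := nome_ne_zero τ
  rw [etaQuot2_eq, Pi.div_apply]
  field_simp

theorem tendsto_theta2_pow_four : Tendsto (fun τ => theta2 τ ^ 4 / nome τ) imTop (𝓝 16) := by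
  have h := tendsto_theta2_mul_exp.pow 4
  refine (h.congr fun τ => ?_).trans (by norm_num)
  rw [mul_pow, ← Complex.exp_nat_mul, nome, div_eq_mul_inv (theta2 τ ^ 4), ← Complex.exp_neg]
  congr 2
  push_cast
  ring

/-- Theta fourth powers and eta quotients obey the same rules under T and S and have the same
leading behaviour at i∞, so `eq_zero_of_permuted` applies to the ratios minus 1. The eta quotients
have no zeros, which makes the ratios holomorphic and later shows that the theta constants do not
vanish. -/
theorem theta_pow_four_eq_etaQuot {τ : ℂ} (hτ : 0 < τ.im) :
    theta2 τ ^ 4 = etaQuot2 τ ∧ theta3 τ ^ 4 = etaQuot3 τ ∧ theta4 τ ^ 4 = etaQuot4 τ := by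
  have h := eq_zero_of_permuted (f₁ := fun τ => theta2 τ ^ 4 / etaQuot2 τ - 1)
    (f₂ := fun τ => theta3 τ ^ 4 / etaQuot3 τ - 1) (f₃ := fun τ => theta4 τ ^ 4 / etaQuot4 τ - 1)
    (fun z hz => ((((differentiableAt_theta2 hz).pow 4).div (differentiableAt_etaQuot2 hz)
      (etaQuot2_ne_zero hz)).sub_const 1).differentiableWithinAt)
    (fun z hz => ((((differentiableAt_theta3 hz).pow 4).div (differentiableAt_etaQuot3 hz)
      (etaQuot3_ne_zero hz)).sub_const 1).differentiableWithinAt)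
    (fun z hz => ((((differentiableAt_theta4 hz).pow 4).div (differentiableAt_etaQuot4 hz)
      (etaQuot4_ne_zero hz)).sub_const 1).differentiableWithinAt)
    (fun z hz => by simp only [theta2_add_one_pow_four, etaQuot2_add_one, neg_div_neg_eq])
    (fun z hz => by simp only [theta3_add_one, etaQuot3_add_one hz])
    (fun z hz => by simp only [theta4_add_one, etaQuot4_add_one hz])
    (fun z hz => by
      simp only [pow_four_of_sq (theta2_sq_neg_one_div hz), etaQuot2_neg_one_div hz]
      rw [mul_div_mul_left _ _ (neg_ne_zero.mpr (pow_ne_zero _ (ne_zero_of_im_pos hz)))])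
    (fun z hz => by
      simp only [pow_four_of_sq (theta3_sq_neg_one_div hz), etaQuot3_neg_one_div hz]
      rw [mul_div_mul_left _ _ (neg_ne_zero.mpr (pow_ne_zero _ (ne_zero_of_im_pos hz)))])
    (fun z hz => by
      simp only [pow_four_of_sq (theta4_sq_neg_one_div hz), etaQuot4_neg_one_div hz]
      rw [mul_div_mul_left _ _ (neg_ne_zero.mpr (pow_ne_zero _ (ne_zero_of_im_pos hz)))])
    (by
      have := (tendsto_theta2_pow_four.div tendsto_etaQuot2 (by norm_num)).sub_const 1
      refine (this.congr fun τ => ?_).trans (by norm_num)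
      have := nome_ne_zero τ
      simp only [Pi.div_apply]
      field_simp)
    (by simpa using ((tendsto_theta3.pow 4).div tendsto_etaQuot3 one_ne_zero).sub_const 1)
    (by simpa using ((tendsto_theta4.pow 4).div tendsto_etaQuot4 one_ne_zero).sub_const 1) hτ
  refine ⟨?_, ?_, ?_⟩
  · exact (div_eq_one_iff_eq (etaQuot2_ne_zero hτ)).mp (sub_eq_zero.mp h.1)
  · exact (div_eq_one_iff_eq (etaQuot3_ne_zero hτ)).mp (sub_eq_zero.mp h.2.1)
  · exact (div_eq_one_iff_eq (etaQuot4_ne_zero hτ)).mp (sub_eq_zero.mp h.2.2)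

theorem theta2_ne_zero {τ : ℂ} (hτ : 0 < τ.im) : theta2 τ ≠ 0 := by
  have h := etaQuot2_ne_zero hτ
  rw [← (theta_pow_four_eq_etaQuot hτ).1] at h
  exact fun h0 => h (by simp [h0])

theorem theta3_ne_zero {τ : ℂ} (hτ : 0 < τ.im) : theta3 τ ≠ 0 := by
  have h := etaQuot3_ne_zero hτ
  rw [← (theta_pow_four_eq_etaQuot hτ).2.1] at h
  exact fun h0 => h (by simp [h0])

theorem theta4_ne_zero {τ : ℂ} (hτ : 0 < τ.im) : theta4 τ ≠ 0 := by
  have h := etaQuot4_ne_zero hτ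
  rw [← (theta_pow_four_eq_etaQuot hτ).2.2] at h
  exact fun h0 => h (by simp [h0])

/-! ### The modular lambda function in terms of theta constants -/

theorem modularLambda_eq {τ : ℂ} (hτ : 0 < τ.im) :
    modularLambda τ = theta2 τ ^ 4 / theta3 τ ^ 4 := by
  have h1 := eta_ne_zero hτ
  have h2 := eta_ne_zero (im_two_mul_pos hτ)
  have h3 := eta_ne_zero (im_half_pos hτ)
  obtain ⟨e2, e3, -⟩ := theta_pow_four_eq_etaQuot hτ
  rw [e2, e3, modularLambda, etaQuot2, etaQuot3]
  field_simp

theorem one_sub_modularLambda {τ : ℂ} (hτ : 0 < τ.im) :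
    1 - modularLambda τ = theta4 τ ^ 4 / theta3 τ ^ 4 := by
  have h3 := theta3_ne_zero hτ
  rw [modularLambda_eq hτ]
  field_simp
  rw [theta3_pow_four hτ]
  ring

theorem modularLambda_ne_zero {τ : ℂ} (hτ : 0 < τ.im) : modularLambda τ ≠ 0 := by
  rw [modularLambda_eq hτ]
  exact div_ne_zero (pow_ne_zero _ (theta2_ne_zero hτ)) (pow_ne_zero _ (theta3_ne_zero hτ))

theorem one_sub_modularLambda_ne_zero {τ : ℂ} (hτ : 0 < τ.im) : 1 - modularLambda τ ≠ 0 := by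
  rw [one_sub_modularLambda hτ]
  exact div_ne_zero (pow_ne_zero _ (theta4_ne_zero hτ)) (pow_ne_zero _ (theta3_ne_zero hτ))

theorem im_add_one_pos {τ : ℂ} (hτ : 0 < τ.im) : 0 < (τ + 1).im := by simpa using hτ

theorem modularLambda_add_one {τ : ℂ} (hτ : 0 < τ.im) :
    modularLambda (τ + 1) = modularLambda τ / (modularLambda τ - 1) := by
  have h3 := theta3_ne_zero hτ
  have h4 := theta4_ne_zero hτ
  have e : modularLambda τ - 1 = -(theta4 τ ^ 4 / theta3 τ ^ 4) := by
    rw [← one_sub_modularLambda hτ]; ring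
  rw [e, modularLambda_eq hτ, modularLambda_eq (im_add_one_pos hτ), theta3_add_one,
    theta2_add_one_pow_four]
  field_simp

theorem modularLambda_neg_one_div {τ : ℂ} (hτ : 0 < τ.im) :
    modularLambda (-1 / τ) = 1 - modularLambda τ := by
  have h0 := ne_zero_of_im_pos hτ
  rw [modularLambda_eq (neg_one_div_im_pos hτ), one_sub_modularLambda hτ,
    pow_four_of_sq (theta2_sq_neg_one_div hτ), pow_four_of_sq (theta3_sq_neg_one_div hτ),
    mul_div_mul_left _ _ (neg_ne_zero.mpr (pow_ne_zero _ h0))]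

theorem differentiableAt_modularLambda {τ : ℂ} (hτ : 0 < τ.im) :
    DifferentiableAt ℂ modularLambda τ :=
  ((((differentiableAt_eta_half hτ).pow 8).const_mul 16).mul
    ((differentiableAt_eta_two_mul hτ).pow 16)).div
    ((differentiableAt_eta_of_mem_upperHalfPlaneSet hτ).pow 24) (pow_ne_zero _ (eta_ne_zero hτ))

theorem tendsto_modularLambda_div_nome :
    Tendsto (fun τ => modularLambda τ / nome τ) imTop (𝓝 16) := by
  have h := tendsto_theta2_pow_four.div (tendsto_theta3.pow 4) (by norm_num)
  refine (h.congr' ?_).trans (by norm_num)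
  filter_upwards [eventually_imTop_lt 0] with τ hτ
  have h3 := theta3_ne_zero hτ
  have := nome_ne_zero τ
  simp only [Pi.div_apply]
  rw [modularLambda_eq hτ]
  field_simp

theorem tendsto_modularLambda : Tendsto modularLambda imTop (𝓝 0) := by
  have h := tendsto_modularLambda_div_nome.mul tendsto_nome
  rw [mul_zero] at h
  refine h.congr fun τ => ?_
  have := nome_ne_zero τ
  field_simp

end EpsteinRepn

/-! ### The derivative of the modular lambda function -/

namespace EpsteinRepn
open Complex hiding eta
open Filter Topology ModularForm EisensteinSeries
open scoped Real ArithmeticFunction.sigma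

theorem isOpen_im_pos : IsOpen {z : ℂ | 0 < z.im} := isOpen_lt continuous_const continuous_im

/-- The logarithmic derivative of eta is (πi/12) E₂, and E₂ tends to 1 by its q-expansion. -/
theorem tendsto_logDeriv_eta : Tendsto (logDeriv eta) imTop (𝓝 (π * I / 12)) := by
  have hs : Summable fun n : ℕ+ => ‖(σ 1 n : ℂ)‖ * Real.exp (-π * ((2 * n : ℕ) : ℕ)) := by
    have h := ((summable_sigma_mul_cexp_pow (k := 2) one_le_two
      UpperHalfPlane.I).norm).comp_injective (i := ((↑) : ℕ+ → ℕ)) PNat.coe_injective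
    refine h.congr fun n => ?_
    simp only [Function.comp, norm_mul, norm_pow]
    congr 1
    rw [← norm_pow, ← Complex.exp_nat_mul, Complex.norm_exp]
    congr 1
    simp
    ring
  have h := tendsto_tsum_exp_imTop hs
  have h0 : (∑' n : ℕ+, if (2 * n : ℕ) = 0 then (σ 1 n : ℂ) else 0) = 0 := by
    simp
  rw [h0] at h
  have h1 := ((h.const_mul 24).const_sub 1).const_mul (π * I / 12)
  simp only [mul_zero, sub_zero, mul_one] at h1
  refine h1.congr' ?_
  filter_upwards [eventually_imTop_lt 0] with τ hτ
  have e := logDeriv_eta_eq_E2 ⟨τ, hτ⟩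
  rw [E2_eq_tsum_cexp] at e
  rw [show logDeriv eta τ = _ from e]
  congr 3
  refine tsum_congr fun n => ?_
  congr 1
  rw [← Complex.exp_nat_mul]
  congr 1
  push_cast
  ring

/-- The coefficients are exponent times inner derivative: 8 · 1/2, 16 · 2 and -24. -/
theorem logDeriv_modularLambda {τ : ℂ} (hτ : 0 < τ.im) :
    logDeriv modularLambda τ =
      4 * logDeriv eta (τ / 2) + 32 * logDeriv eta (2 * τ) - 24 * logDeriv eta τ := by
  have h1 := eta_ne_zero hτ
  have h2 := eta_ne_zero (im_two_mul_pos hτ)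
  have h3 := eta_ne_zero (im_half_pos hτ)
  have d1 := (differentiableAt_eta_of_mem_upperHalfPlaneSet hτ).hasDerivAt
  have d2 := (differentiableAt_eta_of_mem_upperHalfPlaneSet (im_two_mul_pos hτ)).hasDerivAt
  have d3 := (differentiableAt_eta_of_mem_upperHalfPlaneSet (im_half_pos hτ)).hasDerivAt
  have c2 := d2.comp τ ((hasDerivAt_id τ).const_mul 2)
  have c3 := d3.comp τ ((hasDerivAt_id τ).div_const 2)
  have h := (((c3.pow 8).const_mul 16).mul (c2.pow 16)).div (d1.pow 24) (pow_ne_zero _ h1)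
  rw [logDeriv_apply, logDeriv_apply, logDeriv_apply, logDeriv_apply, show deriv modularLambda τ = _ from h.deriv,
    modularLambda]
  simp only [Function.comp, id, Pi.pow_apply, Pi.mul_apply]
  clear h c2 c3 d1 d2 d3
  generalize deriv eta (2 * τ) = A', deriv eta (τ / 2) = B', deriv eta τ = C'
  generalize eta (2 * τ) = A, eta (τ / 2) = B, eta τ = C at *
  field_simp
  push_cast
  ring

theorem tendsto_mul_imTop {c : ℝ} (hc : 0 < c) : Tendsto (fun τ : ℂ => c * τ) imTop imTop := by
  rw [tendsto_comap_iff]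
  refine ((tendsto_comap (f := Complex.im) (x := atTop)).const_mul_atTop hc).congr fun τ => ?_
  simp

theorem tendsto_logDeriv_modularLambda : Tendsto (logDeriv modularLambda) imTop (𝓝 (π * I)) := by
  have h1 := tendsto_logDeriv_eta.comp (tendsto_mul_imTop (c := 1 / 2) (by norm_num))
  have h2 := tendsto_logDeriv_eta.comp (tendsto_mul_imTop (c := 2) (by norm_num))
  have h := ((h1.const_mul 4).add (h2.const_mul 32)).sub (tendsto_logDeriv_eta.const_mul 24)
  rw [show 4 * (π * I / 12) + 32 * (π * I / 12) - 24 * (π * I / 12) = π * I by ring] at h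
  refine h.congr' ?_
  filter_upwards [eventually_imTop_lt 0] with τ hτ
  rw [logDeriv_modularLambda hτ]
  simp only [Function.comp]
  congr 4
  · push_cast; ring
  
theorem deriv_modularLambda_add_one {τ : ℂ} (hτ : 0 < τ.im) :
    deriv modularLambda (τ + 1) = -deriv modularLambda τ / (modularLambda τ - 1) ^ 2 := by
  have hne : modularLambda τ - 1 ≠ 0 := by
    have := one_sub_modularLambda_ne_zero hτ
    rwa [← neg_ne_zero, neg_sub]
  have d := (differentiableAt_modularLambda hτ).hasDerivAt
  have e : (fun z => modularLambda (z + 1)) =ᶠ[𝓝 τ]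
      fun z => modularLambda z / (modularLambda z - 1) := by
    filter_upwards [isOpen_im_pos.mem_nhds hτ] with z hz using modularLambda_add_one hz
  rw [← deriv_comp_add_const, e.deriv_eq]
  refine ((d.div (d.sub_const 1) hne).congr_deriv ?_).deriv
  congr 1
  ring

theorem deriv_modularLambda_neg_one_div {τ : ℂ} (hτ : 0 < τ.im) :
    deriv modularLambda (-1 / τ) = -τ ^ 2 * deriv modularLambda τ := by
  have h0 := ne_zero_of_im_pos hτ
  have d := (differentiableAt_modularLambda hτ).hasDerivAt
  have d2 := (differentiableAt_modularLambda (neg_one_div_im_pos hτ)).hasDerivAt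
  have d3 : HasDerivAt (fun z : ℂ => -1 / z) (1 / τ ^ 2) τ := by
    refine ((hasDerivAt_const τ (-1 : ℂ)).div (hasDerivAt_id τ) h0).congr_deriv ?_
    simp
  have d4 := d2.comp τ d3
  have e : (modularLambda ∘ fun z => -1 / z) =ᶠ[𝓝 τ] fun z => 1 - modularLambda z := by
    filter_upwards [isOpen_im_pos.mem_nhds hτ] with z hz using modularLambda_neg_one_div hz
  have h := (d4.congr_of_eventuallyEq e.symm).unique (d.const_sub 1)
  field_simp at h
  rw [neg_div, h]
  ring

/-- The derivative of the modular lambda function. -/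
theorem deriv_modularLambda {τ : ℂ} (hτ : 0 < τ.im) :
    deriv modularLambda τ =
      π * I * modularLambda τ * (1 - modularLambda τ) * theta3 τ ^ 4 := by
  have hne {z : ℂ} (hz : 0 < z.im) : modularLambda z * (1 - modularLambda z) * theta3 z ^ 4 ≠ 0 :=
    mul_ne_zero (mul_ne_zero (modularLambda_ne_zero hz) (one_sub_modularLambda_ne_zero hz))
      (pow_ne_zero _ (theta3_ne_zero hz))
  have hd : DifferentiableOn ℂ modularLambda {z | 0 < z.im} := fun z hz =>
    (differentiableAt_modularLambda hz).differentiableWithinAt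
  -- Numerator and denominator acquire the same factors under T and S, so the quotient is modular of
  -- weight 0; its value is read off from the logarithmic derivative of λ at i∞, where 1 - λ and θ₃
  -- tend to 1.
  have h := exists_const_of_invariant (c := π * I) (f := fun z => deriv modularLambda z /
      (modularLambda z * (1 - modularLambda z) * theta3 z ^ 4))
    (DifferentiableOn.div (hd.deriv isOpen_im_pos)
      (fun z hz => (((differentiableAt_modularLambda hz).mul
        ((differentiableAt_modularLambda hz).const_sub 1)).mul
        ((differentiableAt_theta3 hz).pow 4)).differentiableWithinAt) fun z hz => hne hz)
    (fun z hz => by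
      have hl : modularLambda z - 1 ≠ 0 := by
        have := one_sub_modularLambda_ne_zero hz
        rwa [← neg_ne_zero, neg_sub]
      have e4 : theta4 z ^ 4 = (1 - modularLambda z) * theta3 z ^ 4 := by
        rw [one_sub_modularLambda hz, div_mul_cancel₀ _ (pow_ne_zero _ (theta3_ne_zero hz))]
      have h1 := modularLambda_ne_zero hz
      have h2 := one_sub_modularLambda_ne_zero hz
      have h3 := theta3_ne_zero hz
      simp only [deriv_modularLambda_add_one hz, modularLambda_add_one hz, theta3_add_one, e4]
      have e5 : 1 - modularLambda z / (modularLambda z - 1) = -1 / (modularLambda z - 1) := by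
        field_simp
        ring
      rw [e5]
      field_simp)
    (fun z hz => by
      have h0 := ne_zero_of_im_pos hz
      have := hne hz
      simp only [deriv_modularLambda_neg_one_div hz, modularLambda_neg_one_div hz,
        pow_four_of_sq (theta3_sq_neg_one_div hz)]
      rw [← mul_div_mul_left (deriv modularLambda z) _ (neg_ne_zero.mpr (pow_ne_zero 2 h0))]
      congr 1
      ring)
    (by
      have h := tendsto_logDeriv_modularLambda.div
        ((tendsto_modularLambda.const_sub 1).mul (tendsto_theta3.pow 4)) (by simp)
      refine (h.congr fun τ => ?_).trans (by simp)
      simp only [Pi.div_apply, logDeriv_apply]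
      rw [div_div, mul_assoc])
    hτ
  rw [div_eq_iff (hne hτ)] at h
  rw [h]
  ring

theorem hasDerivAt_modularLambda {τ : ℂ} (hτ : 0 < τ.im) :
    HasDerivAt modularLambda
      (π * I * modularLambda τ * (1 - modularLambda τ) * theta3 τ ^ 4) τ := by
  rw [← deriv_modularLambda hτ]
  exact (differentiableAt_modularLambda hτ).hasDerivAt

end EpsteinRepn

/-! ### Double q-series and their termwise derivatives -/

namespace EpsteinRepn
open Complex hiding eta
open Filter Topology ModularForm EisensteinSeries
open scoped Real ArithmeticFunction.sigma Nat

theorem hasDerivAt_tsum_exp {ι : Type*} {c : ι → ℂ} {e : ι → ℕ}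
    (h : ∀ δ : ℝ, 0 < δ → Summable fun i => ‖c i‖ * Real.exp (-π * e i * δ))
    (h' : ∀ δ : ℝ, 0 < δ → Summable fun i => ‖c i‖ * e i * Real.exp (-π * e i * δ))
    {τ : ℂ} (hτ : 0 < τ.im) :
    HasDerivAt (fun τ : ℂ => ∑' i, c i * cexp (π * I * (e i : ℝ) * τ))
      (∑' i, c i * (π * I * e i) * cexp (π * I * (e i : ℝ) * τ)) τ := by
  -- On the half-plane above half the height of τ the differentiated series has a uniform summable
  -- bound.
  have hδ : 0 < τ.im / 2 := by positivity
  have hmem : τ ∈ {z : ℂ | τ.im / 2 < z.im} := half_lt_self hτ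
  refine hasDerivAt_tsum_of_isPreconnected (u := fun i => π * (‖c i‖ * e i *
    Real.exp (-π * e i * (τ.im / 2)))) ((h' _ hδ).mul_left π)
    (g := fun i (τ : ℂ) => c i * cexp (π * I * (e i : ℝ) * τ))
    (g' := fun i (τ : ℂ) => c i * (π * I * e i) * cexp (π * I * (e i : ℝ) * τ))
    (t := {z : ℂ | τ.im / 2 < z.im}) (isOpen_lt continuous_const continuous_im)
    (convex_halfSpace_im_gt _).isPreconnected (fun i y hy => ?_) (fun i y hy => ?_)
    (y₀ := τ) hmem ?_ hmem
  · have h1 := ((hasDerivAt_id y).const_mul (π * I * (e i : ℝ))).cexp.const_mul (c i)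
    refine h1.congr_deriv ?_
    simp only [id, mul_one, ofReal_natCast]
    ring
  · rw [norm_mul, norm_mul, norm_exp_pi_I_mul]
    have e1 : ‖(π * I * (e i : ℂ))‖ = π * e i := by
      simp [abs_of_pos Real.pi_pos]
    rw [e1]
    have : Real.exp (-π * (e i : ℝ) * y.im) ≤ Real.exp (-π * (e i : ℝ) * (τ.im / 2)) := by
      apply Real.exp_le_exp.mpr
      have : (0 : ℝ) ≤ π * e i := by positivity
      have hy' : τ.im / 2 ≤ y.im := le_of_lt hy
      nlinarith
    calc ‖c i‖ * (π * e i) * Real.exp (-π * (e i : ℝ) * y.im)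
        ≤ ‖c i‖ * (π * e i) * Real.exp (-π * (e i : ℝ) * (τ.im / 2)) := by gcongr
      _ = _ := by ring
  · refine Summable.of_norm ((h _ hτ).congr fun i => ?_)
    rw [norm_mul, norm_exp_pi_I_mul]

/-- The coefficients of the double `q`-series `qs j l`. -/
noncomputable def qsCoeff (j l : ℕ) (p : ℕ × ℕ) : ℂ :=
  (-1) ^ (p.2 + 1) * ((p.2 : ℂ) + 1) ^ j / (2 * (p.1 : ℂ) + 1) ^ l

/-- The frequencies of the double `q`-series `qs j l`. -/
def qsFreq (p : ℕ × ℕ) : ℕ := (p.2 + 1) * (2 * p.1 + 1)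

/-- The double `q`-series `∑ (-1) ^ n n ^ j a ^ (-l) exp (π i n a τ)` over `n ≥ 1` and odd
`a ≥ 1`. -/
noncomputable def qs (j l : ℕ) (τ : ℂ) : ℂ :=
  ∑' p : ℕ × ℕ, qsCoeff j l p * cexp (π * I * (qsFreq p : ℝ) * τ)

theorem norm_qsCoeff_le (j l : ℕ) (p : ℕ × ℕ) : ‖qsCoeff j l p‖ ≤ ((p.2 : ℝ) + 1) ^ j := by
  have h1 : ‖((p.2 : ℂ) + 1)‖ = (p.2 : ℝ) + 1 := by
    exact_mod_cast Complex.norm_natCast (p.2 + 1)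
  have h2 : ‖(2 * (p.1 : ℂ) + 1)‖ = 2 * (p.1 : ℝ) + 1 := by
    exact_mod_cast Complex.norm_natCast (2 * p.1 + 1)
  rw [qsCoeff, norm_div, norm_mul, norm_pow, norm_pow, norm_pow, h1, h2]
  simp only [norm_neg, norm_one, one_pow, one_mul]
  refine div_le_self (by positivity) (one_le_pow₀ ?_)
  have : (0 : ℝ) ≤ p.1 := Nat.cast_nonneg _
  linarith

theorem summable_pow_mul_exp_prod (J : ℕ) {δ : ℝ} (hδ : 0 < δ) :
    Summable fun p : ℕ × ℕ => ((p.2 : ℝ) + 1) ^ J * Real.exp (-δ * (p.1 + p.2)) := by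
  have h1 : Summable fun n : ℕ => Real.exp (-δ * n) := by
    simpa using Real.summable_pow_mul_exp_neg_nat_mul 0 hδ
  have h2 : Summable fun n : ℕ => ((n : ℝ) + 1) ^ J * Real.exp (-δ * n) := by
    have := ((summable_nat_add_iff 1).mpr
      (Real.summable_pow_mul_exp_neg_nat_mul J hδ)).mul_left (Real.exp δ)
    refine this.congr fun n => ?_
    rw [mul_left_comm, ← Real.exp_add]
    congr 2
    · push_cast; ring
    · push_cast; ring
  refine (h1.mul_of_nonneg h2 (fun _ => by positivity) (fun _ => by positivity)).congr fun p => ?_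
  rw [mul_left_comm, ← Real.exp_add]
  congr 2
  ring

theorem add_le_qsFreq (p : ℕ × ℕ) : p.1 + p.2 + 1 ≤ qsFreq p := by
  rw [qsFreq]
  nlinarith

/-- The frequency, which is at least 1, is lowered by 1 so that the bound still applies after
division by the nome in `tendsto_qs_div_nome`. -/
theorem summable_qsCoeff_shift (j l : ℕ) {δ : ℝ} (hδ : 0 < δ) :
    Summable fun p : ℕ × ℕ => ‖qsCoeff j l p‖ * Real.exp (-δ * ((qsFreq p - 1 : ℕ) : ℝ)) := by
  refine (summable_pow_mul_exp_prod j hδ).of_nonneg_of_le (fun p => by positivity) fun p => ?_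
  refine mul_le_mul (norm_qsCoeff_le j l p) (Real.exp_le_exp.mpr ?_) (by positivity)
    (by positivity)
  have h : ((p.1 + p.2 : ℕ) : ℝ) ≤ ((qsFreq p - 1 : ℕ) : ℝ) := by
    exact_mod_cast Nat.le_sub_one_of_lt (add_le_qsFreq p)
  push_cast at h
  nlinarith

theorem summable_qsCoeff (j l : ℕ) {δ : ℝ} (hδ : 0 < δ) :
    Summable fun p : ℕ × ℕ => ‖qsCoeff j l p‖ * Real.exp (-δ * (qsFreq p : ℝ)) := by
  refine (summable_qsCoeff_shift j l hδ).of_nonneg_of_le (fun p => by positivity) fun p => ?_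
  refine mul_le_mul_of_nonneg_left (Real.exp_le_exp.mpr ?_) (norm_nonneg _)
  have h : ((qsFreq p - 1 : ℕ) : ℝ) ≤ (qsFreq p : ℝ) := by exact_mod_cast Nat.sub_le _ _
  nlinarith

theorem summable_qs (j l : ℕ) {τ : ℂ} (hτ : 0 < τ.im) :
    Summable fun p : ℕ × ℕ => qsCoeff j l p * cexp (π * I * (qsFreq p : ℝ) * τ) := by
  refine Summable.of_norm ((summable_qsCoeff j l (δ := π * τ.im) (by positivity)).congr
    fun p => ?_)
  rw [norm_mul, norm_exp_pi_I_mul]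
  congr 2
  ring

/-- Differentiation brings down the frequency na, which raises the power of n and cancels one 1/a.
Hence integrating `qs (2 * m + 1) 0` repeatedly stays inside the family `qs`. -/
theorem qsCoeff_mul_freq (j l : ℕ) (p : ℕ × ℕ) :
    qsCoeff j (l + 1) p * qsFreq p = qsCoeff (j + 1) l p := by
  have h2 : (2 * (p.1 : ℂ) + 1) ≠ 0 := by exact_mod_cast Nat.succ_ne_zero (2 * p.1)
  rw [qsCoeff, qsCoeff, qsFreq]
  push_cast
  field_simp
  ring

theorem hasDerivAt_qs (j l : ℕ) {τ : ℂ} (hτ : 0 < τ.im) :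
    HasDerivAt (qs j (l + 1)) (π * I * qs (j + 1) l τ) τ := by
  have h := hasDerivAt_tsum_exp (c := qsCoeff j (l + 1)) (e := qsFreq)
    (fun δ hδ => (summable_qsCoeff j (l + 1) (δ := π * δ) (by positivity)).congr fun p => by
      congr 2; ring)
    (fun δ hδ => (summable_qsCoeff (j + 1) l (δ := π * δ) (by positivity)).congr fun p => by
      rw [← qsCoeff_mul_freq, norm_mul, Complex.norm_natCast]; congr 2; ring) hτ
  refine h.congr_deriv ?_
  rw [qs, ← tsum_mul_left]
  refine tsum_congr fun p => ?_
  rw [← qsCoeff_mul_freq]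
  ring

/-- There is no factor 1/a left to cancel as in `hasDerivAt_qs`; half of the exponential decay
absorbs the extra frequency instead. -/
theorem differentiableAt_qs_zero (j : ℕ) {τ : ℂ} (hτ : 0 < τ.im) :
    DifferentiableAt ℂ (qs j 0) τ := by
  have hf (p : ℕ × ℕ) : (qsFreq p : ℝ) ≤ (2 * p.1 + 1) * (p.2 + 1) := by
    rw [qsFreq]; push_cast; linarith
  refine (hasDerivAt_tsum_exp (c := qsCoeff j 0) (e := qsFreq)
    (fun δ hδ => (summable_qsCoeff j 0 (δ := π * δ) (by positivity)).congr fun p => by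
      congr 2; ring) (fun δ hδ => ?_) hτ).differentiableAt
  refine (((summable_qsCoeff j 0 (δ := π * δ / 2) (by positivity))).mul_left
    (2 / (π * δ))).of_nonneg_of_le (fun p => by positivity) fun p => ?_
  have h1 : (qsFreq p : ℝ) * (π * δ / 2) ≤ Real.exp (π * δ / 2 * qsFreq p) := by
    have := Real.add_one_le_exp (π * δ / 2 * qsFreq p)
    nlinarith
  have h2 : Real.exp (-π * qsFreq p * δ) =
      Real.exp (-(π * δ / 2) * qsFreq p) * (Real.exp (π * δ / 2 * qsFreq p))⁻¹ := by
    rw [← Real.exp_neg, ← Real.exp_add]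
    congr 1
    ring
  rw [h2]
  have h3 := Real.exp_pos (π * δ / 2 * qsFreq p)
  have h4 : (qsFreq p : ℝ) * (Real.exp (π * δ / 2 * qsFreq p))⁻¹ ≤ 2 / (π * δ) := by
    rw [← div_eq_mul_inv, div_le_div_iff₀ h3 (by positivity)]
    linarith
  calc ‖qsCoeff j 0 p‖ * qsFreq p * (Real.exp (-(π * δ / 2) * qsFreq p) *
        (Real.exp (π * δ / 2 * qsFreq p))⁻¹)
      = ((qsFreq p : ℝ) * (Real.exp (π * δ / 2 * qsFreq p))⁻¹) *
        (‖qsCoeff j 0 p‖ * Real.exp (-(π * δ / 2) * qsFreq p)) := by ring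
    _ ≤ _ := mul_le_mul_of_nonneg_right h4 (by positivity)

theorem tendsto_qs_div_nome (j l : ℕ) : Tendsto (fun τ => qs j l τ / nome τ) imTop (𝓝 (-1)) := by
  have h := tendsto_tsum_exp_imTop (c := qsCoeff j l) (e := fun p => qsFreq p - 1)
    (summable_qsCoeff_shift j l Real.pi_pos)
  have h0 : (∑' p : ℕ × ℕ, if qsFreq p - 1 = 0 then qsCoeff j l p else 0) = -1 := by
    -- Only n = a = 1 has frequency 1, and its sign is (-1)^1.
    rw [tsum_eq_single (0, 0)]
    · simp [qsFreq, qsCoeff]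
    · rintro ⟨a, n⟩ hp
      have h1 := add_le_qsFreq (a, n)
      have h2 : ¬ (a = 0 ∧ n = 0) := by simpa using hp
      have h3 : qsFreq (a, n) - 1 ≠ 0 := by
        simp only at h1
        omega
      simp [h3]
  rw [h0] at h
  refine h.congr fun τ => ?_
  rw [qs, ← tsum_div_const]
  refine tsum_congr fun p => ?_
  rw [mul_div_assoc, nome, ← Complex.exp_sub]
  congr 2
  have h1 : ((qsFreq p - 1 : ℕ) : ℂ) = qsFreq p - 1 := by
    rw [Nat.cast_sub (le_trans (Nat.le_add_left 1 _) (add_le_qsFreq p)), Nat.cast_one]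
  simp only [ofReal_natCast, h1]
  ring

/-- The sum `∑ n ^ j exp (2 π i n w)` over `n ≥ 1`. -/
noncomputable def expSum (j : ℕ) (w : ℂ) : ℂ :=
  ∑' n : ℕ, ((n : ℂ) + 1) ^ j * cexp (2 * π * I * w) ^ (n + 1)

/-- Sum over n first. The sign (-1)^n comes from the 1/2 added to (2a + 1)τ/2, because exp(πi) = -1;
thus each row is a Lipschitz series at a point of the upper half-plane. -/
theorem hasSum_qs (j l : ℕ) {τ : ℂ} (hτ : 0 < τ.im) :
    HasSum (fun a : ℕ => ((2 * (a : ℂ) + 1) ^ l)⁻¹ * expSum j (((2 * a + 1) * τ + 1) / 2))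
      (qs j l τ) := by
  have h := (summable_qs j l hτ).hasSum
  refine (h.prod_fiberwise (fun a => ((summable_qs j l hτ).prod_factor a).hasSum)).congr_fun
    fun a => ?_
  rw [expSum, ← tsum_mul_left]
  refine tsum_congr fun n => ?_
  have e : cexp (2 * π * I * (((2 * a + 1) * τ + 1) / 2)) =
      -cexp (π * I * ((2 * a + 1) * τ)) := by
    rw [← neg_one_mul, ← Complex.exp_pi_mul_I, ← Complex.exp_add]
    congr 1
    ring
  rw [e, qsCoeff, qsFreq, neg_pow, ← Complex.exp_nat_mul]
  have e2 : π * I * ((((n + 1) * (2 * a + 1) : ℕ) : ℝ) : ℂ) * τ =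
      (n + 1 : ℕ) * (π * I * ((2 * a + 1) * τ)) := by
    push_cast
    ring
  simp only [e2]
  ring

theorem tsum_inv_add_int_pow {k : ℕ} (hk : 1 ≤ k) {w : ℂ} (hw : 0 < w.im) :
    ∑' d : ℤ, 1 / (w + d) ^ (k + 1) = (-2 * π * I) ^ (k + 1) / k ! * expSum k w := by
  have h := EisensteinSeries.qExpansion_identity hk ⟨w, hw⟩
  have hs := UpperHalfPlane.norm_exp_two_pi_I_lt_one ⟨w, hw⟩
  have h2 : Summable fun n : ℕ => (n : ℂ) ^ k * cexp (2 * π * I * w) ^ n :=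
    summable_pow_mul_geometric_of_norm_lt_one k hs
  rw [show ∑' d : ℤ, 1 / (w + d) ^ (k + 1) = _ from h]
  congr 1
  rw [expSum]
  refine (h2.tsum_eq_zero_add).trans ?_
  simp [show k ≠ 0 by omega]

/-! ### Lattice sums over residue classes modulo 2 -/

/-- The sum of `(c τ + d) ^ (-k)` over the pairs `(c, d)` congruent to `(α, β)` modulo `2`. -/
noncomputable def latSum (α β : ℤ) (k : ℕ) (τ : ℂ) : ℂ :=
  ∑' p : ℤ × ℤ, (((2 * p.1 + α) * τ + (2 * p.2 + β)) ^ k)⁻¹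

theorem summable_latSum_all {k : ℕ} (hk : 3 ≤ k) {τ : ℂ} (hτ : 0 < τ.im) :
    Summable fun p : ℤ × ℤ => ((p.1 * τ + p.2) ^ k)⁻¹ := by
  refine (summable_prod_eisSummand hk ⟨τ, hτ⟩).congr fun p => ?_
  simp [eisSummand]

theorem summable_latSum (α β : ℤ) {k : ℕ} (hk : 3 ≤ k) {τ : ℂ} (hτ : 0 < τ.im) :
    Summable fun p : ℤ × ℤ => (((2 * p.1 + α) * τ + (2 * p.2 + β)) ^ k)⁻¹ := by
  have h := (summable_latSum_all hk hτ).comp_injective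
    (i := fun p : ℤ × ℤ => (2 * p.1 + α, 2 * p.2 + β)) (by
      rintro ⟨a, b⟩ ⟨c, d⟩ h
      simp only [Prod.mk.injEq] at h
      ext <;> simp <;> omega)
  refine h.congr fun p => ?_
  simp

theorem latSum_add_one (α β : ℤ) (k : ℕ) (τ : ℂ) :
    latSum α β k (τ + 1) = latSum α (α + β) k τ := by
  let e : ℤ × ℤ ≃ ℤ × ℤ :=
    { toFun := fun p => (p.1, p.1 + p.2)
      invFun := fun p => (p.1, p.2 - p.1)
      left_inv := fun p => by simp
      right_inv := fun p => by simp }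
  rw [latSum, latSum, ← e.tsum_eq
    (fun p : ℤ × ℤ => (((2 * p.1 + α) * τ + (2 * p.2 + ((α + β : ℤ) : ℂ))) ^ k)⁻¹)]
  refine tsum_congr fun p => ?_
  simp only [e, Equiv.coe_fn_mk]
  congr 2
  push_cast
  ring

theorem latSum_add_two_right (α β : ℤ) (k : ℕ) (τ : ℂ) :
    latSum α (β + 2) k τ = latSum α β k τ := by
  rw [latSum, latSum, ← ((Equiv.refl ℤ).prodCongr (Equiv.addRight (1 : ℤ))).tsum_eq
    (fun p : ℤ × ℤ => (((2 * p.1 + α) * τ + (2 * p.2 + β)) ^ k)⁻¹)]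
  refine tsum_congr fun p => ?_
  simp only [Equiv.prodCongr_apply, Equiv.coe_refl, Prod.map, Equiv.coe_addRight, id]
  congr 2
  push_cast
  ring

theorem latSum_neg_right (α β : ℤ) (k : ℕ) (τ : ℂ) :
    latSum α (-β) k τ = latSum α β k τ := by
  have h (n : ℕ) : latSum α (β - 2 * n) k τ = latSum α β k τ := by
    induction n with
    | zero => simp
    | succ n ih =>
      rw [← ih, ← latSum_add_two_right]
      congr 1
      push_cast
      ring
  have h' (β : ℤ) (n : ℕ) : latSum α (β + 2 * n) k τ = latSum α β k τ := by
    induction n with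
    | zero => simp
    | succ n ih =>
      rw [← ih, ← latSum_add_two_right α (β + 2 * n)]
      congr 1
      push_cast
      ring
  rcases Int.eq_nat_or_neg β with ⟨n, rfl | rfl⟩
  · rw [← h n]
    congr 1
    ring
  · rw [← h' (-(n : ℤ)) n]
    congr 1
    ring

theorem latSum_neg_one_div (α β : ℤ) {k : ℕ} {τ : ℂ} (hτ : 0 < τ.im) :
    latSum α β k (-1 / τ) = τ ^ k * latSum β α k τ := by
  have h0 := ne_zero_of_im_pos hτ
  rw [← latSum_neg_right β α, latSum, latSum, ← tsum_mul_left,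
    ← ((Equiv.prodComm ℤ ℤ).trans ((Equiv.refl ℤ).prodCongr (Equiv.neg ℤ))).tsum_eq
      (fun p : ℤ × ℤ => τ ^ k * (((2 * p.1 + β) * τ + (2 * p.2 + ((-α : ℤ) : ℂ))) ^ k)⁻¹)]
  refine tsum_congr fun p => ?_
  simp only [Equiv.trans_apply, Equiv.prodCongr_apply, Equiv.coe_refl, Prod.map, id,
    Equiv.neg_apply, Equiv.prodComm_apply, Prod.fst_swap, Prod.snd_swap]
  rw [show (2 * (p.1 : ℂ) + α) * (-1 / τ) + (2 * p.2 + β) =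
    ((2 * p.2 + β) * τ + (2 * ((-p.1 : ℤ) : ℂ) + ((-α : ℤ) : ℂ))) / τ by
      push_cast; field_simp; ring, div_pow, inv_div, div_eq_mul_inv]

/-- Row a consists of the terms (2(w + b))^(-k) with w = ((2a + 1)τ + 1)/2, so the Lipschitz formula
applies. Rows a and -(a + 1) agree because k is even, whence the factor 2. -/
theorem hasSum_latSum_one_one {k : ℕ} (hk : 3 ≤ k) (hk2 : Even k) {τ : ℂ} (hτ : 0 < τ.im) :
    latSum 1 1 k τ = 2 * (-π * I) ^ k / (k - 1)! * qs (k - 1) 0 τ := by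
  obtain ⟨k, rfl⟩ : ∃ k', k = k' + 1 := ⟨k - 1, by omega⟩
  have hs := summable_latSum 1 1 hk hτ
  set g : ℤ → ℂ := fun a => ∑' b : ℤ, (((2 * a + (1 : ℤ)) * τ + (2 * b + (1 : ℤ))) ^ (k + 1))⁻¹
    with hg
  have hgs : HasSum g (latSum 1 1 (k + 1) τ) :=
    hs.hasSum.prod_fiberwise fun a => (hs.prod_factor a).hasSum
  have hsymm (a : ℤ) : g (-(a + 1)) = g a := by
    simp only [hg]
    rw [← (Equiv.subLeft (-1 : ℤ)).tsum_eq]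
    refine tsum_congr fun b => ?_
    rw [← hk2.neg_pow]
    congr 2
    simp only [Equiv.subLeft_apply]
    push_cast
    ring
  have hnat (a : ℕ) : g a = (-π * I) ^ (k + 1) / k ! * expSum k (((2 * a + 1) * τ + 1) / 2) := by
    have hw : 0 < ((((2 * a + 1) * τ + 1) / 2 : ℂ)).im := by
      have : ((((2 * a + 1) * τ + 1) / 2 : ℂ)) = (((2 * a + 1) / 2 : ℝ) : ℂ) * τ + ((1 / 2 : ℝ) : ℂ) := by
        push_cast; ring
      rw [this, add_im, im_ofReal_mul, ofReal_im, add_zero]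
      positivity
    have h := tsum_inv_add_int_pow (k := k) (by omega) hw
    have h2 : (2 : ℂ) ^ (k + 1) ≠ 0 := pow_ne_zero _ two_ne_zero
    have e : g a = (2 ^ (k + 1))⁻¹ * ∑' d : ℤ, 1 / ((((2 * a + 1) * τ + 1) / 2 : ℂ) + d) ^ (k + 1) := by
      rw [← tsum_mul_left]
      simp only [hg]
      refine tsum_congr fun b => ?_
      rw [one_div, ← mul_inv, ← mul_pow]
      congr 2
      push_cast
      ring
    rw [e, h, show (-2 * π * I : ℂ) = 2 * (-π * I) by ring, mul_pow]
    field_simp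
  have hq := (hasSum_qs k 0 hτ).mul_left ((-π * I) ^ (k + 1) / k !)
  have hq1 : HasSum (fun a : ℕ => g a) ((-π * I) ^ (k + 1) / k ! * qs k 0 τ) :=
    hq.congr_fun fun a => by rw [hnat]; simp
  have hq2 : HasSum (fun a : ℕ => g (-(a + 1))) ((-π * I) ^ (k + 1) / k ! * qs k 0 τ) :=
    hq1.congr_fun fun a => hsymm a
  rw [hgs.unique (hq1.of_nat_of_neg_add_one hq2), Nat.add_sub_cancel]
  ring

end EpsteinRepn

/-! ### The weight-four lattice sums as products of theta constants -/

namespace EpsteinRepn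
open Complex hiding eta
open Filter Topology ModularForm EisensteinSeries
open scoped Real ArithmeticFunction.sigma Nat

theorem latSum_zero_zero {k : ℕ} (τ : ℂ) :
    latSum 0 0 k τ = (2 ^ k)⁻¹ * ∑' p : ℤ × ℤ, ((p.1 * τ + p.2) ^ k)⁻¹ := by
  rw [latSum, ← tsum_mul_left]
  refine tsum_congr fun p => ?_
  rw [← mul_inv, ← mul_pow]
  congr 2
  push_cast
  ring

theorem tsum_eq_latSum_add {k : ℕ} (hk : 3 ≤ k) {τ : ℂ} (hτ : 0 < τ.im) :
    ∑' p : ℤ × ℤ, ((p.1 * τ + p.2) ^ k)⁻¹ =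
      latSum 0 0 k τ + latSum 0 1 k τ + (latSum 1 0 k τ + latSum 1 1 k τ) := by
  let e : (Fin 2 × Fin 2) × (ℤ × ℤ) ≃ ℤ × ℤ :=
    (Equiv.prodComm _ _).trans ((Equiv.prodProdProdComm _ _ _ _).trans
      ((Int.divModEquiv 2).symm.prodCongr (Int.divModEquiv 2).symm))
  have hs := e.summable_iff.mpr (summable_latSum_all hk hτ)
  rw [← e.tsum_eq, Summable.tsum_prod (f := fun p => (((e p).1 * τ + (e p).2 : ℂ) ^ k)⁻¹) hs,
    tsum_fintype, Fintype.sum_prod_type]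
  simp only [Fin.sum_univ_two]
  have h (i j : Fin 2) : ∑' p : ℤ × ℤ, (((e ((i, j), p)).1 * τ + (e ((i, j), p)).2 : ℂ) ^ k)⁻¹ =
      latSum (i : ℕ) (j : ℕ) k τ := by
    refine tsum_congr fun p => ?_
    congr 2
    simp [e, Int.divModEquiv, Equiv.prodProdProdComm]
    ring
  rw [h, h, h, h]
  simp

theorem tendsto_tsum_latSum_four :
    Tendsto (fun τ : ℂ => ∑' p : ℤ × ℤ, ((p.1 * τ + p.2) ^ 4)⁻¹) imTop (𝓝 (π ^ 4 / 45)) := by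
  have hs : Summable fun n : ℕ+ => ‖((σ 3 n : ℕ) : ℂ)‖ * Real.exp (-π * (2 * n : ℕ)) := by
    have h := (Real.summable_pow_mul_exp_neg_nat_mul 4 Real.pi_pos).comp_injective
      PNat.coe_injective
    refine h.of_nonneg_of_le (fun _ => by positivity) fun n => ?_
    rw [Complex.norm_natCast]
    refine mul_le_mul ?_ (Real.exp_le_exp.mpr ?_) (by positivity) (by positivity)
    · exact_mod_cast ArithmeticFunction.sigma_le_pow_succ 3 n
    · have := Real.pi_pos
      have : (0 : ℝ) ≤ (n : ℕ) := Nat.cast_nonneg _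
      push_cast
      nlinarith
  have h1 := tendsto_tsum_exp_imTop (c := fun n : ℕ+ => ((σ 3 n : ℕ) : ℂ))
    (e := fun n => 2 * n) hs
  simp only [mul_eq_zero, PNat.ne_zero, OfNat.ofNat_ne_zero, or_self, if_false, tsum_zero] at h1
  have h2 := (h1.const_mul (2 * ((-2 * π * I) ^ 4 / (4 - 1)!))).const_add (2 * riemannZeta 4)
  rw [mul_zero, add_zero, riemannZeta_four] at h2
  rw [show (π ^ 4 / 45 : ℂ) = 2 * (π ^ 4 / 90) by ring]
  refine h2.congr' ?_
  filter_upwards [eventually_imTop_lt 0] with τ hτ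
  have h3 := tsum_eisSummand_eq_tsum_sigma_mul_cexp_pow (k := 4) (by norm_num) (by decide) ⟨τ, hτ⟩
  rw [← (finTwoArrowEquiv ℤ).symm.tsum_eq] at h3
  have h4 : ∑' p : ℤ × ℤ, ((p.1 * τ + p.2) ^ 4)⁻¹ =
      ∑' p : ℤ × ℤ, eisSummand 4 ((finTwoArrowEquiv ℤ).symm p) ⟨τ, hτ⟩ :=
    tsum_congr fun p => by simp [eisSummand]
  rw [h4]
  refine Eq.trans ?_ h3.symm
  rw [Nat.cast_ofNat, riemannZeta_four]
  congr 2
  refine tsum_congr fun n => ?_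
  congr 1
  rw [← Complex.exp_nat_mul]
  congr 1
  push_cast
  ring

/-- The even-even class is 2^(-4) times the full sum, so the other three classes make up 15/16 of
it. This is how the limit of the class (0, 1) at i∞ is obtained from 2ζ(4). -/
theorem latSum_zero_one_four {τ : ℂ} (hτ : 0 < τ.im) :
    latSum 0 1 4 τ = (15 / 16) * (∑' p : ℤ × ℤ, ((p.1 * τ + p.2) ^ 4)⁻¹) - latSum 1 0 4 τ
      - latSum 1 1 4 τ := by
  have h := tsum_eq_latSum_add (k := 4) (by norm_num) hτ
  rw [latSum_zero_zero] at h
  linear_combination -h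

theorem latSum_one_one_add_one (k : ℕ) (τ : ℂ) : latSum 1 1 k (τ + 1) = latSum 1 0 k τ := by
  rw [latSum_add_one]
  exact latSum_add_two_right 1 0 k τ

theorem latSum_one_zero_add_one (k : ℕ) (τ : ℂ) : latSum 1 0 k (τ + 1) = latSum 1 1 k τ :=
  latSum_add_one 1 0 k τ

/-- Holomorphy is read off from the q-series for the odd-odd class; T and S then carry it to the
other two classes. -/
theorem differentiableAt_latSum_one_one {k : ℕ} (hk : 3 ≤ k) (hk2 : Even k) {τ : ℂ}
    (hτ : 0 < τ.im) : DifferentiableAt ℂ (latSum 1 1 k) τ := by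
  have h : latSum 1 1 k =ᶠ[𝓝 τ] fun τ => 2 * (-π * I) ^ k / (k - 1)! * qs (k - 1) 0 τ := by
    filter_upwards [isOpen_im_pos.mem_nhds hτ] with v hv
    exact hasSum_latSum_one_one hk hk2 hv
  exact h.symm.differentiableAt_iff.mp ((differentiableAt_qs_zero _ hτ).const_mul _)

theorem differentiableAt_latSum_one_zero {k : ℕ} (hk : 3 ≤ k) (hk2 : Even k) {τ : ℂ}
    (hτ : 0 < τ.im) : DifferentiableAt ℂ (latSum 1 0 k) τ := by
  have h : latSum 1 0 k = fun τ => latSum 1 1 k (τ + 1) := by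
    ext τ
    rw [latSum_one_one_add_one]
  rw [h]
  exact (differentiableAt_latSum_one_one hk hk2 (im_add_one_pos hτ)).comp τ
    (differentiableAt_id.add_const 1)

theorem latSum_zero_one_eq {k : ℕ} {τ : ℂ} (hτ : 0 < τ.im) :
    latSum 0 1 k τ = (τ ^ k)⁻¹ * latSum 1 0 k (-1 / τ) := by
  have h0 := ne_zero_of_im_pos hτ
  rw [latSum_neg_one_div 1 0 hτ]
  field_simp

theorem differentiableAt_latSum_zero_one {k : ℕ} (hk : 3 ≤ k) (hk2 : Even k) {τ : ℂ}
    (hτ : 0 < τ.im) : DifferentiableAt ℂ (latSum 0 1 k) τ := by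
  have h0 := ne_zero_of_im_pos hτ
  have h : latSum 0 1 k =ᶠ[𝓝 τ] fun τ => (τ ^ k)⁻¹ * latSum 1 0 k (-1 / τ) := by
    filter_upwards [isOpen_im_pos.mem_nhds hτ] with v hv
    exact latSum_zero_one_eq hv
  refine h.symm.differentiableAt_iff.mp (DifferentiableAt.mul ?_ ?_)
  · exact (differentiableAt_id.pow k).inv (pow_ne_zero _ h0)
  · exact (differentiableAt_latSum_one_zero hk hk2 (neg_one_div_im_pos hτ)).comp τ
      ((differentiableAt_const _).div differentiableAt_id h0)

theorem tendsto_latSum_one_one_div {k : ℕ} (hk : 3 ≤ k) (hk2 : Even k) :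
    Tendsto (fun τ => latSum 1 1 k τ / nome τ) imTop (𝓝 (-(2 * (-π * I) ^ k / (k - 1)!))) := by
  have h := (tendsto_qs_div_nome (k - 1) 0).const_mul (2 * (-π * I) ^ k / (k - 1)! : ℂ)
  rw [mul_neg_one] at h
  refine h.congr' ?_
  filter_upwards [eventually_imTop_lt 0] with τ hτ
  rw [hasSum_latSum_one_one hk hk2 hτ, mul_div_assoc _ (qs _ _ _)]

theorem tendsto_latSum_one_one_four :
    Tendsto (fun τ => latSum 1 1 4 τ / nome τ) imTop (𝓝 (-(π ^ 4 / 3))) := by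
  convert! tendsto_latSum_one_one_div (k := 4) (by norm_num) (by decide) using 3
  have h : (-π * I : ℂ) ^ 4 = π ^ 4 * (I ^ 2) ^ 2 := by ring
  rw [h, I_sq]
  norm_num [Nat.factorial]
  ring

theorem tendsto_latSum_one_one {k : ℕ} (hk : 3 ≤ k) (hk2 : Even k) :
    Tendsto (latSum 1 1 k) imTop (𝓝 0) := by
  have h := (tendsto_latSum_one_one_div hk hk2).mul tendsto_nome
  rw [mul_zero] at h
  exact h.congr fun τ => div_mul_cancel₀ _ (nome_ne_zero τ)

theorem tendsto_latSum_one_zero {k : ℕ} (hk : 3 ≤ k) (hk2 : Even k) :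
    Tendsto (latSum 1 0 k) imTop (𝓝 0) :=
  ((tendsto_latSum_one_one hk hk2).comp tendsto_add_one_imTop).congr
    (latSum_one_one_add_one k)

theorem tendsto_latSum_zero_one_four : Tendsto (latSum 0 1 4) imTop (𝓝 (π ^ 4 / 48)) := by
  have h := ((tendsto_tsum_latSum_four.const_mul (15 / 16)).sub
    (tendsto_latSum_one_zero (k := 4) (by norm_num) (by decide))).sub
    (tendsto_latSum_one_one (k := 4) (by norm_num) (by decide))
  rw [show (15 / 16 * (π ^ 4 / 45) - 0 - 0 : ℂ) = π ^ 4 / 48 by ring] at h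
  refine h.congr' ?_
  filter_upwards [eventually_imTop_lt 0] with τ hτ
  rw [latSum_zero_one_four hτ]

theorem theta2_pow_four_neg_one_div {τ : ℂ} (hτ : 0 < τ.im) :
    theta2 (-1 / τ) ^ 4 = -τ ^ 2 * theta4 τ ^ 4 := pow_four_of_sq (theta2_sq_neg_one_div hτ)

theorem theta3_pow_four_neg_one_div {τ : ℂ} (hτ : 0 < τ.im) :
    theta3 (-1 / τ) ^ 4 = -τ ^ 2 * theta3 τ ^ 4 := pow_four_of_sq (theta3_sq_neg_one_div hτ)

theorem theta4_pow_four_neg_one_div {τ : ℂ} (hτ : 0 < τ.im) :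
    theta4 (-1 / τ) ^ 4 = -τ ^ 2 * theta2 τ ^ 4 := pow_four_of_sq (theta4_sq_neg_one_div hτ)

/-- T and S permute the three classes exactly as they permute the products of theta constants, with
the same factor τ⁴ under S, so `eq_zero_of_permuted` applies to the ratios minus 1. For the odd-odd
class both sides vanish at i∞, and leading coefficients in the nome are compared: π⁴/3 = 16 π⁴/48.
-/
theorem latSum_four {τ : ℂ} (hτ : 0 < τ.im) :
    latSum 0 1 4 τ = π ^ 4 / 48 * (theta3 τ ^ 4 * theta4 τ ^ 4) ∧
    latSum 1 1 4 τ = -(π ^ 4 / 48) * (theta2 τ ^ 4 * theta4 τ ^ 4) ∧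
    latSum 1 0 4 τ = π ^ 4 / 48 * (theta2 τ ^ 4 * theta3 τ ^ 4) := by
  have hpi : (π : ℂ) ≠ 0 := by exact_mod_cast Real.pi_ne_zero
  have n2 {τ : ℂ} (h : 0 < τ.im) := theta2_ne_zero h
  have n3 {τ : ℂ} (h : 0 < τ.im) := theta3_ne_zero h
  have n4 {τ : ℂ} (h : 0 < τ.im) := theta4_ne_zero h
  have lim2 : Tendsto (fun τ => latSum 1 1 4 τ / (-(π ^ 4 / 48) * (theta2 τ ^ 4 * theta4 τ ^ 4)) - 1)
      imTop (𝓝 0) := by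
    have h := (tendsto_latSum_one_one_four.div ((tendsto_theta2_pow_four.mul
      (tendsto_theta4.pow 4)).const_mul (-(π ^ 4 / 48 : ℂ))) (by simp [hpi])).sub_const 1
    have e : (-(π ^ 4 / 3) / (-(π ^ 4 / 48) * (16 * 1 ^ 4)) - 1 : ℂ) = 0 := by
      field_simp
      norm_num
    rw [e] at h
    refine h.congr' ?_
    filter_upwards [eventually_imTop_lt 0] with τ hτ
    have := n2 hτ
    have := n4 hτ
    have := nome_ne_zero τ
    simp only [Pi.div_apply]
    field_simp
  have key := eq_zero_of_permuted
    (f₁ := fun τ => latSum 0 1 4 τ / (π ^ 4 / 48 * (theta3 τ ^ 4 * theta4 τ ^ 4)) - 1)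
    (f₂ := fun τ => latSum 1 1 4 τ / (-(π ^ 4 / 48) * (theta2 τ ^ 4 * theta4 τ ^ 4)) - 1)
    (f₃ := fun τ => latSum 1 0 4 τ / (π ^ 4 / 48 * (theta2 τ ^ 4 * theta3 τ ^ 4)) - 1)
    ?_ ?_ ?_ ?_ ?_ ?_ ?_ ?_ ?_ ?_ lim2 ?_ hτ
  · obtain ⟨h1, h2, h3⟩ := key
    have := n2 hτ
    have := n3 hτ
    have := n4 hτ
    refine ⟨?_, ?_, ?_⟩
    · exact (div_eq_one_iff_eq (by simp [*])).mp (sub_eq_zero.mp h1)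
    · exact (div_eq_one_iff_eq (by simp [*])).mp (sub_eq_zero.mp h2)
    · exact (div_eq_one_iff_eq (by simp [*])).mp (sub_eq_zero.mp h3)
  · intro v hv
    exact (((differentiableAt_latSum_zero_one (by norm_num) (by decide) hv).div
      (((differentiableAt_theta3 hv).pow 4).mul ((differentiableAt_theta4 hv).pow 4)
        |>.const_mul _) (by simp [n3 hv, n4 hv, hpi])).sub_const 1).differentiableWithinAt
  · intro v hv
    exact (((differentiableAt_latSum_one_one (by norm_num) (by decide) hv).div
      (((differentiableAt_theta2 hv).pow 4).mul ((differentiableAt_theta4 hv).pow 4)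
        |>.const_mul _) (by simp [n2 hv, n4 hv, hpi])).sub_const 1).differentiableWithinAt
  · intro v hv
    exact (((differentiableAt_latSum_one_zero (by norm_num) (by decide) hv).div
      (((differentiableAt_theta2 hv).pow 4).mul ((differentiableAt_theta3 hv).pow 4)
        |>.const_mul _) (by simp [n2 hv, n3 hv, hpi])).sub_const 1).differentiableWithinAt
  · intro v hv
    simp only [latSum_add_one, theta3_add_one, theta4_add_one, zero_add, mul_comm]
  · intro v hv
    simp only [latSum_one_one_add_one, theta2_add_one_pow_four, theta4_add_one, neg_mul, mul_neg, neg_neg]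
  · intro v hv
    simp only [latSum_one_zero_add_one, theta2_add_one_pow_four, theta3_add_one,
      neg_mul, mul_neg]
  · intro v hv
    have h0 := ne_zero_of_im_pos hv
    have := n2 hv
    have := n3 hv
    simp only [latSum_neg_one_div 0 1 hv, theta3_pow_four_neg_one_div hv,
      theta4_pow_four_neg_one_div hv]
    field_simp
  · intro v hv
    have h0 := ne_zero_of_im_pos hv
    have := n2 hv
    have := n4 hv
    simp only [latSum_neg_one_div 1 1 hv, theta2_pow_four_neg_one_div hv,
      theta4_pow_four_neg_one_div hv]
    field_simp
  · intro v hv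
    have h0 := ne_zero_of_im_pos hv
    have := n4 hv
    have := n3 hv
    simp only [latSum_neg_one_div 1 0 hv, theta3_pow_four_neg_one_div hv,
      theta2_pow_four_neg_one_div hv]
    field_simp
  · have h := (tendsto_latSum_zero_one_four.div (((tendsto_theta3.pow 4).mul
      (tendsto_theta4.pow 4)).const_mul (π ^ 4 / 48 : ℂ)) (by simp [hpi])).sub_const 1
    have e : (π ^ 4 / 48 / (π ^ 4 / 48 * (1 ^ 4 * 1 ^ 4)) - 1 : ℂ) = 0 := by
      field_simp
      norm_num
    rw [e] at h
    exact h
  · refine (lim2.comp tendsto_add_one_imTop).congr fun τ => ?_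
    simp only [Function.comp_apply, latSum_one_one_add_one, theta2_add_one_pow_four,
      theta4_add_one, neg_mul, mul_neg, neg_neg]

end EpsteinRepn

/-! ### Higher weights from the differential equation of the Weierstrass function -/

namespace EpsteinRepn
open Complex hiding eta
open Filter Topology ModularForm EisensteinSeries
open scoped Real ArithmeticFunction.sigma Nat

/-- Compare Taylor coefficients with the explicit power series of ℘ at x. The case n = 0 differs
because of the constants subtracted to make ℘ converge. -/
theorem iteratedDeriv_weierstrassP (L : PeriodPair) {x : ℂ} (hx : x ∉ L.lattice) {n : ℕ}
    (hn : n ≠ 0) : iteratedDeriv n L.weierstrassP x = (n + 1)! * L.sumInvPow x (n + 2) := by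
  obtain ⟨r, hr0, hr⟩ := Metric.nhds_basis_closedBall.mem_iff.mp
    (L.isClosed_lattice.isOpen_compl.mem_nhds hx)
  have h1 := (L.hasFPowerSeriesOnBall_weierstrassP x ⟨r, hr0.le⟩ hr0 hr).hasFPowerSeriesAt
  have h2 := congr($((L.analyticOnNhd_weierstrassP x hx).hasFPowerSeriesAt
      |>.eq_formalMultilinearSeries h1).coeff n)
  simp only [FormalMultilinearSeries.coeff_ofScalars, PeriodPair.weierstrassPSeries, hn,
    if_false] at h2
  rw [div_eq_iff (by exact_mod_cast n.factorial_ne_zero)] at h2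
  rw [h2, Nat.factorial_succ]
  push_cast
  ring

/-- Differentiating (℘')² = 4℘³ - g₂℘ - g₃ gives the claim multiplied by ℘'. At a half period ℘'
vanishes, so the factor is cancelled on a punctured neighbourhood and the identity extends by
analyticity. The hypothesis `h4` says ℘''(x) ≠ 0, which prevents ℘' from vanishing identically near
x. -/
theorem deriv_deriv_weierstrassP (L : PeriodPair) {x : ℂ} (hx : x ∉ L.lattice)
    (h4 : L.sumInvPow x 4 ≠ 0) :
    deriv (deriv L.weierstrassP) =ᶠ[𝓝 x] fun z => 6 * L.weierstrassP z ^ 2 - L.g₂ / 2 := by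
  have hopen : ∀ᶠ z in 𝓝 x, z ∉ L.lattice := L.isClosed_lattice.isOpen_compl.mem_nhds hx
  have ha {z : ℂ} (hz : z ∉ L.lattice) : AnalyticAt ℂ L.weierstrassP z :=
    L.analyticOnNhd_weierstrassP z hz
  have key : ∀ᶠ z in 𝓝 x, deriv L.weierstrassP z = 0 ∨
      deriv (deriv L.weierstrassP) z = 6 * L.weierstrassP z ^ 2 - L.g₂ / 2 := by
    filter_upwards [hopen.eventually_nhds] with z hz
    have hz' := hz.self_of_nhds
    have h1 : (fun z => deriv L.weierstrassP z ^ 2) =ᶠ[𝓝 z]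
        fun z => 4 * L.weierstrassP z ^ 3 - L.g₂ * L.weierstrassP z - L.g₃ := by
      filter_upwards [hz] with w hw
      rw [L.deriv_weierstrassP, L.derivWeierstrassP_sq w hw]
    have hd := (ha hz').differentiableAt.hasDerivAt
    have hd2 := (ha hz').deriv.differentiableAt.hasDerivAt
    have h2 := (hd2.pow 2).unique ((((hd.pow 3).const_mul 4).sub
      (hd.const_mul L.g₂)).sub_const L.g₃ |>.congr_of_eventuallyEq h1)
    by_cases h : deriv L.weierstrassP z = 0
    · exact Or.inl h
    · right
      apply mul_left_cancel₀ h
      simp only [Nat.cast_ofNat] at h2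
      linear_combination h2 / 2
  rcases (ha hx).deriv.eventually_eq_zero_or_eventually_ne_zero with h | h
  · exfalso
    have h2 := iteratedDeriv_weierstrassP L hx two_ne_zero
    rw [iteratedDeriv_succ, iteratedDeriv_one,
      (show deriv L.weierstrassP =ᶠ[𝓝 x] fun _ => 0 from h).deriv_eq] at h2
    simp [h4, Nat.factorial_ne_zero] at h2
  · have hA : AnalyticAt ℂ (fun z => deriv (deriv L.weierstrassP) z -
        (6 * L.weierstrassP z ^ 2 - L.g₂ / 2)) x :=
      (ha hx).deriv.deriv.sub ((analyticAt_const.mul ((ha hx).pow 2)).sub analyticAt_const)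
    have h3 : ∀ᶠ z in 𝓝[≠] x, deriv (deriv L.weierstrassP) z -
        (6 * L.weierstrassP z ^ 2 - L.g₂ / 2) = 0 := by
      filter_upwards [h, key.filter_mono nhdsWithin_le_nhds] with z hz hz2
      exact sub_eq_zero.mpr (hz2.resolve_left hz)
    filter_upwards [hA.frequently_zero_iff_eventually_zero.mp h3.frequently] with z hz
    exact sub_eq_zero.mp hz

theorem iteratedDeriv_weierstrassP_add_two (L : PeriodPair) {x : ℂ} (hx : x ∉ L.lattice)
    (h4 : L.sumInvPow x 4 ≠ 0) {n : ℕ} (hn : n ≠ 0) :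
    iteratedDeriv (n + 2) L.weierstrassP x = 6 * ∑ i ∈ Finset.range (n + 1), n.choose i *
      iteratedDeriv i L.weierstrassP x * iteratedDeriv (n - i) L.weierstrassP x := by
  have ha : AnalyticAt ℂ L.weierstrassP x := L.analyticOnNhd_weierstrassP x hx
  rw [iteratedDeriv_succ', iteratedDeriv_succ',
    (deriv_deriv_weierstrassP L hx h4).iteratedDeriv_eq]
  have e : (fun z => 6 * L.weierstrassP z ^ 2 - L.g₂ / 2) =
      fun z => 6 * (L.weierstrassP z * L.weierstrassP z) - L.g₂ / 2 := by
    ext z; ring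
  rw [e, iteratedDeriv_fun_sub _ contDiffAt_const, iteratedDeriv_const_mul_field,
    iteratedDeriv_fun_mul ha.contDiffAt ha.contDiffAt, iteratedDeriv_const]
  · simp [hn]
  · exact contDiffAt_const.mul (ha.contDiffAt.mul ha.contDiffAt)

/-- The lattice `2 ℤ τ + 2 ℤ`. -/
noncomputable def doubleLattice (τ : ℂ) (hτ : 0 < τ.im) : PeriodPair where
  ω₁ := 2 * τ
  ω₂ := 2
  indep := by
    rw [LinearIndependent.pair_iff]
    intro s t h
    have h1 := congrArg Complex.im h
    have h2 := congrArg Complex.re h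
    simp at h1 h2
    have h3 : s = 0 := h1.resolve_right hτ.ne'
    subst h3
    simpa using h2

theorem tsum_doubleLattice {τ : ℂ} (hτ : 0 < τ.im) (f : ℂ → ℂ) :
    ∑' l : (doubleLattice τ hτ).lattice, f l = ∑' p : ℤ × ℤ, f (2 * p.1 * τ + 2 * p.2) := by
  rw [← (doubleLattice τ hτ).latticeEquivProd.symm.toEquiv.tsum_eq]
  refine tsum_congr fun p => ?_
  congr 1
  refine ((doubleLattice τ hτ).latticeEquiv_symm_apply p).trans ?_
  simp only [doubleLattice]
  ring

theorem add_one_notMem_doubleLattice {τ : ℂ} (hτ : 0 < τ.im) :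
    τ + 1 ∉ (doubleLattice τ hτ).lattice := by
  have h := (doubleLattice τ hτ).mul_ω₁_add_mul_ω₂_mem_lattice (α := 1 / 2) (β := 1 / 2)
  have e : (((1 / 2 : ℚ) : ℂ) * (doubleLattice τ hτ).ω₁ + ((1 / 2 : ℚ) : ℂ) *
      (doubleLattice τ hτ).ω₂) = τ + 1 := by
    simp only [doubleLattice]
    push_cast
    ring
  rw [e] at h
  rw [h]
  norm_num

theorem sumInvPow_doubleLattice_even {τ : ℂ} (hτ : 0 < τ.im) {k : ℕ} (hk : Even k) :
    (doubleLattice τ hτ).sumInvPow (τ + 1) k = latSum 1 1 k τ := by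
  rw [PeriodPair.sumInvPow, tsum_doubleLattice hτ (fun l => ((l - (τ + 1)) ^ k)⁻¹), latSum,
    ← (Equiv.neg (ℤ × ℤ)).tsum_eq]
  refine tsum_congr fun p => ?_
  rw [← hk.neg_pow]
  congr 2
  simp
  ring

/-- The reflection l ↦ 2(τ + 1) - l preserves the lattice and negates l - (τ + 1). -/
theorem sumInvPow_doubleLattice_odd {τ : ℂ} (hτ : 0 < τ.im) {k : ℕ} (hk : Odd k) :
    (doubleLattice τ hτ).sumInvPow (τ + 1) k = 0 := by
  rw [PeriodPair.sumInvPow, tsum_doubleLattice hτ (fun l => ((l - (τ + 1)) ^ k)⁻¹)]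
  rw [← self_eq_neg, ← tsum_neg, ← (Equiv.subLeft ((1, 1) : ℤ × ℤ)).tsum_eq]
  refine tsum_congr fun p => ?_
  rw [← inv_neg, ← hk.neg_pow]
  congr 2
  simp
  ring

/-- The sum G₄ of the doubled lattice is 1/16 of the total over all four classes, itself included;
solving, 15 G₄ is the sum of the other three classes, and g₂ = 60 G₄. -/
theorem g₂_doubleLattice {τ : ℂ} (hτ : 0 < τ.im) :
    (doubleLattice τ hτ).g₂ = 4 * (latSum 0 1 4 τ + latSum 1 0 4 τ + latSum 1 1 4 τ) := by
  have h1 : (doubleLattice τ hτ).G 4 = latSum 0 0 4 τ := by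
    rw [PeriodPair.G, tsum_doubleLattice hτ (fun l => (l ^ 4)⁻¹), latSum]
    simp only [Int.cast_zero, add_zero]
  have h := tsum_eq_latSum_add (k := 4) (by norm_num) hτ
  have h2 := latSum_zero_zero (k := 4) τ
  rw [PeriodPair.g₂, h1]
  rw [h] at h2
  linear_combination 64 * h2

theorem latSum_one_one_four_ne_zero {τ : ℂ} (hτ : 0 < τ.im) : latSum 1 1 4 τ ≠ 0 := by
  have hpi : (π : ℂ) ≠ 0 := by exact_mod_cast Real.pi_ne_zero
  rw [(latSum_four hτ).2.1]
  simp [hpi, theta2_ne_zero hτ, theta4_ne_zero hτ]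

/-- The value of `℘` for the lattice `2 ℤ τ + 2 ℤ` at `τ + 1`. -/
noncomputable def halfPeriodValue (τ : ℂ) (hτ : 0 < τ.im) : ℂ :=
  (doubleLattice τ hτ).weierstrassP (τ + 1)

section

variable {τ : ℂ} (hτ : 0 < τ.im)
include hτ

theorem halfPeriodValue_sq : 3 * latSum 1 1 4 τ = 3 * halfPeriodValue τ hτ ^ 2 -
    (latSum 0 1 4 τ + latSum 1 0 4 τ + latSum 1 1 4 τ) := by
  have hx := add_one_notMem_doubleLattice hτ
  have h4 : (doubleLattice τ hτ).sumInvPow (τ + 1) 4 ≠ 0 := by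
    rw [sumInvPow_doubleLattice_even hτ (by decide)]
    exact latSum_one_one_four_ne_zero hτ
  have h := iteratedDeriv_weierstrassP (doubleLattice τ hτ) hx two_ne_zero
  rw [sumInvPow_doubleLattice_even hτ (by decide), iteratedDeriv_succ, iteratedDeriv_one,
    (deriv_deriv_weierstrassP _ hx h4).self_of_nhds, g₂_doubleLattice] at h
  rw [halfPeriodValue]
  norm_num [Nat.factorial] at h
  linear_combination -h / 2

/-- This is the derivative of order 2n of ℘'' = 6℘² - g₂/2 at the half period. Odd derivatives
vanish there, so only even indices survive in the Leibniz sum; the derivative of order 0 is the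
value of ℘ itself, hence the case distinction. -/
theorem latSum_recursion {n : ℕ} (hn : n ≠ 0) :
    (2 * n + 3)! * latSum 1 1 (2 * n + 4) τ = 6 * ∑ i ∈ Finset.range (n + 1), (2 * n).choose (2 * i) *
      (if i = 0 then halfPeriodValue τ hτ else (2 * i + 1)! * latSum 1 1 (2 * i + 2) τ) *
      (if n - i = 0 then halfPeriodValue τ hτ
        else (2 * (n - i) + 1)! * latSum 1 1 (2 * (n - i) + 2) τ) := by
  have hx := add_one_notMem_doubleLattice hτ
  have h4 : (doubleLattice τ hτ).sumInvPow (τ + 1) 4 ≠ 0 := by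
    rw [sumInvPow_doubleLattice_even hτ (by decide)]
    exact latSum_one_one_four_ne_zero hτ
  have hd (i : ℕ) : iteratedDeriv (2 * i) (doubleLattice τ hτ).weierstrassP (τ + 1) =
      if i = 0 then halfPeriodValue τ hτ else (2 * i + 1)! * latSum 1 1 (2 * i + 2) τ := by
    rcases Nat.eq_zero_or_pos i with rfl | hi
    · simp [halfPeriodValue]
    · rw [iteratedDeriv_weierstrassP _ hx (by omega), if_neg hi.ne',
        sumInvPow_doubleLattice_even hτ ⟨i + 1, by ring⟩]
  have ho (i : ℕ) : iteratedDeriv (2 * i + 1) (doubleLattice τ hτ).weierstrassP (τ + 1) = 0 := by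
    rw [iteratedDeriv_weierstrassP _ hx (by omega),
      sumInvPow_doubleLattice_odd hτ ⟨i + 1, by ring⟩, mul_zero]
  have h := iteratedDeriv_weierstrassP_add_two _ hx h4 (n := 2 * n) (by omega)
  rw [show 2 * n + 2 = 2 * (n + 1) by ring, hd, if_neg n.succ_ne_zero,
    show 2 * (n + 1) + 1 = 2 * n + 3 by ring, show 2 * (n + 1) + 2 = 2 * n + 4 by ring] at h
  rw [h]
  congr 1
  have hsum (N : ℕ) (f : ℕ → ℂ) (hf : ∀ i, f (2 * i + 1) = 0) :
      ∑ i ∈ Finset.range (2 * N + 1), f i = ∑ i ∈ Finset.range (N + 1), f (2 * i) := by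
    induction N with
    | zero => simp
    | succ N ih =>
      rw [show 2 * (N + 1) + 1 = 2 * N + 1 + 1 + 1 by ring, Finset.sum_range_succ,
        Finset.sum_range_succ, ih, hf, add_zero, Finset.sum_range_succ _ (N + 1)]
      rfl
  rw [hsum _ _ fun i => by rw [ho]; ring]
  refine Finset.sum_congr rfl fun i _ => ?_
  rw [← Nat.mul_sub, hd, hd]

theorem latSum_six : 5 * latSum 1 1 6 τ = 3 * (halfPeriodValue τ hτ * latSum 1 1 4 τ) := by
  have h := latSum_recursion hτ one_ne_zero
  norm_num [Finset.sum_range_succ, Nat.factorial, Nat.choose] at h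
  linear_combination h / 24

theorem latSum_eight : 7 * latSum 1 1 8 τ = 1 / 5 * (2 * halfPeriodValue τ hτ *
    (5 * latSum 1 1 6 τ) + (3 * latSum 1 1 4 τ) ^ 2) := by
  have h := latSum_recursion hτ two_ne_zero
  norm_num [Finset.sum_range_succ, Nat.factorial, Nat.choose] at h
  linear_combination h / 720

theorem latSum_ten : 9 * latSum 1 1 10 τ = 3 / 28 * (2 * halfPeriodValue τ hτ *
    (7 * latSum 1 1 8 τ) + 2 * (3 * latSum 1 1 4 τ) * (5 * latSum 1 1 6 τ)) := by
  have h := latSum_recursion hτ three_ne_zero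
  norm_num [Finset.sum_range_succ, Nat.factorial, Nat.choose] at h
  linear_combination h / 40320

theorem latSum_twelve : 11 * latSum 1 1 12 τ = 1 / 15 * (2 * halfPeriodValue τ hτ *
    (9 * latSum 1 1 10 τ) + 2 * (3 * latSum 1 1 4 τ) * (7 * latSum 1 1 8 τ) +
      (5 * latSum 1 1 6 τ) ^ 2) := by
  have h := latSum_recursion hτ four_ne_zero
  norm_num [Finset.sum_range_succ, Nat.factorial, Nat.choose] at h
  linear_combination h / 3628800

theorem latSum_fourteen : 13 * latSum 1 1 14 τ = 1 / 22 * (2 * halfPeriodValue τ hτ *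
    (11 * latSum 1 1 12 τ) + 2 * (3 * latSum 1 1 4 τ) * (9 * latSum 1 1 10 τ) +
      2 * (5 * latSum 1 1 6 τ) * (7 * latSum 1 1 8 τ)) := by
  have h := latSum_recursion hτ (n := 5) (by norm_num)
  norm_num [Finset.sum_range_succ, Nat.factorial, Nat.choose] at h
  linear_combination h / 479001600

end

theorem tendsto_latSum_one_one_six :
    Tendsto (fun τ => latSum 1 1 6 τ / nome τ) imTop (𝓝 (π ^ 6 / 60)) := by
  convert! tendsto_latSum_one_one_div (k := 6) (by norm_num) (by decide) using 2
  have h : (-π * I : ℂ) ^ 6 = π ^ 6 * (I ^ 2) ^ 3 := by ring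
  rw [h, I_sq]
  norm_num [Nat.factorial]
  ring

/-- The second derivative of ℘ and the weight-four identities determine the square of the value. The
quotient of the sums of weights 6 and 4 shows that the value is holomorphic in τ, so one choice of
sign holds on the whole half-plane, and the limit -π²/12 at i∞ excludes the wrong one. -/
theorem halfPeriodValue_eq {τ : ℂ} (hτ : 0 < τ.im) :
    halfPeriodValue τ hτ = π ^ 2 / 12 * (theta2 τ ^ 4 - theta4 τ ^ 4) := by
  have hpi : (π : ℂ) ≠ 0 := by exact_mod_cast Real.pi_ne_zero
  have hU : IsPreconnected {z : ℂ | 0 < z.im} := (convex_halfSpace_im_gt 0).isPreconnected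
  set h : ℂ → ℂ := fun τ => 5 * latSum 1 1 6 τ / (3 * latSum 1 1 4 τ) with hh
  have hv {τ : ℂ} (hτ : 0 < τ.im) : halfPeriodValue τ hτ = h τ := by
    have h1 := latSum_six hτ
    have h2 := latSum_one_one_four_ne_zero hτ
    rw [hh, eq_div_iff (by simp [h2]), h1]
    ring
  have hd : DifferentiableOn ℂ h {z | 0 < z.im} := fun τ hτ =>
    (((differentiableAt_latSum_one_one (by norm_num) (by decide) hτ).const_mul 5).div
      ((differentiableAt_latSum_one_one (by norm_num) (by decide) hτ).const_mul 3)
      (by simp [latSum_one_one_four_ne_zero hτ])).differentiableWithinAt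
  have hg : DifferentiableOn ℂ (fun τ => (π : ℂ) ^ 2 / 12 * (theta2 τ ^ 4 - theta4 τ ^ 4))
      {z | 0 < z.im} := fun τ hτ => ((((differentiableAt_theta2 hτ).pow 4).sub
        ((differentiableAt_theta4 hτ).pow 4)).const_mul _).differentiableWithinAt
  have hprod : ∀ z ∈ {z : ℂ | 0 < z.im},
      (h z - π ^ 2 / 12 * (theta2 z ^ 4 - theta4 z ^ 4)) *
      (h z + π ^ 2 / 12 * (theta2 z ^ 4 - theta4 z ^ 4)) = 0 := by
    intro z hz
    have h1 := halfPeriodValue_sq hz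
    obtain ⟨h2, h3, h4⟩ := latSum_four hz
    rw [hv hz, h2, h3, h4, theta3_pow_four hz] at h1
    linear_combination -h1 / 3
  rcases AnalyticOnNhd.eq_zero_or_eq_zero_of_mul_eq_zero
    ((hd.sub hg).analyticOnNhd isOpen_im_pos) ((hd.add hg).analyticOnNhd isOpen_im_pos)
    hprod hU with h0 | h0
  · rw [hv hτ]
    exact sub_eq_zero.mp (h0 τ hτ)
  · exfalso
    have l1 : Tendsto h imTop (𝓝 (5 * (π ^ 6 / 60) / (3 * -(π ^ 4 / 3)))) := by
      refine ((tendsto_latSum_one_one_six.const_mul 5).div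
        (tendsto_latSum_one_one_four.const_mul 3) (by simp [hpi])).congr fun τ => ?_
      have := nome_ne_zero τ
      simp only [hh, Pi.div_apply]
      field_simp
    have l2 : Tendsto (fun τ => theta2 τ ^ 4) imTop (𝓝 0) := by
      have := tendsto_theta2_pow_four.mul tendsto_nome
      rw [mul_zero] at this
      exact this.congr fun τ => div_mul_cancel₀ _ (nome_ne_zero τ)
    have l3 := l1.add ((l2.sub (tendsto_theta4.pow 4)).const_mul ((π : ℂ) ^ 2 / 12))
    have l4 : Tendsto (fun z : ℂ => h z + π ^ 2 / 12 * (theta2 z ^ 4 - theta4 z ^ 4)) imTop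
        (𝓝 0) := by
      refine tendsto_const_nhds.congr' ?_
      filter_upwards [eventually_imTop_lt 0] with z hz
      exact (h0 z hz).symm
    have hne : imTop.NeBot := by
      rw [imTop]
      exact Filter.atTop_neBot.comap_of_surj fun y => ⟨y * I, by simp⟩
    have e := tendsto_nhds_unique l3 l4
    field_simp at e
    norm_num at e

/-- The value `(π² / 12) θ₃⁴`. -/
noncomputable def latUnit (τ : ℂ) : ℂ := π ^ 2 / 12 * theta3 τ ^ 4

section

variable {τ : ℂ} (hτ : 0 < τ.im)
include hτ

theorem theta2_pow_four_eq : theta2 τ ^ 4 = modularLambda τ * theta3 τ ^ 4 := by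
  rw [modularLambda_eq hτ, div_mul_cancel₀ _ (pow_ne_zero _ (theta3_ne_zero hτ))]

theorem theta4_pow_four_eq : theta4 τ ^ 4 = (1 - modularLambda τ) * theta3 τ ^ 4 := by
  rw [one_sub_modularLambda hτ, div_mul_cancel₀ _ (pow_ne_zero _ (theta3_ne_zero hτ))]

theorem halfPeriodValue_eq_modularLambda :
    halfPeriodValue τ hτ = latUnit τ * (2 * modularLambda τ - 1) := by
  rw [halfPeriodValue_eq, theta2_pow_four_eq hτ, theta4_pow_four_eq hτ, latUnit]
  ring

/-- The input that, with `halfPeriodValue_eq_modularLambda`, turns the recursion into polynomials in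
λ. The factor multiplying λ(1 - λ) in each weight below is the polynomial of the corresponding
integrand. -/
theorem latSum_four_eq : latSum 1 1 4 τ =
    -3 * latUnit τ ^ 2 * (modularLambda τ * (1 - modularLambda τ)) := by
  rw [(latSum_four hτ).2.1, theta2_pow_four_eq hτ, theta4_pow_four_eq hτ, latUnit]
  ring

theorem latSum_six_eq : latSum 1 1 6 τ =
    -(9 / 5) * latUnit τ ^ 3 * (modularLambda τ * (1 - modularLambda τ)) *
      (2 * modularLambda τ - 1) := by
  have h := latSum_six hτ
  rw [latSum_four_eq hτ, halfPeriodValue_eq_modularLambda] at h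
  linear_combination h / 5

theorem latSum_eight_eq : latSum 1 1 8 τ =
    -(9 / 35) * latUnit τ ^ 4 * (modularLambda τ * (1 - modularLambda τ)) *
      (2 - 17 * modularLambda τ * (1 - modularLambda τ)) := by
  have h := latSum_eight hτ
  rw [latSum_six_eq hτ, latSum_four_eq hτ, halfPeriodValue_eq_modularLambda] at h
  linear_combination h / 7

theorem latSum_ten_eq : latSum 1 1 10 τ =
    -(3 / 35) * latUnit τ ^ 5 * (modularLambda τ * (1 - modularLambda τ)) *
      ((2 * modularLambda τ - 1) * (1 - 31 * modularLambda τ * (1 - modularLambda τ))) := by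
  have h := latSum_ten hτ
  rw [latSum_eight_eq hτ, latSum_six_eq hτ, latSum_four_eq hτ,
    halfPeriodValue_eq_modularLambda] at h
  linear_combination h / 9

theorem latSum_fourteen_eq : latSum 1 1 14 τ =
    -(18 / 25025) * latUnit τ ^ 7 * (modularLambda τ * (1 - modularLambda τ)) *
      ((2 * modularLambda τ - 1) * (1 - 512 * modularLambda τ * (1 - modularLambda τ) +
        5461 * modularLambda τ ^ 2 * (1 - modularLambda τ) ^ 2)) := by
  have h12 := latSum_twelve hτ
  have h := latSum_fourteen hτ
  rw [h12, latSum_ten_eq hτ, latSum_eight_eq hτ, latSum_six_eq hτ, latSum_four_eq hτ,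
    halfPeriodValue_eq_modularLambda] at h
  linear_combination h / 13

end

end EpsteinRepn

/-! ### Gauss's arithmetic-geometric mean integral -/

namespace EpsteinRepn
open Complex hiding eta
open Filter Topology ModularForm EisensteinSeries
open scoped Real ArithmeticFunction.sigma Nat
open MeasureTheory Set in
/-- The integral `∫ dθ / √(a² cos² θ + b² sin² θ)` over `(0, π / 2)`. -/
noncomputable def gaussInt (a b : ℝ) : ℝ :=
  ∫ θ in Ioo 0 (π / 2), (√(a ^ 2 * Real.cos θ ^ 2 + b ^ 2 * Real.sin θ ^ 2))⁻¹

open MeasureTheory Set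

/-- Substitute x = b tan θ. -/
theorem gaussInt_eq_Ioi {a b : ℝ} (ha : 0 < a) (hb : 0 < b) :
    gaussInt a b = ∫ x in Ioi (0 : ℝ), (√((x ^ 2 + a ^ 2) * (x ^ 2 + b ^ 2)))⁻¹ := by
  have himg : (fun θ : ℝ => b * Real.tan θ) '' Ioo 0 (π / 2) = Ioi 0 := by
    ext x
    simp only [mem_image, mem_Ioo, mem_Ioi]
    constructor
    · rintro ⟨θ, hθ, rfl⟩
      exact mul_pos hb (Real.tan_pos_of_pos_of_lt_pi_div_two hθ.1 hθ.2)
    · intro hx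
      refine ⟨Real.arctan (x / b), ⟨Real.arctan_pos.mpr (by positivity),
        Real.arctan_lt_pi_div_two _⟩, ?_⟩
      rw [Real.tan_arctan, mul_div_cancel₀ _ hb.ne']
  have hcos {θ : ℝ} (hθ : θ ∈ Ioo 0 (π / 2)) : 0 < Real.cos θ :=
    Real.cos_pos_of_mem_Ioo ⟨by linarith [hθ.1, Real.pi_pos], hθ.2⟩
  rw [← himg, integral_image_eq_integral_deriv_smul_of_monotoneOn measurableSet_Ioo
    (f' := fun θ => b * (1 / Real.cos θ ^ 2))
    (fun θ hθ => ((Real.hasDerivAt_tan (hcos hθ).ne').const_mul b).hasDerivWithinAt), gaussInt]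
  · refine setIntegral_congr_fun measurableSet_Ioo fun θ hθ => ?_
    have hc := hcos hθ
    have e : ((b * Real.tan θ) ^ 2 + a ^ 2) * ((b * Real.tan θ) ^ 2 + b ^ 2) =
        (b / Real.cos θ ^ 2) ^ 2 * (a ^ 2 * Real.cos θ ^ 2 + b ^ 2 * Real.sin θ ^ 2) := by
      rw [Real.tan_eq_sin_div_cos]
      field_simp
      rw [Real.sin_sq_add_cos_sq]
      ring
    simp only [e, smul_eq_mul]
    rw [Real.sqrt_mul (sq_nonneg _), Real.sqrt_sq (by positivity), mul_inv]
    field_simp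
  · intro x hx y hy hxy
    refine mul_le_mul_of_nonneg_left ?_ hb.le
    refine Real.strictMonoOn_tan.monotoneOn ⟨?_, hx.2⟩ ⟨?_, hy.2⟩ hxy
    · linarith [hx.1, Real.pi_pos]
    · linarith [hy.1, Real.pi_pos]

/-- The substitution u = (x - ab/x)/2 maps (0, ∞) increasingly onto ℝ and carries the integrand for
the two means to twice the one for a and b. Evenness of the integrand in u compensates the factor 2.
-/
theorem gaussInt_mean {a b : ℝ} (ha : 0 < a) (hb : 0 < b) {g : ℝ} (hg : 0 < g)
    (hg2 : g ^ 2 = a * b) : gaussInt ((a + b) / 2) g = gaussInt a b := by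
  rw [gaussInt_eq_Ioi (by positivity) hg, gaussInt_eq_Ioi ha hb]
  have hab : 0 < a * b := by positivity
  have himg : (fun x : ℝ => (x - a * b / x) / 2) '' Ioi 0 = univ := by
    refine eq_univ_of_forall fun u => ?_
    have h1 : 0 ≤ u ^ 2 + a * b := by positivity
    have h2 : |u| < √(u ^ 2 + a * b) := by
      rw [← Real.sqrt_sq_eq_abs]
      exact Real.sqrt_lt_sqrt (sq_nonneg u) (by linarith)
    have h3 : 0 < u + √(u ^ 2 + a * b) := by linarith [neg_abs_le u]
    refine ⟨u + √(u ^ 2 + a * b), h3, ?_⟩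
    have h4 := Real.sq_sqrt h1
    set s := √(u ^ 2 + a * b)
    field_simp
    linear_combination h4
  have key : ∫ u in univ, (√((u ^ 2 + ((a + b) / 2) ^ 2) * (u ^ 2 + g ^ 2)))⁻¹ =
      ∫ x in Ioi (0 : ℝ), 2 * (√((x ^ 2 + a ^ 2) * (x ^ 2 + b ^ 2)))⁻¹ := by
    rw [← himg, integral_image_eq_integral_deriv_smul_of_monotoneOn measurableSet_Ioi
      (f' := fun x => (1 + a * b / x ^ 2) / 2)]
    · refine setIntegral_congr_fun measurableSet_Ioi fun x hx => ?_
      have hx : 0 < x := hx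
      have e : (((x - a * b / x) / 2) ^ 2 + ((a + b) / 2) ^ 2) *
          (((x - a * b / x) / 2) ^ 2 + g ^ 2) =
          ((1 + a * b / x ^ 2) / 4) ^ 2 * ((x ^ 2 + a ^ 2) * (x ^ 2 + b ^ 2)) := by
        rw [hg2]
        field_simp
        ring
      have hp : 0 < 1 + a * b / x ^ 2 := by positivity
      simp only [e, smul_eq_mul]
      rw [Real.sqrt_mul (sq_nonneg _), Real.sqrt_sq (by positivity), mul_inv]
      field_simp
      norm_num
    · intro x hx
      have hx : x ≠ 0 := ne_of_gt hx
      have h := (((hasDerivAt_id x).sub ((hasDerivAt_inv hx).const_mul (a * b))).div_const 2)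
      refine (h.congr_deriv ?_).hasDerivWithinAt
      field_simp
      ring
    · intro x hx y hy hxy
      have hx : 0 < x := hx
      have : a * b / y ≤ a * b / x := by gcongr
      simp only
      linarith
  rw [setIntegral_univ, integral_const_mul] at key
  have h2 := integral_comp_abs (f := fun u => (√((u ^ 2 + ((a + b) / 2) ^ 2) * (u ^ 2 + g ^ 2)))⁻¹)
  simp only [sq_abs] at h2
  linarith

theorem gaussInt_mem_Icc {a b m M : ℝ} (hm : 0 < m) (ha : a ∈ Icc m M) (hb : b ∈ Icc m M) :
    gaussInt a b ∈ Icc (M⁻¹ * (π / 2)) (m⁻¹ * (π / 2)) := by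
  have ha0 : 0 < a := hm.trans_le ha.1
  have hb0 : 0 < b := hm.trans_le hb.1
  have hM : 0 < M := ha0.trans_le ha.2
  have hlow (θ : ℝ) : m ≤ √(a ^ 2 * Real.cos θ ^ 2 + b ^ 2 * Real.sin θ ^ 2) := by
    apply Real.le_sqrt_of_sq_le
    have h1 := pow_le_pow_left₀ hm.le ha.1 2
    have h2 := pow_le_pow_left₀ hm.le hb.1 2
    have h3 := Real.sin_sq_add_cos_sq θ
    nlinarith [sq_nonneg (Real.sin θ), sq_nonneg (Real.cos θ)]
  have hup (θ : ℝ) : √(a ^ 2 * Real.cos θ ^ 2 + b ^ 2 * Real.sin θ ^ 2) ≤ M := by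
    apply Real.sqrt_le_iff.mpr ⟨hM.le, ?_⟩
    have h1 := pow_le_pow_left₀ ha0.le ha.2 2
    have h2 := pow_le_pow_left₀ hb0.le hb.2 2
    have h3 := Real.sin_sq_add_cos_sq θ
    nlinarith [sq_nonneg (Real.sin θ), sq_nonneg (Real.cos θ)]
  have hint : IntegrableOn (fun θ => (√(a ^ 2 * Real.cos θ ^ 2 + b ^ 2 * Real.sin θ ^ 2))⁻¹)
      (Ioo 0 (π / 2)) := by
    refine (Continuous.integrableOn_Icc (a := 0) (b := π / 2) ?_).mono_set Ioo_subset_Icc_self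
    exact Continuous.inv₀ (by fun_prop) fun θ => (hm.trans_le (hlow θ)).ne'
  have hconst (c : ℝ) : ∫ _ in Ioo (0 : ℝ) (π / 2), c = c * (π / 2) := by
    rw [setIntegral_const, measureReal_def, Real.volume_Ioo,
      ENNReal.toReal_ofReal (by linarith [Real.pi_pos])]
    simp only [sub_zero, smul_eq_mul]
    ring
  have hci (c : ℝ) : IntegrableOn (fun _ : ℝ => c) (Ioo 0 (π / 2)) :=
    integrableOn_const (by simp)
  constructor
  · rw [← hconst]
    exact setIntegral_mono (hci _) hint fun θ =>
      inv_anti₀ (hm.trans_le (hlow θ)) (hup θ)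
  · rw [← hconst]
    exact setIntegral_mono hint (hci _) fun θ => inv_anti₀ hm (hlow θ)

/-- A pair of positive sequences related by arithmetic and geometric means that tends to `(1, 1)`
starts at a pair with Gauss integral `π / 2`. -/
theorem gaussInt_eq_of_tendsto_one {a b : ℕ → ℝ} (ha : ∀ n, 0 < a n) (hb : ∀ n, 0 < b n)
    (hab : ∀ n, a (n + 1) = (a n + b n) / 2) (hab' : ∀ n, b (n + 1) ^ 2 = a n * b n)
    (ha1 : Tendsto a atTop (𝓝 1)) (hb1 : Tendsto b atTop (𝓝 1)) :
    gaussInt (a 0) (b 0) = π / 2 := by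
  have hconst (n : ℕ) : gaussInt (a n) (b n) = gaussInt (a 0) (b 0) := by
    induction n with
    | zero => rfl
    | succ n ih => rw [← ih, hab, gaussInt_mean (ha n) (hb n) (hb _) (hab' n)]
  have hmin : Tendsto (fun n => (min (a n) (b n))⁻¹ * (π / 2)) atTop (𝓝 (π / 2)) := by
    have h := ((ha1.min hb1).inv₀ (by simp)).mul_const (π / 2)
    simpa using h
  have hmax : Tendsto (fun n => (max (a n) (b n))⁻¹ * (π / 2)) atTop (𝓝 (π / 2)) := by
    have h := ((ha1.max hb1).inv₀ (by simp)).mul_const (π / 2)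
    simpa using h
  have hmem (n : ℕ) := gaussInt_mem_Icc (lt_min (ha n) (hb n)) (a := a n) (b := b n)
    (M := max (a n) (b n)) ⟨min_le_left _ _, le_max_left _ _⟩ ⟨min_le_right _ _, le_max_right _ _⟩
  simp only [hconst] at hmem
  exact le_antisymm (ge_of_tendsto' hmin fun n => (hmem n).2)
    (le_of_tendsto' hmax fun n => (hmem n).1)

/-! ### The complete elliptic integral on the cut plane and on the imaginary axis -/

/-- The plane cut along `[1, ∞)`. -/
def cutPlane : Set ℂ := {t | 1 - t ∈ slitPlane}

theorem isOpen_cutPlane : IsOpen cutPlane :=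
  isOpen_slitPlane.preimage (by fun_prop : Continuous fun t : ℂ => 1 - t)

theorem one_sub_mul_mem_slitPlane {t : ℂ} (ht : t ∈ cutPlane) {r : ℝ} (h0 : 0 ≤ r) (h1 : r ≤ 1) :
    1 - t * r ∈ slitPlane := by
  have h := StarConvex.add_smul_mem starConvex_one_slitPlane
    (y := -t) (by rw [← sub_eq_add_neg]; exact ht) h0 h1
  convert! h using 1
  rw [real_smul]
  ring

theorem one_sub_mul_sin_mem_slitPlane {t : ℂ} (ht : t ∈ cutPlane) (θ : ℝ) :
    1 - t * (Real.sin θ : ℂ) ^ 2 ∈ slitPlane := by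
  have h := one_sub_mul_mem_slitPlane ht (sq_nonneg (Real.sin θ)) (Real.sin_sq_le_one θ)
  push_cast at h ⊢
  exact h

theorem re_inv_cpow_half_pos {x : ℂ} (hx : x ∈ slitPlane) : 0 < (1 / x ^ (1 / 2 : ℂ)).re := by
  have h0 := slitPlane_ne_zero hx
  have hre : 0 < (x ^ (1 / 2 : ℂ)).re := by
    rw [cpow_def_of_ne_zero h0, exp_re]
    refine mul_pos (Real.exp_pos _) (Real.cos_pos_of_mem_Ioo ?_)
    have h1 : (log x * (1 / 2)).im = x.arg / 2 := by
      rw [show (1 / 2 : ℂ) = ((1 / 2 : ℝ) : ℂ) by push_cast; rfl, im_mul_ofReal, log_im]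
      ring
    rw [h1]
    have h2 := neg_pi_lt_arg x
    have h3 := (arg_le_pi x).lt_of_ne (mem_slitPlane_iff_arg.mp hx).1
    constructor <;> linarith
  rw [one_div, inv_re]
  exact div_pos hre (normSq_pos.mpr fun h => by rw [h, zero_re] at hre; exact hre.false)

theorem continuous_ellipticK_integrand {t : ℂ} (ht : t ∈ cutPlane) :
    Continuous fun θ : ℝ => 1 / (1 - t * (Real.sin θ : ℂ) ^ 2) ^ (1 / 2 : ℂ) := by
  refine continuous_const.div ?_ fun θ => ?_
  · exact Continuous.cpow (by fun_prop) continuous_const fun θ => one_sub_mul_sin_mem_slitPlane ht θ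
  · exact (cpow_ne_zero_iff_of_exponent_ne_zero (by norm_num)).mpr
      (slitPlane_ne_zero (one_sub_mul_sin_mem_slitPlane ht θ))

/-- The principal square root has positive real part off its cut, hence so has the integrand. The
point is that K has no zeros, so that `periodRatio` is holomorphic. -/
theorem re_ellipticKsqrt_pos {t : ℂ} (ht : t ∈ cutPlane) : 0 < (ellipticKsqrt t).re := by
  have hc := continuous_ellipticK_integrand ht
  have hi := hc.intervalIntegrable (μ := volume) 0 (π / 2)
  have h : (ellipticKsqrt t).re =
      ∫ θ in (0 : ℝ)..(π / 2), (1 / (1 - t * (Real.sin θ : ℂ) ^ 2) ^ (1 / 2 : ℂ)).re :=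
    (intervalIntegral.intervalIntegral_re hi).symm
  rw [h]
  refine intervalIntegral.intervalIntegral_pos_of_pos_on
    ((continuous_re.comp hc).intervalIntegrable _ _) (fun θ _ =>
      re_inv_cpow_half_pos (one_sub_mul_sin_mem_slitPlane ht θ)) (by positivity)

theorem ellipticKsqrt_ne_zero {t : ℂ} (ht : t ∈ cutPlane) : ellipticKsqrt t ≠ 0 := fun h => by
  have := re_ellipticKsqrt_pos ht
  simp [h] at this

theorem differentiableAt_ellipticKsqrt {t : ℂ} (ht : t ∈ cutPlane) :
    DifferentiableAt ℂ ellipticKsqrt t := by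
  obtain ⟨r, hr0, hr⟩ := Metric.nhds_basis_closedBall.mem_iff.mp (isOpen_cutPlane.mem_nhds ht)
  set F' : ℂ → ℝ → ℂ := fun t θ => (1 / 2 : ℂ) * (Real.sin θ : ℂ) ^ 2 *
    (1 - t * (Real.sin θ : ℂ) ^ 2) ^ (-(1 / 2 : ℂ) - 1) with hF'
  have hcont : ContinuousOn (Function.uncurry F') (Metric.closedBall t r ×ˢ Icc 0 (π / 2)) := by
    intro p hp
    refine ContinuousAt.continuousWithinAt ?_
    refine ContinuousAt.mul (by fun_prop) (ContinuousAt.cpow (by fun_prop) continuousAt_const ?_)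
    exact one_sub_mul_sin_mem_slitPlane (hr hp.1) _
  obtain ⟨C, hC⟩ := ((isCompact_closedBall t r).prod isCompact_Icc).exists_bound_of_continuousOn hcont
  have hpi := Real.pi_pos
  have huIoc : uIoc (0 : ℝ) (π / 2) ⊆ Icc 0 (π / 2) := by
    rw [uIoc_of_le (by positivity)]
    exact Ioc_subset_Icc_self
  have hcF' : Continuous (F' t) := by
    refine Continuous.mul (by fun_prop) (Continuous.cpow (by fun_prop) continuous_const ?_)
    exact fun θ => one_sub_mul_sin_mem_slitPlane ht θ
  refine (intervalIntegral.hasDerivAt_integral_of_dominated_loc_of_deriv_le (F' := F')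
    (bound := fun _ => C) (Metric.closedBall_mem_nhds t hr0) ?_
    ((continuous_ellipticK_integrand ht).intervalIntegrable _ _) hcF'.aestronglyMeasurable ?_
    (intervalIntegrable_const) ?_).2.differentiableAt
  · filter_upwards [isOpen_cutPlane.mem_nhds ht] with x hx
    exact (continuous_ellipticK_integrand hx).aestronglyMeasurable
  · exact Eventually.of_forall fun θ hθ x hx => hC (x, θ) ⟨hx, huIoc hθ⟩
  · refine Eventually.of_forall fun θ hθ x hx => ?_
    have hm := one_sub_mul_sin_mem_slitPlane (hr hx) θ
    have h1 : HasDerivAt (fun x : ℂ => 1 - x * (Real.sin θ : ℂ) ^ 2) (-(Real.sin θ : ℂ) ^ 2) x := by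
      simpa using ((hasDerivAt_id x).mul_const ((Real.sin θ : ℂ) ^ 2)).const_sub 1
    have h2 := h1.cpow_const (c := -(1 / 2 : ℂ)) hm
    have h3 : (fun x : ℂ => 1 / (1 - x * (Real.sin θ : ℂ) ^ 2) ^ (1 / 2 : ℂ)) =
        fun x : ℂ => (1 - x * (Real.sin θ : ℂ) ^ 2) ^ (-(1 / 2 : ℂ)) := by
      ext x
      rw [cpow_neg, one_div]
    rw [h3]
    refine h2.congr_deriv ?_
    simp only [hF']
    ring

theorem conj_theta3 (τ : ℂ) : (starRingEnd ℂ) (theta3 τ) = theta3 (-(starRingEnd ℂ) τ) := by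
  rw [theta3, theta3, jacobiTheta₂_conj, map_zero]

theorem conj_theta4 (τ : ℂ) : (starRingEnd ℂ) (theta4 τ) = theta4 (-(starRingEnd ℂ) τ) := by
  rw [theta4, theta4, jacobiTheta₂_conj]
  congr 1
  simp [map_ofNat]

theorem neg_conj_mul_I (y : ℝ) : -(starRingEnd ℂ) (y * I) = y * I := by simp

theorem theta3_mul_I_real (y : ℝ) : ((theta3 (y * I)).re : ℂ) = theta3 (y * I) :=
  conj_eq_iff_re.mp (by rw [conj_theta3, neg_conj_mul_I])

theorem theta4_mul_I_real (y : ℝ) : ((theta4 (y * I)).re : ℂ) = theta4 (y * I) :=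
  conj_eq_iff_re.mp (by rw [conj_theta4, neg_conj_mul_I])

/-- By the duplication formulas, θ₃² and θ₄² at 2ⁿ y i are successive arithmetic and geometric
means, and both tend to 1. -/
theorem gaussInt_theta {y : ℝ} (hy : 0 < y) :
    gaussInt ((theta3 (y * I)).re ^ 2) ((theta4 (y * I)).re ^ 2) = π / 2 := by
  obtain ⟨Y, hY0, hYs, hYpos, hYlim⟩ : ∃ Y : ℕ → ℝ, Y 0 = y ∧ (∀ n, Y (n + 1) = 2 * Y n) ∧
      (∀ n, 0 < Y n) ∧ Tendsto Y atTop atTop :=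
    ⟨fun n => 2 ^ n * y, by simp, fun n => by ring, fun n => by positivity,
      (tendsto_pow_atTop_atTop_of_one_lt one_lt_two).atTop_mul_const hy⟩
  have hpos (n : ℕ) : 0 < (Y n * I : ℂ).im := by simpa using hYpos n
  have h3 (n : ℕ) : (theta3 (Y n * I)).re ≠ 0 := fun h =>
    theta3_ne_zero (hpos n) (by rw [← theta3_mul_I_real, h, ofReal_zero])
  have h4 (n : ℕ) : (theta4 (Y n * I)).re ≠ 0 := fun h =>
    theta4_ne_zero (hpos n) (by rw [← theta4_mul_I_real, h, ofReal_zero])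
  have hdouble (n : ℕ) : (2 * (Y n * I) : ℂ) = Y (n + 1) * I := by
    rw [hYs]; push_cast; ring
  have hlim : Tendsto (fun n : ℕ => (Y n * I : ℂ)) atTop imTop := by
    rw [imTop, tendsto_comap_iff]
    exact hYlim.congr fun n => by simp [Function.comp]
  have h := gaussInt_eq_of_tendsto_one (a := fun n => (theta3 (Y n * I)).re ^ 2)
    (b := fun n => (theta4 (Y n * I)).re ^ 2) (fun n => by have := h3 n; positivity)
    (fun n => by have := h4 n; positivity) (fun n => ?_) (fun n => ?_) ?_ ?_
  · simpa [hY0] using h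
  · have e := theta3_sq_add_theta4_sq (hpos n)
    rw [hdouble, ← theta3_mul_I_real (Y n), ← theta4_mul_I_real (Y n),
      ← theta3_mul_I_real (Y (n + 1))] at e
    norm_cast at e
    linarith
  · have e := theta3_mul_theta4 (hpos n)
    rw [hdouble, ← theta3_mul_I_real (Y n), ← theta4_mul_I_real (Y n),
      ← theta4_mul_I_real (Y (n + 1))] at e
    norm_cast at e
    rw [← e]
    ring
  · have := (continuous_re.tendsto _).comp (tendsto_theta3.comp hlim)
    simpa [Function.comp] using this.pow 2
  · have := (continuous_re.tendsto _).comp (tendsto_theta4.comp hlim)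
    simpa [Function.comp] using this.pow 2

/-- With a = θ₃ and b = θ₄ one has 1 - λ sin² θ = (a⁴ cos² θ + b⁴ sin² θ)/a⁴, so K is a² times the
Gauss integral of (a², b²). -/
theorem ellipticKsqrt_modularLambda_mul_I {y : ℝ} (hy : 0 < y) :
    ellipticKsqrt (modularLambda (y * I)) = π / 2 * theta3 (y * I) ^ 2 := by
  have hτ : 0 < (y * I : ℂ).im := by simpa using hy
  set a := (theta3 (y * I)).re with ha
  set b := (theta4 (y * I)).re with hb
  have ha0 : a ≠ 0 := fun h => theta3_ne_zero hτ (by rw [← theta3_mul_I_real, ← ha, h, ofReal_zero])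
  have hb0 : b ≠ 0 := fun h => theta4_ne_zero hτ (by rw [← theta4_mul_I_real, ← hb, h, ofReal_zero])
  have hl : modularLambda (y * I) = ((1 - b ^ 4 / a ^ 4 : ℝ) : ℂ) := by
    have h := one_sub_modularLambda hτ
    rw [← theta3_mul_I_real, ← theta4_mul_I_real, ← ha, ← hb] at h
    push_cast
    linear_combination -h
  have hint (θ : ℝ) : 1 / (1 - modularLambda (y * I) * (Real.sin θ : ℂ) ^ 2) ^ (1 / 2 : ℂ) =
      ((a ^ 2 * (√((a ^ 2) ^ 2 * Real.cos θ ^ 2 + (b ^ 2) ^ 2 * Real.sin θ ^ 2))⁻¹ : ℝ) : ℂ) := by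
    have hsc := Real.sin_sq_add_cos_sq θ
    have e : 1 - (1 - b ^ 4 / a ^ 4) * Real.sin θ ^ 2 =
        ((a ^ 2) ^ 2 * Real.cos θ ^ 2 + (b ^ 2) ^ 2 * Real.sin θ ^ 2) / (a ^ 2) ^ 2 := by
      field_simp
      linear_combination -a ^ 4 * hsc
    have e2 : (1 - modularLambda (y * I) * (Real.sin θ : ℂ) ^ 2) =
        (((a ^ 2) ^ 2 * Real.cos θ ^ 2 + (b ^ 2) ^ 2 * Real.sin θ ^ 2) / (a ^ 2) ^ 2 : ℝ) := by
      rw [← e, hl]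
      push_cast
      ring
    rw [e2, show (1 / 2 : ℂ) = ((1 / 2 : ℝ) : ℂ) by push_cast; rfl, ← ofReal_cpow (by positivity),
      ← Real.sqrt_eq_rpow, Real.sqrt_div' _ (by positivity), Real.sqrt_sq (by positivity),
      one_div, ← ofReal_inv, inv_div, div_eq_mul_inv]
  rw [ellipticKsqrt, intervalIntegral.integral_congr (fun θ _ => hint θ),
    intervalIntegral.integral_ofReal, intervalIntegral.integral_const_mul,
    intervalIntegral.integral_of_le (by positivity), integral_Ioc_eq_integral_Ioo]
  have h := gaussInt_theta hy
  rw [gaussInt] at h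
  rw [h, ← theta3_mul_I_real, ← ha]
  push_cast
  ring

end EpsteinRepn

/-! ### The fundamental domain of Γ(2) and the values of λ on it -/

namespace EpsteinRepn
open Complex hiding eta
open Filter Topology ModularForm EisensteinSeries
open scoped Real Nat
open Set

/-- The interior of the standard fundamental domain of `Γ(2)`. -/
def fundDomain : Set ℂ := {τ | 0 < τ.im ∧ |τ.re| < 1 ∧ |τ.re| < normSq τ}

theorem isOpen_fundDomain : IsOpen fundDomain :=
  (isOpen_lt continuous_const continuous_im).and ((isOpen_lt continuous_re.abs continuous_const).and
    (isOpen_lt continuous_re.abs continuous_normSq))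

/-- The domain is the region above the graph of √(|x| - x²) over (-1, 1), hence a continuous image
of a product of intervals. -/
theorem isPreconnected_fundDomain : IsPreconnected fundDomain := by
  have hc : IsPreconnected (Ioo (-1 : ℝ) 1 ×ˢ Ioi (0 : ℝ)) :=
    ((convex_Ioo _ _).prod (convex_Ioi _)).isPreconnected
  have himg : (fun p : ℝ × ℝ => ((p.1 : ℂ) + (√(|p.1| - p.1 ^ 2) + p.2 : ℝ) * I)) ''
      (Ioo (-1 : ℝ) 1 ×ˢ Ioi (0 : ℝ)) = fundDomain := by
    ext τ
    constructor
    · rintro ⟨⟨x, s⟩, ⟨hx, hs⟩, rfl⟩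
      have hx : |x| < 1 := abs_lt.mpr hx
      have hs : 0 < s := hs
      have h0 : 0 ≤ |x| - x ^ 2 := by
        rw [← sq_abs]
        nlinarith [abs_nonneg x]
      have h1 := Real.sq_sqrt h0
      have h2 := Real.sqrt_nonneg (|x| - x ^ 2)
      refine ⟨by simp; positivity, by simpa using hx, ?_⟩
      rw [normSq_apply]
      simp
      nlinarith
    · rintro ⟨h1, h2, h3⟩
      have h4 : √(|τ.re| - τ.re ^ 2) < τ.im := by
        rw [Real.sqrt_lt' h1]
        rw [normSq_apply] at h3
        linarith
      refine ⟨(τ.re, τ.im - √(|τ.re| - τ.re ^ 2)), ⟨abs_lt.mp h2, sub_pos.mpr h4⟩, ?_⟩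
      apply Complex.ext <;> simp
  rw [← himg]
  exact hc.image _ (by fun_prop)

theorem neg_one_div_re (τ : ℂ) : (-1 / τ).re = -τ.re / normSq τ := by
  simp [div_re]

theorem neg_one_div_im (τ : ℂ) : (-1 / τ).im = τ.im / normSq τ := by
  simp [neg_div]

/-- The inversion exchanges the conditions |Re τ| < 1 and |Re τ| < |τ|². -/
theorem neg_one_div_mem_fundDomain {τ : ℂ} (h : τ ∈ fundDomain) : -1 / τ ∈ fundDomain := by
  obtain ⟨h1, h2, h3⟩ := h
  have hn : 0 < normSq τ := normSq_pos.mpr (ne_zero_of_im_pos h1)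
  refine ⟨neg_one_div_im_pos h1, ?_, ?_⟩
  · rw [neg_one_div_re, abs_div, abs_neg, abs_of_pos hn, div_lt_one hn]
    exact h3
  · rw [neg_one_div_re, abs_div, abs_neg, abs_of_pos hn, normSq_div]
    simp only [normSq_neg, normSq_one]
    gcongr

/-- On the imaginary axis θ₃ and θ₄ are real, so 1 - λ = θ₄⁴/θ₃⁴ is positive; the same at -1/τ,
where λ becomes 1 - λ, gives λ > 0. -/
theorem modularLambda_mul_I {y : ℝ} (hy : 0 < y) :
    ∃ r : ℝ, 0 < r ∧ r < 1 ∧ modularLambda (y * I) = r := by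
  have key {y : ℝ} (hy : 0 < y) : ∃ r : ℝ, r < 1 ∧ modularLambda (y * I) = r := by
    have hτ : 0 < (y * I : ℂ).im := by simpa using hy
    have h := one_sub_modularLambda hτ
    have h3 := theta3_ne_zero hτ
    have h4 := theta4_ne_zero hτ
    rw [← theta3_mul_I_real] at h h3
    rw [← theta4_mul_I_real] at h h4
    rw [Ne, ofReal_eq_zero] at h3 h4
    refine ⟨1 - (theta4 (y * I)).re ^ 4 / (theta3 (y * I)).re ^ 4, ?_, ?_⟩
    · have : 0 < (theta4 (y * I)).re ^ 4 / (theta3 (y * I)).re ^ 4 := by positivity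
      linarith
    · push_cast
      linear_combination -h
  obtain ⟨r, hr, h⟩ := key hy
  obtain ⟨r', hr', h'⟩ := key (inv_pos.mpr hy)
  refine ⟨r, ?_, hr, h⟩
  have hτ : 0 < (y * I : ℂ).im := by simpa using hy
  have e : (-1 / (y * I) : ℂ) = (y⁻¹ : ℝ) * I := by
    have : (y : ℂ) ≠ 0 := by exact_mod_cast hy.ne'
    push_cast
    field_simp
    simp
  have h2 := modularLambda_neg_one_div hτ
  rw [e, h', h] at h2
  have h3 : r' = 1 - r := by exact_mod_cast h2
  linarith

theorem modularLambda_neg_conj {τ : ℂ} (hτ : 0 < τ.im) :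
    modularLambda (-(starRingEnd ℂ) τ) = (starRingEnd ℂ) (modularLambda τ) := by
  have hτ' : 0 < (-(starRingEnd ℂ) τ).im := by simpa using hτ
  have h := one_sub_modularLambda hτ'
  rw [← conj_theta3, ← conj_theta4, ← map_pow, ← map_pow, ← map_div₀,
    ← one_sub_modularLambda hτ, map_sub, map_one] at h
  linear_combination -h

/-- Here Im τ ≥ √3/2, so |q| ≤ e^(-2.6) ≤ 0.08 and |θ₄ - 1| ≤ 2|q|/(1 - |q|) ≤ 0.175. Expanding (1 +
d)⁴ - 1 leaves a factor at most 5.5, and 0.175 · 5.5 < 1. -/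
theorem norm_theta4_pow_four_sub_one_lt {τ : ℂ} (hτ : 0 < τ.im) (h : 3 / 4 ≤ τ.im ^ 2) :
    ‖theta4 τ ^ 4 - 1‖ < 1 := by
  have hy : 0.866 < τ.im := by nlinarith
  have hq : Real.exp (-π * τ.im) ≤ 0.08 := by
    have h1 : -π * τ.im ≤ -2.6 := by nlinarith [Real.pi_gt_d2]
    have h2 : Real.exp (-π * τ.im) ≤ Real.exp (-2.6) := Real.exp_le_exp.mpr h1
    have h3 : (12.5 : ℝ) ≤ Real.exp 2.6 := by
      have e : Real.exp 2.6 = Real.exp 1 * Real.exp 1 * Real.exp 0.6 := by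
        rw [← Real.exp_add, ← Real.exp_add]
        norm_num
      have h4 := Real.exp_one_gt_d9
      have h5 : (1 + 0.6 + 0.6 ^ 2 / 2 : ℝ) ≤ Real.exp 0.6 := Real.quadratic_le_exp_of_nonneg (by norm_num)
      rw [e]
      have h6 : (2.7 * 2.7 : ℝ) ≤ Real.exp 1 * Real.exp 1 := by nlinarith
      nlinarith
    rw [Real.exp_neg] at h2
    refine h2.trans ?_
    rw [inv_le_comm₀ (by positivity) (by norm_num)]
    norm_num at h3 ⊢
    exact h3
  have h1 : ‖theta4 τ - 1‖ ≤ 0.175 := by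
    rw [← theta3_add_one]
    have h2 := norm_jacobiTheta_sub_one_le (τ := τ + 1) (by simpa using hτ)
    rw [jacobiTheta_eq_jacobiTheta₂] at h2
    refine h2.trans ?_
    have e : (τ + 1).im = τ.im := by simp
    rw [e, div_mul_eq_mul_div, div_le_iff₀ (by linarith)]
    linarith
  set d := theta4 τ - 1 with hd
  have e : theta4 τ ^ 4 - 1 = d * (4 + 6 * d + 4 * d ^ 2 + d ^ 3) := by rw [hd]; ring
  have h2 : ‖4 + 6 * d + 4 * d ^ 2 + d ^ 3‖ ≤ 4 + 6 * ‖d‖ + 4 * ‖d‖ ^ 2 + ‖d‖ ^ 3 := by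
    refine (norm_add_le _ _).trans ?_
    rw [norm_pow]
    gcongr
    refine (norm_add_le _ _).trans ?_
    gcongr
    · refine (norm_add_le _ _).trans ?_
      rw [norm_mul]
      simp
    · rw [norm_mul, norm_pow]
      simp
  rw [e, norm_mul]
  have h3 := norm_nonneg d
  have h4 : 4 + 6 * ‖d‖ + 4 * ‖d‖ ^ 2 + ‖d‖ ^ 3 ≤ 5.5 := by
    have : ‖d‖ ^ 2 ≤ 0.175 ^ 2 := by gcongr
    have : ‖d‖ ^ 3 ≤ 0.175 ^ 3 := by gcongr
    norm_num at *
    linarith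
  calc ‖d‖ * ‖4 + 6 * d + 4 * d ^ 2 + d ^ 3‖ ≤ 0.175 * 5.5 := by
        apply mul_le_mul h1 (h2.trans h4) (norm_nonneg _) (by norm_num)
    _ < 1 := by norm_num

/-- On a horizontal line λ' = i(πθ₄⁴)λ, so λ(x + iy) = λ(iy) exp(iA(x)) with A the integral of πθ₄⁴.
The bound on θ₄ puts the derivative of Re A strictly between 0 and 2π. As λ(1 + iy) is real, Re A(1)
is a multiple of π in (0, 2π), namely π; by monotonicity Re A lies in (0, π) between the ends. -/
theorem modularLambda_im_pos_of_im_large {x y : ℝ} (hy : 0 < y) (hy2 : 3 / 4 ≤ y ^ 2)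
    (hx0 : 0 < x) (hx1 : x < 1) : 0 < (modularLambda (x + y * I)).im := by
  have him (s : ℝ) : 0 < (s + y * I : ℂ).im := by simpa using hy
  set g : ℝ → ℂ := fun s => π * theta4 (s + y * I) ^ 4 with hg
  have hgc : Continuous g := by
    refine continuous_const.mul (Continuous.pow ?_ 4)
    refine continuous_iff_continuousAt.mpr fun s => ?_
    exact (differentiableAt_theta4 (him s)).continuousAt.comp
      (f := fun s : ℝ => (s + y * I : ℂ)) (by fun_prop)
  set A : ℝ → ℂ := fun x => ∫ s in (0 : ℝ)..x, g s with hA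
  have hAd (s : ℝ) : HasDerivAt A (g s) s := hgc.integral_hasStrictDerivAt 0 s |>.hasDerivAt
  have hfd (s : ℝ) : HasDerivAt (fun s : ℝ => modularLambda (s + y * I))
      (I * g s * modularLambda (s + y * I)) s := by
    have h1 : HasDerivAt (fun s : ℝ => (s + y * I : ℂ)) 1 s :=
      (hasDerivAt_id s).ofReal_comp.add_const _
    have h2 := (hasDerivAt_modularLambda (him s)).comp s h1
    refine h2.congr_deriv ?_
    rw [one_sub_modularLambda (him s), hg]
    have h3 := pow_ne_zero 4 (theta3_ne_zero (him s))
    rw [mul_one, mul_assoc _ (_ / _), div_mul_cancel₀ _ h3]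
    ring
  have hconst (s : ℝ) : modularLambda (s + y * I) * cexp (-(I * A s)) = modularLambda (y * I) := by
    have h := is_const_of_deriv_eq_zero
      (f := fun s : ℝ => modularLambda (s + y * I) * cexp (-(I * A s)))
      (fun s => ((hfd s).mul ((hAd s).const_mul I).neg.cexp).differentiableAt)
      (fun s => by
        refine ((hfd s).mul ((hAd s).const_mul I).neg.cexp).deriv.trans ?_
        ring) s 0
    simpa [hA] using h
  obtain ⟨r, hr0, hr1, hr⟩ := modularLambda_mul_I hy
  have hval (s : ℝ) : (modularLambda (s + y * I)).im =
      r * (Real.exp (-(A s).im) * Real.sin (A s).re) := by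
    have h := hconst s
    rw [hr, exp_neg, ← div_eq_mul_inv, div_eq_iff (exp_ne_zero _)] at h
    rw [h, im_ofReal_mul, exp_im]
    simp
  have hRd (s : ℝ) : HasDerivAt (fun s => (A s).re) (g s).re s := by
    exact (hasDerivAt_const s reCLM).clm_apply (hAd s) |>.congr_deriv (by simp)
  have hgre (s : ℝ) : 0 < (g s).re ∧ (g s).re < 2 * π := by
    have h1 := norm_theta4_pow_four_sub_one_lt (him s) (by simpa using hy2)
    have h2 := (abs_re_le_norm _).trans_lt h1
    rw [sub_re, one_re, abs_lt] at h2
    have h3 : (g s).re = π * (theta4 (s + y * I) ^ 4).re := by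
      rw [hg]
      exact re_ofReal_mul _ _
    rw [h3]
    have := Real.pi_pos
    constructor <;> nlinarith [h2.1, h2.2]
  have hmono : StrictMono fun s => (A s).re :=
    strictMono_of_deriv_pos fun s => by rw [(hRd s).deriv]; exact (hgre s).1
  have hanti : StrictAnti fun s => (A s).re - 2 * π * s :=
    strictAnti_of_deriv_neg fun s => by
      have h := (hRd s).sub ((hasDerivAt_id s).const_mul (2 * π))
      have h' := h.deriv
      simp only [id] at h'
      refine lt_of_eq_of_lt h' ?_
      linarith [(hgre s).2]
  have hA0 : (A 0).re = 0 := by simp [hA]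
  have h01 := hmono zero_lt_one
  have h01' := hanti zero_lt_one
  simp only [hA0, mul_zero, sub_zero, mul_one] at h01 h01'
  have hR1 : (A 1).re = π := by
    have h1 := hval 1
    have h2 : (modularLambda ((1 : ℝ) + y * I)).im = 0 := by
      have h3 := modularLambda_add_one (τ := y * I) (by simpa using hy)
      rw [ofReal_one, add_comm, h3, hr]
      have : ((r : ℂ) / (r - 1)) = ((r / (r - 1) : ℝ) : ℂ) := by push_cast; rfl
      rw [this, ofReal_im]
    rw [h2] at h1
    have h3 : Real.sin (A 1).re = 0 := by
      rcases mul_eq_zero.mp h1.symm with h | h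
      · exact absurd h hr0.ne'
      · exact (mul_eq_zero.mp h).resolve_left (Real.exp_pos _).ne'
    rcases lt_trichotomy (A 1).re π with h | h | h
    · exact absurd h3 (Real.sin_pos_of_pos_of_lt_pi h01 h).ne'
    · exact h
    · have h4 := Real.sin_pos_of_pos_of_lt_pi (x := (A 1).re - π) (by linarith) (by linarith)
      rw [Real.sin_sub_pi, h3] at h4
      simp at h4
  rw [hval x]
  have h1 := hmono hx0
  have h2 := hmono hx1
  simp only [hA0, hR1] at h1 h2
  have := Real.sin_pos_of_pos_of_lt_pi h1 h2
  positivity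

theorem modularLambda_im_pos_of_one_le {τ : ℂ} (hτ : 0 < τ.im) (h0 : 0 < τ.re) (h1 : τ.re < 1)
    (h2 : 1 ≤ normSq τ) (h3 : 1 ≤ normSq (τ - 1)) : 0 < (modularLambda τ).im := by
  have h4 : 3 / 4 ≤ τ.im ^ 2 := by
    rw [normSq_apply] at h2 h3
    simp at h3
    nlinarith
  have h := modularLambda_im_pos_of_im_large hτ h4 h0 h1
  rwa [re_add_im] at h

theorem modularLambda_sub_one {τ : ℂ} (hτ : 0 < τ.im) :
    modularLambda (τ - 1) = modularLambda τ / (modularLambda τ - 1) := by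
  have hτ' : 0 < (τ - 1).im := by simpa using hτ
  have h := modularLambda_add_one hτ'
  have h1 := one_sub_modularLambda_ne_zero hτ'
  have h1' : modularLambda (τ - 1) - 1 ≠ 0 := fun h => h1 (by linear_combination -h)
  rw [sub_add_cancel] at h
  rw [h]
  field_simp
  ring

theorem im_div_normSq_pos {w : ℂ} (h : 0 < (w⁻¹).im) : w.im < 0 := by
  rw [inv_im] at h
  by_contra h'
  have : -w.im / normSq w ≤ 0 := div_nonpos_of_nonpos_of_nonneg (by linarith) (normSq_nonneg w)
  linarith

/-- The ideal triangle with vertices 0, 1, ∞ is covered by the part with |τ| ≥ 1 and |τ - 1| ≥ 1 and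
its images under the rotations of order three, -1/(τ - 1) and 1 - 1/τ. These turn λ into 1/(1 - λ)
and 1 - 1/λ, which preserve the sign of the imaginary part. -/
theorem modularLambda_im_pos {τ : ℂ} (hτ : 0 < τ.im) (h0 : 0 < τ.re) (h1 : τ.re < 1)
    (h2 : τ.re < normSq τ) : 0 < (modularLambda τ).im := by
  have hn := ne_zero_of_im_pos hτ
  have hτ1 : 0 < (τ - 1).im := by simpa using hτ
  have hn1 := ne_zero_of_im_pos hτ1
  have hp : 0 < normSq τ := normSq_pos.mpr hn
  have hp1 : 0 < normSq (τ - 1) := normSq_pos.mpr hn1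
  have e1 : normSq (τ - 1) = normSq τ - 2 * τ.re + 1 := by
    rw [normSq_apply, normSq_apply]
    simp
    ring
  have hl := modularLambda_ne_zero hτ
  have hl1 := one_sub_modularLambda_ne_zero hτ
  have hl2 : modularLambda τ - 1 ≠ 0 := fun h => hl1 (by linear_combination -h)
  by_cases hA : 1 ≤ normSq τ ∧ 1 ≤ normSq (τ - 1)
  · exact modularLambda_im_pos_of_one_le hτ h0 h1 hA.1 hA.2
  by_cases hB : normSq (τ - 1) ≤ normSq τ
  · have hB1 : normSq (τ - 1) < 1 := by
      by_contra h
      push Not at h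
      exact hA ⟨h.trans hB, h⟩
    have h := modularLambda_im_pos_of_one_le (τ := -1 / (τ - 1)) (neg_one_div_im_pos hτ1) ?_ ?_ ?_ ?_
    · rw [modularLambda_neg_one_div hτ1, modularLambda_sub_one hτ] at h
      have e : 1 - modularLambda τ / (modularLambda τ - 1) = (1 - modularLambda τ)⁻¹ := by
        field_simp
        ring
      rw [e] at h
      have := im_div_normSq_pos h
      simpa using this
    · rw [neg_one_div_re]
      refine div_pos ?_ hp1
      simpa using h1
    · rw [neg_one_div_re, div_lt_one hp1, e1]
      simp
      linarith
    · rw [normSq_div]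
      simp only [normSq_neg, normSq_one]
      rw [le_div_iff₀ hp1]
      linarith
    · have e : -1 / (τ - 1) - 1 = -(τ / (τ - 1)) := by
        field_simp
        ring
      rw [e, normSq_neg, normSq_div, le_div_iff₀ hp1]
      linarith
  · push Not at hB
    have hB1 : normSq τ < 1 := by
      by_contra h
      push Not at h
      exact hA ⟨h, h.trans hB.le⟩
    have hS := neg_one_div_im_pos hτ
    have h := modularLambda_im_pos_of_one_le (τ := -1 / τ + 1) (im_add_one_pos hS) ?_ ?_ ?_ ?_
    · rw [modularLambda_add_one hS, modularLambda_neg_one_div hτ] at h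
      have e : (1 - modularLambda τ) / (1 - modularLambda τ - 1) = 1 - (modularLambda τ)⁻¹ := by
        rw [show 1 - modularLambda τ - 1 = -modularLambda τ by ring]
        field_simp
        ring
      rw [e, sub_im, one_im, zero_sub, ← neg_im, ← inv_neg] at h
      have := im_div_normSq_pos h
      simpa using this
    · have : τ.re / normSq τ < 1 := (div_lt_one hp).mpr h2
      rw [add_re, neg_one_div_re, one_re, neg_div]
      linarith
    · have : 0 < τ.re / normSq τ := by positivity
      rw [add_re, neg_one_div_re, one_re, neg_div]
      linarith
    · have e : -1 / τ + 1 = (τ - 1) / τ := by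
        field_simp
        ring
      rw [e, normSq_div, le_div_iff₀ hp]
      linarith
    · rw [add_sub_cancel_right, normSq_div]
      simp only [normSq_neg, normSq_one]
      rw [le_div_iff₀ hp]
      linarith

/-- The plane cut along `(-∞, 0]` and `[1, ∞)`. -/
def doublyCutPlane : Set ℂ := {t | t.im ≠ 0 ∨ (0 < t.re ∧ t.re < 1)}

theorem mem_cutPlane_of_mem {t : ℂ} (h : t ∈ doublyCutPlane) : t ∈ cutPlane := by
  rcases h with h | h
  · exact Or.inr (by simpa using h)
  · exact Or.inl (by simpa using h.2)

theorem one_sub_mem_doublyCutPlane {t : ℂ} (h : t ∈ doublyCutPlane) : 1 - t ∈ doublyCutPlane := by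
  rcases h with h | h
  · exact Or.inl (by simpa using h)
  · exact Or.inr ⟨by simpa using h.2, by simpa using h.1⟩

theorem modularLambda_mem {τ : ℂ} (h : τ ∈ fundDomain) : modularLambda τ ∈ doublyCutPlane := by
  obtain ⟨hτ, h1, h2⟩ := h
  rcases lt_trichotomy τ.re 0 with h0 | h0 | h0
  · left
    have h := modularLambda_im_pos (τ := -(starRingEnd ℂ) τ) (by simpa using hτ) (by simpa using h0)
      (by simp; linarith [neg_abs_le τ.re]) (by
        rw [normSq_neg, normSq_conj]
        simp
        linarith [neg_abs_le τ.re])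
    rw [modularLambda_neg_conj hτ, conj_im] at h
    exact fun h' => by simp [h'] at h
  · right
    obtain ⟨r, hr0, hr1, hr⟩ := modularLambda_mul_I hτ
    have e : τ = τ.im * I := by
      conv_lhs => rw [← re_add_im τ, h0]
      simp
    rw [e, hr]
    exact ⟨by simpa using hr0, by simpa using hr1⟩
  · left
    exact (modularLambda_im_pos hτ h0 (lt_of_abs_lt h1) (lt_of_abs_lt h2)).ne'

/-- The identity is known on the imaginary axis. On the domain λ avoids the cut of K, so both sides
are analytic on a connected open set and the identity theorem applies. -/
theorem ellipticKsqrt_modularLambda {τ : ℂ} (h : τ ∈ fundDomain) :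
    ellipticKsqrt (modularLambda τ) = π / 2 * theta3 τ ^ 2 := by
  have hf : DifferentiableOn ℂ (fun τ => ellipticKsqrt (modularLambda τ)) fundDomain :=
    fun v hv => ((differentiableAt_ellipticKsqrt (mem_cutPlane_of_mem (modularLambda_mem hv))).comp v
      (differentiableAt_modularLambda hv.1)).differentiableWithinAt
  have hg : DifferentiableOn ℂ (fun τ => (π / 2 * theta3 τ ^ 2 : ℂ)) fundDomain :=
    fun v hv => (((differentiableAt_theta3 hv.1).pow 2).const_mul _).differentiableWithinAt
  have hI : I ∈ fundDomain := by simp [fundDomain]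
  refine AnalyticOnNhd.eqOn_of_preconnected_of_frequently_eq
    (hf.analyticOnNhd isOpen_fundDomain) (hg.analyticOnNhd isOpen_fundDomain)
    isPreconnected_fundDomain hI ?_ h
  have ht : Tendsto (fun y : ℝ => (y * I : ℂ)) (𝓝[≠] 1) (𝓝[≠] I) := by
    refine tendsto_nhdsWithin_iff.mpr ⟨?_, ?_⟩
    · have : ContinuousAt (fun y : ℝ => (y * I : ℂ)) 1 := by fun_prop
      have := this.tendsto
      simp only [ofReal_one, one_mul] at this
      exact this.mono_left nhdsWithin_le_nhds
    · filter_upwards [self_mem_nhdsWithin] with y hy h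
      apply hy
      have := congrArg Complex.im h
      simpa using this
  refine ht.frequently (Eventually.frequently ?_)
  filter_upwards [nhdsWithin_le_nhds (Ioi_mem_nhds (zero_lt_one : (0 : ℝ) < 1))] with y hy
  exact ellipticKsqrt_modularLambda_mul_I hy

theorem ellipticKsqrt_one_sub_modularLambda {τ : ℂ} (h : τ ∈ fundDomain) :
    ellipticKsqrt (1 - modularLambda τ) = π / 2 * (-I * τ * theta3 τ ^ 2) := by
  rw [← modularLambda_neg_one_div h.1, ellipticKsqrt_modularLambda (neg_one_div_mem_fundDomain h),
    theta3_sq_neg_one_div h.1]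

/-- The factor θ₃² cancels between K at 1 - λ and K at λ. In particular λ is injective on the
domain, with explicit holomorphic inverse. -/
theorem periodRatio_modularLambda {τ : ℂ} (h : τ ∈ fundDomain) :
    periodRatio (modularLambda τ) = τ := by
  have := theta3_ne_zero h.1
  have hpi : (π : ℂ) ≠ 0 := by exact_mod_cast Real.pi_ne_zero
  rw [periodRatio, ellipticKsqrt_modularLambda h, ellipticKsqrt_one_sub_modularLambda h]
  field_simp
  simp

theorem differentiableAt_periodRatio {t : ℂ} (ht : t ∈ doublyCutPlane) :
    DifferentiableAt ℂ periodRatio t := by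
  refine DifferentiableAt.div (DifferentiableAt.const_mul ?_ _)
    (differentiableAt_ellipticKsqrt (mem_cutPlane_of_mem ht))
    (ellipticKsqrt_ne_zero (mem_cutPlane_of_mem ht))
  exact (differentiableAt_ellipticKsqrt (mem_cutPlane_of_mem (one_sub_mem_doublyCutPlane ht))).comp t
    ((differentiableAt_const _).sub differentiableAt_id)

end EpsteinRepn

/-! ### Lifting the segment from 0 to λ(τ) into the fundamental domain -/

namespace EpsteinRepn
open Complex hiding eta
open Filter Topology ModularForm EisensteinSeries
open scoped Real Nat
open Set

/-- The hypothesis says that -1/f has real part at most 1 in absolute value; since -1/f is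
unbounded, its imaginary part must tend to infinity. -/
theorem tendsto_neg_one_div_imTop {α : Type*} {l : Filter α} {f : α → ℂ}
    (hf : Tendsto f l (𝓝 0))
    (h : ∀ᶠ a in l, 0 < (f a).im ∧ |(f a).re| ≤ normSq (f a)) :
    Tendsto (fun a => -1 / f a) l imTop := by
  rw [imTop, tendsto_comap_iff]
  refine tendsto_atTop.mpr fun M => ?_
  have hN : Tendsto (fun a => normSq (f a)) l (𝓝 0) := by
    simpa [Function.comp_def] using (continuous_normSq.tendsto 0).comp hf
  have hM : 0 < (M ^ 2 + 1)⁻¹ := by positivity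
  filter_upwards [h, hN.eventually_lt_const hM] with a ⟨h1, h2⟩ h3
  have hn : 0 < normSq (f a) := normSq_pos.mpr (ne_zero_of_im_pos h1)
  simp only [Function.comp_apply]
  rw [neg_one_div_im, le_div_iff₀ hn]
  refine (le_abs_self _).trans (abs_le_of_sq_le_sq ?_ h1.le)
  have h4 : (M ^ 2 + 1) * normSq (f a) < 1 := by
    rw [inv_eq_one_div, lt_div_iff₀ (by positivity)] at h3
    linarith
  have h5 : (f a).re ^ 2 ≤ normSq (f a) ^ 2 := by
    rw [← sq_abs]
    gcongr
  have h6 : normSq (f a) = (f a).re ^ 2 + (f a).im ^ 2 := by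
    rw [normSq_apply]
    ring
  nlinarith

theorem modularLambda_comp_tendsto_zero {α : Type*} {l : Filter α} {f : α → ℂ}
    (hf : Tendsto f l (𝓝 0))
    (h : ∀ᶠ a in l, 0 < (f a).im ∧ |(f a).re| ≤ normSq (f a)) :
    Tendsto (fun a => 1 - modularLambda (f a)) l (𝓝 0) := by
  refine (tendsto_modularLambda.comp (tendsto_neg_one_div_imTop hf h)).congr' ?_
  filter_upwards [h] with a ha
  exact modularLambda_neg_one_div ha.1

/-- A limit of points of the domain on the real line can only be 0, 1 or -1. Near 0, λ tends to 1,
which `ht1` forbids. Near ±1, λ/(λ - 1) tends to 1, so 1/(λ - 1) tends to 0, against the finite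
limit of λ. -/
theorem im_pos_of_tendsto {F : Filter ℂ} [F.NeBot] {v t : ℂ} (hF : F ≤ 𝓝 v)
    (hD : ∀ᶠ τ in F, τ ∈ fundDomain) (ht : Tendsto modularLambda F (𝓝 t)) (ht1 : t ≠ 1) :
    0 < v.im := by
  have hid : Tendsto (fun τ : ℂ => τ) F (𝓝 v) := hF
  have him := (continuous_im.tendsto v).comp hid
  have hre := (continuous_re.tendsto v).comp hid
  have hns := (continuous_normSq.tendsto v).comp hid
  have h1 : 0 ≤ v.im := ge_of_tendsto him (hD.mono fun τ h => h.1.le)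
  have h2 : |v.re| ≤ 1 := le_of_tendsto hre.abs (hD.mono fun τ h => h.2.1.le)
  have h3 : |v.re| ≤ normSq v := le_of_tendsto_of_tendsto hre.abs hns (hD.mono fun τ h => h.2.2.le)
  refine h1.lt_of_ne fun h0 => ?_
  have hv : v = v.re := by
    apply Complex.ext <;> simp [← h0]
  have h4 : |v.re| ≤ |v.re| ^ 2 := by
    rw [sq_abs]
    rwa [normSq_apply, ← h0, mul_zero, add_zero, ← sq] at h3
  have hcusp (e : ℂ → ℂ) (he : ∀ᶠ τ in F, 0 < (e τ).im ∧ |(e τ).re| ≤ normSq (e τ))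
      (hl : ∀ᶠ τ in F, modularLambda (e τ) = modularLambda τ / (modularLambda τ - 1))
      (h0 : Tendsto e F (𝓝 0)) : False := by
    have h5 := (modularLambda_comp_tendsto_zero h0 he).mul (ht.const_sub 1)
    have h6 : Tendsto (fun _ : ℂ => (1 : ℂ)) F (𝓝 (0 * (1 - t))) := by
      refine h5.congr' ?_
      filter_upwards [hl, hD] with τ h hτ
      rw [h]
      have := one_sub_modularLambda_ne_zero hτ.1
      have : modularLambda τ - 1 ≠ 0 := fun h => this (by linear_combination -h)
      field_simp
      ring
    simpa using tendsto_nhds_unique h6 tendsto_const_nhds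
  have h5 : v.re = 0 ∨ v.re = 1 ∨ v.re = -1 := by
    rcases (abs_nonneg v.re).eq_or_lt with h | h
    · exact Or.inl (abs_eq_zero.mp h.symm)
    · right
      have : |v.re| = 1 := le_antisymm h2 (by nlinarith)
      exact (abs_eq zero_le_one).mp this
  rcases h5 with h5 | h5 | h5
  · rw [hv, h5, ofReal_zero] at hid
    have h6 := modularLambda_comp_tendsto_zero hid (hD.mono fun τ h => ⟨h.1, h.2.2.le⟩)
    have h7 := tendsto_nhds_unique h6 (ht.const_sub 1)
    exact ht1 (by linear_combination h7)
  · refine hcusp (fun τ => τ - 1) ?_ (hD.mono fun τ h => modularLambda_sub_one h.1) ?_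
    · filter_upwards [hD, hre.eventually_const_lt (show 0 < v.re by linarith)] with τ hτ hτ0
      obtain ⟨k1, k2, k3⟩ := hτ
      simp only [Function.comp_apply] at hτ0
      rw [abs_of_pos hτ0] at k2 k3
      refine ⟨by simpa using k1, ?_⟩
      rw [normSq_apply] at k3 ⊢
      simp only [sub_re, one_re, sub_im, one_im]
      rw [abs_of_neg (by linarith)]
      nlinarith
    · rw [hv, h5] at hid
      simpa using hid.sub_const 1
  · refine hcusp (fun τ => τ + 1) ?_ (hD.mono fun τ h => modularLambda_add_one h.1) ?_
    · filter_upwards [hD, hre.eventually_lt_const (show v.re < 0 by linarith)] with τ hτ hτ0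
      obtain ⟨k1, k2, k3⟩ := hτ
      simp only [Function.comp_apply] at hτ0
      rw [abs_of_neg hτ0] at k2 k3
      refine ⟨by simpa using k1, ?_⟩
      rw [normSq_apply] at k3 ⊢
      simp only [add_re, one_re, add_im, one_im]
      rw [abs_of_pos (by linarith)]
      nlinarith
    · rw [hv, h5] at hid
      simpa using hid.add_const 1

theorem modularLambda_of_abs_re_eq_one {τ : ℂ} (hτ : 0 < τ.im) (h : |τ.re| = 1) :
    ∃ r : ℝ, r < 0 ∧ modularLambda τ = r := by
  obtain ⟨r, hr0, hr1, hr⟩ := modularLambda_mul_I hτ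
  have hI : 0 < (τ.im * I : ℂ).im := by simpa using hτ
  refine ⟨r / (r - 1), div_neg_of_pos_of_neg hr0 (by linarith), ?_⟩
  rcases (abs_eq zero_le_one).mp h with h | h
  · have e : τ = τ.im * I + 1 := by
      conv_lhs => rw [← re_add_im τ, h]
      push_cast
      ring
    rw [e, modularLambda_add_one hI, hr]
    push_cast
    rfl
  · have e : τ = τ.im * I - 1 := by
      conv_lhs => rw [← re_add_im τ, h]
      push_cast
      ring
    rw [e, modularLambda_sub_one hI, hr]
    push_cast
    rfl

/-- λ maps the vertical sides into (-∞, 0) and, by inversion, the two half circles into (1, ∞), so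
no boundary point has its value in the doubly cut plane. -/
theorem mem_fundDomain_of_modularLambda_mem {τ : ℂ} (hτ : 0 < τ.im) (h1 : |τ.re| ≤ 1)
    (h2 : |τ.re| ≤ normSq τ) (h : modularLambda τ ∈ doublyCutPlane) : τ ∈ fundDomain := by
  have hn : 0 < normSq τ := normSq_pos.mpr (ne_zero_of_im_pos hτ)
  refine ⟨hτ, h1.lt_of_ne fun h3 => ?_, h2.lt_of_ne fun h3 => ?_⟩
  · obtain ⟨r, hr, e⟩ := modularLambda_of_abs_re_eq_one hτ h3
    rw [e] at h
    rcases h with h | h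
    · simp at h
    · simp at h
      linarith
  · obtain ⟨r, hr, e⟩ := modularLambda_of_abs_re_eq_one (neg_one_div_im_pos hτ) (by
      rw [neg_one_div_re, abs_div, abs_neg, abs_of_pos hn, h3, div_self hn.ne'])
    rw [modularLambda_neg_one_div hτ] at e
    have e' : modularLambda τ = ((1 - r : ℝ) : ℂ) := by
      push_cast
      linear_combination -e
    rw [e'] at h
    rcases h with h | h
    · simp at h
    · simp at h
      linarith

theorem modularLambda_periodRatio {t : ℂ} (h : t ∈ modularLambda '' fundDomain) :
    periodRatio t ∈ fundDomain ∧ modularLambda (periodRatio t) = t := by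
  obtain ⟨τ, hτ, rfl⟩ := h
  rw [periodRatio_modularLambda hτ]
  exact ⟨hτ, rfl⟩

/-- The inverse `periodRatio` is continuous at t, so preimages of nearby points converge to
`periodRatio t`. By the two preceding exclusions this limit is neither on the real line nor on a
side of the domain. -/
theorem mem_image_of_mem_closure {t : ℂ} (ht : t ∈ doublyCutPlane)
    (hcl : t ∈ closure (modularLambda '' fundDomain)) : t ∈ modularLambda '' fundDomain := by
  have hne : (𝓝[modularLambda '' fundDomain] t).NeBot := mem_closure_iff_nhdsWithin_neBot.mp hcl
  have hc : Tendsto periodRatio (𝓝[modularLambda '' fundDomain] t) (𝓝 (periodRatio t)) :=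
    (differentiableAt_periodRatio ht).continuousAt.tendsto.mono_left nhdsWithin_le_nhds
  have hD : ∀ᶠ w in 𝓝[modularLambda '' fundDomain] t, periodRatio w ∈ fundDomain ∧
      modularLambda (periodRatio w) = w := by
    filter_upwards [self_mem_nhdsWithin] with w hw
    exact modularLambda_periodRatio hw
  have hid : Tendsto (fun w : ℂ => w) (𝓝[modularLambda '' fundDomain] t) (𝓝 t) :=
    nhdsWithin_le_nhds
  have hl : Tendsto modularLambda (map periodRatio (𝓝[modularLambda '' fundDomain] t)) (𝓝 t) := by
    rw [tendsto_map'_iff]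
    exact hid.congr' (hD.mono fun w hw => hw.2.symm)
  have ht1 : t ≠ 1 := by
    rintro rfl
    rcases ht with h | h <;> simp at h
  have him := im_pos_of_tendsto hc (hD.mono fun w hw => hw.1) hl ht1
  have hval : modularLambda (periodRatio t) = t :=
    tendsto_nhds_unique ((differentiableAt_modularLambda him).continuousAt.tendsto.mono_left hc) hl
  refine ⟨periodRatio t, ?_, hval⟩
  have hre := (continuous_re.tendsto _).comp hc
  have hns := (continuous_normSq.tendsto _).comp hc
  refine mem_fundDomain_of_modularLambda_mem him
    (le_of_tendsto hre.abs (hD.mono fun w h => h.1.2.1.le))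
    (le_of_tendsto_of_tendsto hre.abs hns (hD.mono fun w h => h.1.2.2.le)) (by rwa [hval])

/-- Otherwise some preimages stay in a compact rectangle while λ tends to 0. They have a cluster
point, which lies in the upper half-plane and is a zero of λ; there is none. -/
theorem tendsto_im_periodRatio :
    Tendsto (fun w => (periodRatio w).im) (𝓝[modularLambda '' fundDomain] 0) atTop := by
  refine tendsto_atTop.mpr fun M => ?_
  by_contra hM
  rw [not_eventually] at hM
  set N := 𝓝[modularLambda '' fundDomain] (0 : ℂ) ⊓ 𝓟 {w | ¬ M ≤ (periodRatio w).im} with hN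
  have hne : N.NeBot := frequently_iff_neBot.mp hM
  have hmem : ∀ᶠ w in N, w ∈ modularLambda '' fundDomain :=
    (eventually_mem_nhdsWithin (a := (0 : ℂ)) (s := modularLambda '' fundDomain)).filter_mono
      inf_le_left
  have hle : ∀ᶠ w in N, ¬ M ≤ (periodRatio w).im :=
    (eventually_principal.mpr fun w hw => hw).filter_mono inf_le_right
  have hcompact : IsCompact (Icc (-1 : ℝ) 1 ×ℂ Icc 0 M) := isCompact_Icc.reProdIm isCompact_Icc
  obtain ⟨v, -, hv⟩ := hcompact (f := map periodRatio N) (by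
    refine le_principal_iff.mpr (mem_map.mpr ?_)
    filter_upwards [hmem, hle] with w hw hw2
    have h := (modularLambda_periodRatio hw).1
    exact ⟨⟨(abs_le.mp h.2.1.le).1, (abs_le.mp h.2.1.le).2⟩, h.1.le, (not_le.mp hw2).le⟩)
  have hne2 : (𝓝 v ⊓ map periodRatio N).NeBot := hv
  have hD : ∀ᶠ τ in map periodRatio N, τ ∈ fundDomain :=
    hmem.mono fun w hw => (modularLambda_periodRatio hw).1
  have hl : Tendsto modularLambda (map periodRatio N) (𝓝 0) := by
    rw [tendsto_map'_iff]
    have hid : Tendsto (fun w : ℂ => w) N (𝓝 0) := inf_le_left.trans nhdsWithin_le_nhds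
    exact hid.congr' (hmem.mono fun w hw => (modularLambda_periodRatio hw).2.symm)
  have him := im_pos_of_tendsto (F := 𝓝 v ⊓ map periodRatio N) inf_le_left
    (hD.filter_mono inf_le_right) (hl.mono_left inf_le_right) zero_ne_one
  have hval := tendsto_nhds_unique ((differentiableAt_modularLambda him).continuousAt.tendsto.mono_left
    (inf_le_left (b := map periodRatio N))) (hl.mono_left inf_le_right)
  exact modularLambda_ne_zero him hval

theorem deriv_modularLambda_ne_zero {τ : ℂ} (hτ : 0 < τ.im) :
    π * I * modularLambda τ * (1 - modularLambda τ) * theta3 τ ^ 4 ≠ 0 := by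
  have hpi : (π : ℂ) ≠ 0 := by exact_mod_cast Real.pi_ne_zero
  simp [hpi, modularLambda_ne_zero hτ, one_sub_modularLambda_ne_zero hτ, theta3_ne_zero hτ]

theorem isOpen_image_fundDomain : IsOpen (modularLambda '' fundDomain) := by
  rw [isOpen_iff_mem_nhds]
  rintro _ ⟨τ, hτ, rfl⟩
  have hd : DifferentiableOn ℂ modularLambda {z | 0 < z.im} := fun z hz =>
    (differentiableAt_modularLambda hz).differentiableWithinAt
  have ha : AnalyticAt ℂ modularLambda τ := hd.analyticAt (isOpen_im_pos.mem_nhds hτ.1)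
  have hs := ha.hasStrictDerivAt
  rw [(hasDerivAt_modularLambda hτ.1).deriv] at hs
  rw [← hs.map_nhds_eq (deriv_modularLambda_ne_zero hτ.1)]
  exact image_mem_map (isOpen_fundDomain.mem_nhds hτ)

/-- The half-open segment is connected, lies in the doubly cut plane and meets the image of the
domain at u = 1; the image is open and relatively closed there. -/
theorem segment_mem_image {τ : ℂ} (hτ : τ ∈ fundDomain) {u : ℝ} (hu : u ∈ Ioc (0 : ℝ) 1) :
    (u * modularLambda τ : ℂ) ∈ modularLambda '' fundDomain := by
  have hconn : IsPreconnected ((fun u : ℝ => (u * modularLambda τ : ℂ)) '' Ioc (0 : ℝ) 1) :=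
    isPreconnected_Ioc.image _ (by fun_prop)
  have hΩ : ∀ t ∈ (fun u : ℝ => (u * modularLambda τ : ℂ)) '' Ioc (0 : ℝ) 1,
      t ∈ doublyCutPlane := by
    rintro _ ⟨u, hu, rfl⟩
    have hu0 : 0 < u := hu.1
    rcases modularLambda_mem hτ with h | h
    · left
      simp only [im_ofReal_mul]
      exact mul_ne_zero hu0.ne' h
    · right
      simp only [re_ofReal_mul]
      exact ⟨mul_pos hu0 h.1, by nlinarith [hu.2]⟩
  refine hconn.subset_of_closure_inter_subset isOpen_image_fundDomain
    ⟨modularLambda τ, ⟨1, by simp, by simp⟩, mem_image_of_mem _ hτ⟩ ?_ ⟨u, hu, rfl⟩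
  rintro t ⟨h1, h2⟩
  exact mem_image_of_mem_closure (hΩ t h2) h1

/-- The preimage in the fundamental domain of the segment from `0` to `λ(τ)`. -/
noncomputable def segPath (τ : ℂ) (u : ℝ) : ℂ := periodRatio (u * modularLambda τ)

theorem segPath_one {τ : ℂ} (hτ : τ ∈ fundDomain) : segPath τ 1 = τ := by
  rw [segPath, ofReal_one, one_mul, periodRatio_modularLambda hτ]

theorem segPath_mem {τ : ℂ} (hτ : τ ∈ fundDomain) {u : ℝ} (hu : u ∈ Ioc (0 : ℝ) 1) :
    segPath τ u ∈ fundDomain :=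
  (modularLambda_periodRatio (segment_mem_image hτ hu)).1

theorem modularLambda_segPath {τ : ℂ} (hτ : τ ∈ fundDomain) {u : ℝ} (hu : u ∈ Ioc (0 : ℝ) 1) :
    modularLambda (segPath τ u) = u * modularLambda τ :=
  (modularLambda_periodRatio (segment_mem_image hτ hu)).2

theorem tendsto_segPath {τ : ℂ} (hτ : τ ∈ fundDomain) :
    Tendsto (segPath τ) (𝓝[>] 0) imTop := by
  rw [imTop, tendsto_comap_iff]
  refine tendsto_im_periodRatio.comp (f := fun u : ℝ => (u * modularLambda τ : ℂ)) ?_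
  refine tendsto_nhdsWithin_iff.mpr ⟨?_, ?_⟩
  · have : ContinuousAt (fun u : ℝ => (u * modularLambda τ : ℂ)) 0 := by fun_prop
    have := this.tendsto
    simp only [ofReal_zero, zero_mul] at this
    exact this.mono_left nhdsWithin_le_nhds
  · filter_upwards [Ioc_mem_nhdsGT zero_lt_one] with u hu
    exact segment_mem_image hτ hu

theorem hasDerivAt_segPath {τ : ℂ} (hτ : τ ∈ fundDomain) {u : ℝ} (hu : u ∈ Ioc (0 : ℝ) 1) :
    ∃ d : ℂ, HasDerivAt (segPath τ) d u ∧
      π * I * (u * modularLambda τ) * (1 - u * modularLambda τ) * theta3 (segPath τ u) ^ 4 * d =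
        modularLambda τ := by
  have hmem := segment_mem_image hτ hu
  have hΩ : (u * modularLambda τ : ℂ) ∈ doublyCutPlane := by
    rw [← modularLambda_segPath hτ hu]
    exact modularLambda_mem (segPath_mem hτ hu)
  have h1 := (differentiableAt_periodRatio hΩ).hasDerivAt
  have h2 := hasDerivAt_modularLambda (segPath_mem hτ hu).1
  rw [modularLambda_segPath hτ hu] at h2
  have h3 := HasDerivAt.comp (u * modularLambda τ : ℂ) h2 h1
  have h4 : (modularLambda ∘ periodRatio) =ᶠ[𝓝 (u * modularLambda τ : ℂ)] id := by
    filter_upwards [isOpen_image_fundDomain.mem_nhds hmem] with w hw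
    exact (modularLambda_periodRatio hw).2
  have h5 := (h3.congr_of_eventuallyEq h4.symm).unique (hasDerivAt_id _)
  have h6 : HasDerivAt (fun u : ℝ => (u * modularLambda τ : ℂ)) (1 * modularLambda τ) u :=
    (hasDerivAt_id u).ofReal_comp.mul_const _
  refine ⟨_, h1.comp u h6, ?_⟩
  rw [one_mul, ← mul_assoc, h5, one_mul]

theorem continuousOn_segPath {τ : ℂ} (hτ : τ ∈ fundDomain) :
    ContinuousOn (segPath τ) (Ioc (0 : ℝ) 1) := fun u hu => by
  obtain ⟨d, hd, -⟩ := hasDerivAt_segPath hτ hu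
  exact hd.continuousAt.continuousWithinAt

/-- The imaginary part of the path grows at most logarithmically. -/
theorem exp_im_segPath_le {τ : ℂ} (hτ : τ ∈ fundDomain) :
    ∃ C : ℝ, ∀ u ∈ Ioc (0 : ℝ) 1, Real.exp (π * (segPath τ u).im) ≤ C / u := by
  -- λ divided by the nome tends to 16, so any constant above 16 bounds it for small u; on the
  -- remaining compact interval continuity suffices.
  have h1 := ((tendsto_modularLambda_div_nome.comp (tendsto_segPath hτ)).norm).eventually_lt_const
    (show ‖(16 : ℂ)‖ < 17 by norm_num)
  obtain ⟨δ, hδ0, hδ⟩ := mem_nhdsGT_iff_exists_Ioc_subset.mp h1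
  have hδ0 : 0 < δ := hδ0
  obtain ⟨C, hC⟩ := (isCompact_Icc (a := δ) (b := 1)).exists_bound_of_continuousOn
    (f := fun u => Real.exp (π * (segPath τ u).im)) (by
      refine Real.continuous_exp.comp_continuousOn (continuousOn_const.mul
        (continuous_im.comp_continuousOn ((continuousOn_segPath hτ).mono fun u hu => ?_)))
      exact ⟨hδ0.trans_le hu.1, hu.2⟩)
  have hl : 0 < ‖modularLambda τ‖ := norm_pos_iff.mpr (modularLambda_ne_zero hτ.1)
  refine ⟨max C (17 / ‖modularLambda τ‖), fun u hu => ?_⟩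
  rw [le_div_iff₀ hu.1]
  rcases le_or_gt u δ with h | h
  · have h2 : ‖modularLambda (segPath τ u) / nome (segPath τ u)‖ < 17 := hδ ⟨hu.1, h⟩
    rw [modularLambda_segPath hτ hu, norm_div, norm_nome, norm_mul, norm_real, Real.norm_eq_abs,
      abs_of_pos hu.1, neg_mul, Real.exp_neg, div_inv_eq_mul] at h2
    refine le_max_of_le_right ((le_div_iff₀ hl).mpr ?_)
    nlinarith
  · have h2 := hC u ⟨h.le, hu.2⟩
    rw [Real.norm_eq_abs, abs_of_pos (Real.exp_pos _)] at h2
    refine le_max_of_le_left (le_trans ?_ h2)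
    exact mul_le_of_le_one_right (Real.exp_pos _).le hu.2

end EpsteinRepn

/-! ### Fourier expansion of sums of inverse powers of |w + d|² -/

namespace EpsteinRepn
open Complex hiding eta
open Filter Topology ModularForm EisensteinSeries
open scoped Real Nat
open Set

/-- The coefficients `(2 m - j)! m! / (m - j)!`. -/
def lipCoeff (m j : ℕ) : ℕ := (2 * m - j)! * m.descFactorial j

/-- The partial fraction expansion of (vw)^(-(m + 1)) when v and w are translated together with v -
w fixed, here verified for the five exponents needed. With w the conjugate of v it decomposes
|v|^(-2(m + 1)). -/
theorem lipCoeff_identity {m : ℕ} (hm : m ∈ ({1, 2, 3, 4, 6} : Finset ℕ)) {v w : ℂ} (hv : v ≠ 0)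
    (hw : w ≠ 0) :
    ∑ j ∈ Finset.range (m + 1), (lipCoeff m j : ℂ) *
      ((v - w) ^ j * (v ^ (j + 1))⁻¹ - (w - v) ^ j * (w ^ (j + 1))⁻¹) =
      (-1) ^ (m + 1) * (m ! : ℂ) ^ 2 * (v - w) ^ (2 * m + 1) / (v * w) ^ (m + 1) := by
  simp only [Finset.mem_insert, Finset.mem_singleton] at hm
  rcases hm with rfl | rfl | rfl | rfl | rfl
  all_goals
    norm_num [Finset.sum_range_succ, lipCoeff, Nat.factorial, Nat.descFactorial]
    field_simp
    ring

theorem im_lipCoeff_sum {m : ℕ} (hm : m ∈ ({1, 2, 3, 4, 6} : Finset ℕ)) {v : ℂ} (hv : 0 < v.im) :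
    ∑ j ∈ Finset.range (m + 1),
      ((lipCoeff m j : ℂ) * (2 * v.im * I) ^ j * (v ^ (j + 1))⁻¹).im =
      -(4 ^ m * (m ! : ℝ) ^ 2 * v.im ^ (2 * m + 1) * (normSq v ^ (m + 1))⁻¹) := by
  have hv0 := ne_zero_of_im_pos hv
  have hw0 : (starRingEnd ℂ) v ≠ 0 := by simpa using hv0
  have h := lipCoeff_identity hm hv0 hw0
  have hsub : v - (starRingEnd ℂ) v = 2 * v.im * I := by
    rw [sub_conj]
    push_cast
    ring
  have hterm (j : ℕ) : (lipCoeff m j : ℂ) * ((v - (starRingEnd ℂ) v) ^ j * (v ^ (j + 1))⁻¹ -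
      ((starRingEnd ℂ) v - v) ^ j * ((starRingEnd ℂ) v ^ (j + 1))⁻¹) =
      (2 * ((lipCoeff m j : ℂ) * (2 * v.im * I) ^ j * (v ^ (j + 1))⁻¹).im : ℝ) * I := by
    rw [← sub_conj]
    simp only [map_mul, map_pow, map_inv₀, conj_ofReal, conj_I, map_ofNat, map_natCast]
    rw [hsub, ← neg_sub v, hsub]
    ring
  simp only [hterm] at h
  rw [← Finset.sum_mul, ← ofReal_sum, ← Finset.mul_sum, hsub, mul_conj] at h
  have hI : (2 * (v.im : ℂ) * I) ^ (2 * m + 1) = 2 * 4 ^ m * v.im ^ (2 * m + 1) * ((-1) ^ m * I) := by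
    rw [mul_pow, mul_pow, pow_succ I, pow_mul I, I_sq, pow_succ (2 : ℂ), pow_mul (2 : ℂ),
      show (2 : ℂ) ^ 2 = 4 by norm_num]
    ring
  rw [hI] at h
  have hs : ((-1 : ℂ) ^ m) * (-1) ^ m = 1 := by rw [← mul_pow]; simp
  have h2 : ((2 * ∑ j ∈ Finset.range (m + 1),
      ((lipCoeff m j : ℂ) * (2 * v.im * I) ^ j * (v ^ (j + 1))⁻¹).im : ℝ) : ℂ) =
      ((2 * -(4 ^ m * (m ! : ℝ) ^ 2 * v.im ^ (2 * m + 1) * (normSq v ^ (m + 1))⁻¹) : ℝ) : ℂ) := by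
    apply mul_right_cancel₀ I_ne_zero
    rw [h]
    push_cast
    linear_combination (-(2 * 4 ^ m * (m ! : ℂ) ^ 2 * v.im ^ (2 * m + 1) *
      ((normSq v : ℂ) ^ (m + 1))⁻¹ * I)) * hs
  have h3 := ofReal_injective h2
  linarith

theorem summable_inv_add_int_pow (w : ℂ) {k : ℕ} (hk : 2 ≤ k) :
    Summable fun d : ℤ => ((w + d) ^ k)⁻¹ := by
  have h := linear_right_summable w 1 (k := k) (by exact_mod_cast hk)
  simpa using h

theorem im_add_int (w : ℂ) (d : ℤ) : (w + d).im = w.im := by simp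

/-- The Lipschitz sum `∑ (w + d) ^ (-(j + 1))` in terms of its Fourier series, with the
conventional constant for `j = 0`. -/
noncomputable def lipSum (j : ℕ) (w : ℂ) : ℂ := (-2 * π * I) ^ (j + 1) / j ! * expSum j w

theorem hasSum_lipSum {j : ℕ} (hj : 1 ≤ j) {w : ℂ} (hw : 0 < w.im) :
    HasSum (fun d : ℤ => ((w + d) ^ (j + 1))⁻¹) (lipSum j w) := by
  have h := (summable_inv_add_int_pow w (k := j + 1) (by omega)).hasSum
  have e := tsum_inv_add_int_pow hj hw
  simp only [one_div] at e
  rwa [e] at h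

/-- For exponent 1 the Lipschitz series does not converge absolutely, but its imaginary parts do.
Pairing d with -d gives π cot(πw), which equals `lipSum 0 w` minus πi; hence the extra -π. -/
theorem hasSum_im_inv_add_int {w : ℂ} (hw : 0 < w.im) :
    HasSum (fun d : ℤ => ((w + d)⁻¹).im) ((lipSum 0 w).im - π) := by
  have hs : Summable fun d : ℤ => ((w + d)⁻¹).im := by
    refine Summable.of_norm (((summable_inv_add_int_pow w le_rfl).norm.mul_left w.im).congr
      fun d => ?_)
    rw [inv_im, im_add_int, norm_inv, norm_pow, Real.norm_eq_abs, abs_div, abs_neg, abs_of_pos hw,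
      abs_of_nonneg (normSq_nonneg _), normSq_eq_norm_sq]
    rfl
  have hz := UpperHalfPlane.coe_mem_integerComplement ⟨w, hw⟩
  have hcot := cot_series_rep' hz
  have hcs := (summable_cotTerm hz).hasSum
  have h1 := hs.hasSum.nat_add_neg
  have h2 : HasSum (fun n : ℕ => ((w + ((n + 1 : ℕ) : ℤ))⁻¹).im +
      ((w + (-((n + 1 : ℕ) : ℤ) : ℤ))⁻¹).im) ((π * cot (π * w) - 1 / w).im) := by
    have h3 : HasSum (fun n : ℕ => 1 / (w - (n + 1)) + 1 / (w + (n + 1)))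
        (π * cot (π * w) - 1 / w) := by
      have h4 : ∑' n : ℕ, cotTerm w n = π * cot (π * w) - 1 / w := hcot.symm
      rw [← h4]
      exact hcs
    refine (hasSum_im h3).congr_fun fun n => ?_
    rw [add_im, add_comm, one_div, one_div]
    push_cast
    rw [sub_eq_add_neg]
  have h4 := (hasSum_nat_add_iff' 1).mpr h1
  simp only [Finset.sum_range_one, Nat.cast_zero, Int.cast_zero, neg_zero, add_zero] at h4
  have h5 := h4.unique h2
  have h6 := pi_mul_cot_pi_q_exp ⟨w, hw⟩
  have h7 : (lipSum 0 w).im = (π * cot (π * w)).im + π := by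
    have hn := UpperHalfPlane.norm_exp_two_pi_I_lt_one ⟨w, hw⟩
    have e : expSum 0 w = ∑' n : ℕ, cexp (2 * π * I * w) ^ n - 1 := by
      rw [(summable_geometric_of_norm_lt_one hn).tsum_eq_zero_add]
      simp [expSum]
    have e2 : lipSum 0 w = π * cot (π * w) + π * I := by
      rw [lipSum, e]
      refine Eq.trans ?_ (congrArg (· + (π * I : ℂ)) h6.symm)
      simp
      ring
    rw [e2]
    simp
  have h8 : ∑' d : ℤ, ((w + d)⁻¹).im = (lipSum 0 w).im - π := by
    rw [h7]
    rw [sub_im, one_div] at h5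
    linarith
  rw [← h8]
  exact hs.hasSum

/-- Each partial fraction is summed separately. The correction -π of the simple pole, weighted by
`lipCoeff m 0`, is the constant Fourier coefficient; it becomes the zeta term of the theorem. -/
theorem hasSum_lipschitz {m : ℕ} (hm : m ∈ ({1, 2, 3, 4, 6} : Finset ℕ)) {w : ℂ}
    (hw : 0 < w.im) :
    HasSum (fun d : ℤ => -(4 ^ m * (m ! : ℝ) ^ 2 * w.im ^ (2 * m + 1) *
      (normSq (w + d) ^ (m + 1))⁻¹))
      ((∑ j ∈ Finset.range (m + 1), (lipCoeff m j : ℂ) * (2 * w.im * I) ^ j * lipSum j w).im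
        - (2 * m)! * π) := by
  have h (j : ℕ) (hj : j ∈ Finset.range (m + 1)) :
      HasSum (fun d : ℤ => ((lipCoeff m j : ℂ) * (2 * w.im * I) ^ j * ((w + d) ^ (j + 1))⁻¹).im)
        (((lipCoeff m j : ℂ) * (2 * w.im * I) ^ j * lipSum j w).im -
          if j = 0 then (2 * m)! * π else 0) := by
    rcases Nat.eq_zero_or_pos j with rfl | hj
    · have h1 := (hasSum_im_inv_add_int hw).mul_left ((lipCoeff m 0 : ℕ) : ℝ)
      have h2 : lipCoeff m 0 = (2 * m)! := by simp [lipCoeff]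
      rw [if_pos rfl]
      convert! h1 using 1
      · ext d
        rw [pow_zero, mul_one, zero_add, pow_one, ← ofReal_natCast, im_ofReal_mul]
      · rw [pow_zero, mul_one, ← ofReal_natCast, im_ofReal_mul, h2]
        ring
    · rw [if_neg hj.ne', sub_zero]
      exact hasSum_im ((hasSum_lipSum hj hw).mul_left _)
  have h2 := hasSum_sum h
  rw [Finset.sum_sub_distrib, Finset.sum_ite_eq' (Finset.range (m + 1)) 0,
    if_pos (by simp), ← im_sum] at h2
  refine h2.congr_fun fun d => ?_
  have h3 := im_lipCoeff_sum hm (v := w + d) (by rwa [im_add_int])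
  rw [im_add_int] at h3
  exact h3.symm

end EpsteinRepn

/-! ### The Eichler integral and its value at τ -/

namespace EpsteinRepn
open Complex hiding eta
open Filter Topology ModularForm EisensteinSeries
open scoped Real Nat
open Set

/-- The iterated primitives of the `q`-expansion `qs (2 m + 1) 0`. -/
noncomputable def eichF (m i : ℕ) (v : ℂ) : ℂ := ((π * I : ℂ) ^ i)⁻¹ * qs (2 * m + 1 - i) i v

theorem pi_mul_I_ne_zero : (π * I : ℂ) ≠ 0 :=
  mul_ne_zero (by exact_mod_cast Real.pi_ne_zero) I_ne_zero

theorem hasDerivAt_eichF {m i : ℕ} (hi : i ≤ 2 * m) {v : ℂ} (hv : 0 < v.im) :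
    HasDerivAt (eichF m (i + 1)) (eichF m i v) v := by
  have h := (hasDerivAt_qs (2 * m + 1 - (i + 1)) i hv).const_mul ((π * I : ℂ) ^ (i + 1))⁻¹
  refine h.congr_deriv ?_
  rw [eichF, show 2 * m + 1 - (i + 1) + 1 = 2 * m + 1 - i by omega]
  have := pi_mul_I_ne_zero
  rw [pow_succ]
  field_simp

open Polynomial in
/-- The polynomial `(X - τ) ^ m (X - τ̄) ^ m`. -/
noncomputable def eichPoly (m : ℕ) (τ : ℂ) : ℂ[X] :=
  (X - C τ) ^ m * (X - C ((starRingEnd ℂ) τ)) ^ m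

open Polynomial in
theorem natDegree_eichPoly_le (m : ℕ) (τ : ℂ) : (eichPoly m τ).natDegree ≤ 2 * m := by
  refine natDegree_mul_le.trans ?_
  rw [natDegree_pow, natDegree_pow, natDegree_X_sub_C, natDegree_X_sub_C]
  omega

open Polynomial in
theorem eval_eichPoly (m : ℕ) (τ v : ℂ) :
    (eichPoly m τ).eval v = (v - τ) ^ m * (v - (starRingEnd ℂ) τ) ^ m := by
  simp [eichPoly]

open Polynomial in
theorem eval_iterate_derivative_eichPoly (m : ℕ) (τ : ℂ) (k : ℕ) :
    (derivative^[k] (eichPoly m τ)).eval τ =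
      k ! * (X ^ m * (X + C (2 * τ.im * I)) ^ m : ℂ[X]).coeff k := by
  have h1 : taylor τ (eichPoly m τ) = X ^ m * (X + C (2 * τ.im * I)) ^ m := by
    have e : τ - (starRingEnd ℂ) τ = 2 * τ.im * I := by
      rw [sub_conj]; push_cast; ring
    rw [← e, eichPoly, taylor_mul, taylor_pow, taylor_pow]
    congr 2
    · simp
    · simp only [map_sub, taylor_X, taylor_C]
      ring
  rw [← h1, taylor_coeff, ← factorial_smul_hasseDeriv]
  simp

open Polynomial in
/-- The Eichler integral of `qs (2 m + 1) 0` against the polynomial `eichPoly m τ`. -/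
noncomputable def eichPhi (m : ℕ) (τ v : ℂ) : ℂ :=
  ∑ k ∈ Finset.range (2 * m + 1),
    (-1) ^ k * eichF m (k + 1) v * (derivative^[k] (eichPoly m τ)).eval v

open Polynomial in
-- Repeated integration by parts: the derivative of the alternating sum telescopes, and its far end
-- vanishes because the polynomial has degree at most 2m.
theorem hasDerivAt_eichPhi (m : ℕ) (τ : ℂ) {v : ℂ} (hv : 0 < v.im) :
    HasDerivAt (eichPhi m τ) (eichF m 0 v * (eichPoly m τ).eval v) v := by
  have h : HasDerivAt (eichPhi m τ) (∑ k ∈ Finset.range (2 * m + 1),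
      ((-1) ^ k * eichF m k v * (derivative^[k] (eichPoly m τ)).eval v -
        (-1) ^ (k + 1) * eichF m (k + 1) v * (derivative^[k + 1] (eichPoly m τ)).eval v)) v := by
    refine HasDerivAt.fun_sum fun k hk => ?_
    have hk : k ≤ 2 * m := by
      have := Finset.mem_range.mp hk
      omega
    refine (((hasDerivAt_eichF hk hv).const_mul ((-1) ^ k)).mul
      ((derivative^[k] (eichPoly m τ)).hasDerivAt v)).congr_deriv ?_
    rw [Function.iterate_succ_apply']
    ring
  refine h.congr_deriv ?_
  rw [Finset.sum_range_sub' (fun k => (-1) ^ k * eichF m k v *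
    (derivative^[k] (eichPoly m τ)).eval v)]
  rw [iterate_derivative_eq_zero (Nat.lt_succ_of_le (natDegree_eichPoly_le m τ))]
  simp

/-- Inside the fundamental domain |v| ≤ 1 + Im v, so exponential decay in Im v beats the polynomial;
without the restriction the real part could grow. -/
theorem tendsto_nome_mul_eval (p : Polynomial ℂ) :
    Tendsto (fun v => nome v * p.eval v) (imTop ⊓ 𝓟 fundDomain) (𝓝 0) := by
  induction p using Polynomial.induction_on' with
  | add p q hp hq =>
    have h := hp.add hq
    rw [add_zero] at h
    refine h.congr fun v => ?_
    rw [Polynomial.eval_add, mul_add]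
  | monomial n a =>
    have h1 : Tendsto (fun y : ℝ => ‖a‖ * Real.exp 1 * ((1 + y) ^ n * Real.exp (-(1 + y)))) atTop
        (𝓝 0) := by
      have h := ((Real.tendsto_pow_mul_exp_neg_atTop_nhds_zero n).comp
        (tendsto_atTop_add_const_left atTop (1 : ℝ) tendsto_id)).const_mul (‖a‖ * Real.exp 1)
      rw [mul_zero] at h
      exact h
    have h2 : Tendsto Complex.im (imTop ⊓ 𝓟 fundDomain) atTop := tendsto_comap.mono_left inf_le_left
    refine squeeze_zero_norm' ?_ (h1.comp h2)
    have h3 : ∀ᶠ v in imTop ⊓ 𝓟 fundDomain, v ∈ fundDomain :=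
      (eventually_principal.mpr fun w hw => hw).filter_mono inf_le_right
    filter_upwards [h3] with v hv
    have h4 : ‖v‖ ≤ 1 + v.im := by
      refine (norm_le_abs_re_add_abs_im v).trans ?_
      rw [abs_of_pos hv.1]
      exact add_le_add_left hv.2.1.le _
    have h5 : Real.exp (-π * v.im) ≤ Real.exp 1 * Real.exp (-(1 + v.im)) := by
      rw [← Real.exp_add]
      apply Real.exp_le_exp.mpr
      have := hv.1
      nlinarith [Real.pi_gt_three]
    rw [Polynomial.eval_monomial, norm_mul, norm_mul, norm_pow, norm_nome, Function.comp_apply]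
    calc Real.exp (-π * v.im) * (‖a‖ * ‖v‖ ^ n)
        ≤ (Real.exp 1 * Real.exp (-(1 + v.im))) * (‖a‖ * (1 + v.im) ^ n) := by gcongr
      _ = _ := by ring

theorem tendsto_eichPhi (m : ℕ) (τ : ℂ) :
    Tendsto (eichPhi m τ) (imTop ⊓ 𝓟 fundDomain) (𝓝 0) := by
  have h : Tendsto (fun v => ∑ k ∈ Finset.range (2 * m + 1), (-1) ^ k * eichF m (k + 1) v *
      (Polynomial.derivative^[k] (eichPoly m τ)).eval v) (imTop ⊓ 𝓟 fundDomain)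
      (𝓝 (∑ k ∈ Finset.range (2 * m + 1), 0)) := by
    refine tendsto_finsetSum _ fun k _ => ?_
    have h1 := ((tendsto_qs_div_nome (2 * m + 1 - (k + 1)) (k + 1)).mono_left
      (inf_le_left (b := 𝓟 fundDomain))).const_mul ((-1) ^ k * ((π * I : ℂ) ^ (k + 1))⁻¹)
    have h2 := h1.mul (tendsto_nome_mul_eval (Polynomial.derivative^[k] (eichPoly m τ)))
    rw [mul_zero] at h2
    refine h2.congr fun v => ?_
    have := nome_ne_zero v
    rw [eichF]
    field_simp
  rw [Finset.sum_const_zero] at h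
  exact h

open Polynomial in
-- The polynomial vanishes to order m at v = τ, so only derivatives of order 2m - j with j ≤ m
-- contribute; the binomial coefficients come from its expansion X^m (X + 2i Im τ)^m about τ.
theorem eichPhi_self (m : ℕ) (τ : ℂ) :
    eichPhi m τ τ = ∑ j ∈ Finset.range (m + 1),
      (-1) ^ j * eichF m (2 * m + 1 - j) τ * ((2 * m - j)! * ((2 * τ.im * I) ^ j * m.choose j)) := by
  rw [eichPhi, ← Finset.sum_range_reflect]
  symm
  refine Finset.sum_subset_zero_on_sdiff (Finset.range_mono (by omega)) (fun j hj => ?_)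
    fun j hj => ?_
  · obtain ⟨h1, h2⟩ := Finset.mem_sdiff.mp hj
    have h1 := Finset.mem_range.mp h1
    have h2 : ¬ j < m + 1 := fun h => h2 (Finset.mem_range.mpr h)
    rw [eval_iterate_derivative_eichPoly, coeff_X_pow_mul', if_neg (by omega)]
    simp
  · have hj : j < m + 1 := Finset.mem_range.mp hj
    rw [eval_iterate_derivative_eichPoly, coeff_X_pow_mul', if_pos (by omega), coeff_X_add_C_pow,
      show 2 * m + 1 - 1 - j = 2 * m - j by omega, show 2 * m - j + 1 = 2 * m + 1 - j by omega,
      show 2 * m - j - m = m - j by omega, show m - (m - j) = j by omega,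
      Nat.choose_symm (by omega : j ≤ m)]
    congr 2
    have : (-1 : ℂ) ^ (2 * m - j) * (-1) ^ j = 1 := by
      rw [← pow_add, show 2 * m - j + j = 2 * m by omega, pow_mul]
      simp
    have h2 : (-1 : ℂ) ^ j * (-1) ^ j = 1 := by
      rw [← mul_pow]; simp
    linear_combination (-1 : ℂ) ^ j * (h2 - this)  + ((-1 : ℂ) ^ (2 * m - j) - (-1 : ℂ) ^ j) * h2

/-- The point `((2 a + 1) τ + 1) / 2`. -/
noncomputable def oddPoint (τ : ℂ) (a : ℕ) : ℂ := ((2 * a + 1) * τ + 1) / 2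

theorem im_oddPoint (τ : ℂ) (a : ℕ) : (oddPoint τ a).im = (2 * a + 1) * τ.im / 2 := by
  have : oddPoint τ a = (((2 * a + 1) / 2 : ℝ) : ℂ) * τ + ((1 / 2 : ℝ) : ℂ) := by
    rw [oddPoint]; push_cast; ring
  rw [this, add_im, im_ofReal_mul, ofReal_im]
  ring

/-- Row a reproduces the combination of Lipschitz sums in `hasSum_lipschitz`, since `oddPoint τ a`
has imaginary part (2a + 1) Im τ / 2. The common factor is -(1/2)(πi)^(-(2m + 2)), which is real. -/
theorem hasSum_eichPhi_self (m : ℕ) {τ : ℂ} (hτ : 0 < τ.im) :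
    HasSum (fun a : ℕ => (((-1) ^ m / (2 * π ^ (2 * m + 2)) * ((2 * (a : ℝ) + 1) ^ (2 * m + 1))⁻¹ : ℝ) : ℂ) *
      ∑ j ∈ Finset.range (m + 1), (lipCoeff m j : ℂ) * (2 * (oddPoint τ a).im * I) ^ j *
        lipSum j (oddPoint τ a)) (eichPhi m τ τ) := by
  rw [eichPhi_self]
  simp only [Finset.mul_sum]
  refine hasSum_sum fun j hj => ?_
  have hj : j ≤ m := by
    have := Finset.mem_range.mp hj
    omega
  have h := (hasSum_qs j (2 * m + 1 - j) hτ).mul_left ((-1) ^ j * ((π * I : ℂ) ^ (2 * m + 1 - j))⁻¹ *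
    ((2 * m - j)! * ((2 * τ.im * I) ^ j * m.choose j)))
  have e : (-1) ^ j * eichF m (2 * m + 1 - j) τ *
      ((2 * m - j)! * ((2 * τ.im * I) ^ j * m.choose j)) =
      (-1) ^ j * ((π * I : ℂ) ^ (2 * m + 1 - j))⁻¹ *
    ((2 * m - j)! * ((2 * τ.im * I) ^ j * m.choose j)) * qs j (2 * m + 1 - j) τ := by
    rw [eichF, show 2 * m + 1 - (2 * m + 1 - j) = j by omega]
    ring
  rw [e]
  refine h.congr_fun fun a => ?_
  obtain ⟨l, hl⟩ : ∃ l, 2 * m + 1 = l + j := ⟨2 * m + 1 - j, by omega⟩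
  have hk : (((-1) ^ m / (2 * π ^ (2 * m + 2)) * ((2 * (a : ℝ) + 1) ^ (2 * m + 1))⁻¹ : ℝ) : ℂ) =
      -(1 / 2) * ((π * I : ℂ) ^ (l + j) * (π * I))⁻¹ * ((2 * (a : ℂ) + 1) ^ (l + j))⁻¹ := by
    rw [← pow_succ, ← hl, mul_pow, show 2 * m + 1 + 1 = 2 * (m + 1) by ring, pow_mul I, I_sq]
    push_cast
    rw [show 2 * (m + 1) = 2 * m + 2 by ring, pow_succ (-1 : ℂ)]
    congr 1
    rcases neg_one_pow_eq_or ℂ m with h | h <;> rw [h] <;>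
      simp only [mul_one, mul_neg, neg_neg, inv_neg, one_mul, mul_inv, div_eq_mul_inv] <;> ring
  have hfac : (lipCoeff m j : ℂ) = (2 * m - j)! * (j ! * m.choose j) := by
    rw [lipCoeff, Nat.descFactorial_eq_factorial_mul_choose]
    push_cast
    rfl
  have h2a : (2 * (a : ℂ) + 1) ≠ 0 := by exact_mod_cast Nat.succ_ne_zero (2 * a)
  have hpi := pi_mul_I_ne_zero
  have hj0 : (j ! : ℂ) ≠ 0 := by exact_mod_cast j.factorial_ne_zero
  rw [hk, hfac, show 2 * m + 1 - j = l by omega, im_oddPoint, lipSum]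
  push_cast
  rw [show (2 * ((2 * (a : ℂ) + 1) * τ.im / 2) * I) = (2 * a + 1) * (τ.im * I) by ring,
    show (-2 * π * I : ℂ) = -1 * 2 * (π * I) by ring,
    show (2 * (τ.im : ℂ) * I) = 2 * (τ.im * I) by ring]
  simp only [mul_pow, pow_add, pow_one]
  rw [show ((2 * (a : ℂ) + 1) * τ + 1) / 2 = oddPoint τ a from rfl]
  simp only [← mul_pow (π : ℂ) I]
  generalize expSum j (oddPoint τ a) = E
  generalize (π * I : ℂ) = p at *
  field_simp

theorem hasSum_odd_inv_pow {k : ℕ} (hk : 2 ≤ k) :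
    HasSum (fun a : ℕ => ((2 * (a : ℝ) + 1) ^ k)⁻¹) ((1 - (2 ^ k)⁻¹) * ∑' n : ℕ, ((n : ℝ) ^ k)⁻¹) := by
  have hs : Summable fun n : ℕ => ((n : ℝ) ^ k)⁻¹ := Real.summable_nat_pow_inv.mpr (by omega)
  have he : Summable fun n : ℕ => (((2 * n : ℕ) : ℝ) ^ k)⁻¹ := by
    have h : Function.Injective fun n : ℕ => 2 * n := fun a b h => by
      simp only at h
      omega
    simpa only [Function.comp_def] using hs.comp_injective h
  have ho : Summable fun n : ℕ => (((2 * n + 1 : ℕ) : ℝ) ^ k)⁻¹ := by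
    have h : Function.Injective fun n : ℕ => 2 * n + 1 := fun a b h => by
      simp only at h
      omega
    simpa only [Function.comp_def] using hs.comp_injective h
  have h1 := tsum_even_add_odd (f := fun n : ℕ => ((n : ℝ) ^ k)⁻¹) he ho
  have h2 : ∑' n : ℕ, (((2 * n : ℕ) : ℝ) ^ k)⁻¹ = (2 ^ k)⁻¹ * ∑' n : ℕ, ((n : ℝ) ^ k)⁻¹ := by
    rw [← tsum_mul_left]
    refine tsum_congr fun n => ?_
    rw [Nat.cast_mul, mul_pow, mul_inv, Nat.cast_ofNat]
  have h4 := ho.hasSum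
  have h3 : ∑' n : ℕ, (((2 * n + 1 : ℕ) : ℝ) ^ k)⁻¹ = (1 - (2 ^ k)⁻¹) * ∑' n : ℕ, ((n : ℝ) ^ k)⁻¹ := by
    rw [sub_mul, one_mul, ← h2, ← h1, add_sub_cancel_left]
  rw [h3] at h4
  simpa only [Nat.cast_add, Nat.cast_mul, Nat.cast_ofNat, Nat.cast_one] using h4

theorem riemannZeta_eq_ofReal_tsum {k : ℕ} (hk : 2 ≤ k) :
    riemannZeta k = ((∑' n : ℕ, ((n : ℝ) ^ k)⁻¹ : ℝ) : ℂ) := by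
  rw [zeta_nat_eq_tsum_of_gt_one (by omega)]
  push_cast
  refine tsum_congr fun n => ?_
  rw [one_div]

/-- The sum of `|w + d| ^ (-2 (m + 1))` over the integers `d`. -/
noncomputable def normSum (m : ℕ) (w : ℂ) : ℝ := ∑' d : ℤ, (normSq (w + d) ^ (m + 1))⁻¹

theorem summable_normSum {m : ℕ} (w : ℂ) :
    Summable fun d : ℤ => (normSq (w + d) ^ (m + 1))⁻¹ := by
  refine (summable_inv_add_int_pow w (k := 2 * (m + 1)) (by omega)).norm.congr fun d => ?_
  rw [norm_inv, norm_pow, pow_mul, normSq_eq_norm_sq]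

/-- Divide `hasSum_lipschitz` at row a by the power of the imaginary part, which contains (2a +
1)^(2m + 1), and sum. The constants (2m)! π build the odd part of ζ(2m + 1); the Fourier parts build
the imaginary part of the Eichler integral. -/
theorem hasSum_normSum {m : ℕ} (hm : m ∈ ({1, 2, 3, 4, 6} : Finset ℕ)) {τ : ℂ} (hτ : 0 < τ.im) :
    HasSum (fun a : ℕ => normSum m (oddPoint τ a))
      (((2 * m)! * π * ((1 - (2 ^ (2 * m + 1))⁻¹) * ∑' n : ℕ, ((n : ℝ) ^ (2 * m + 1))⁻¹) -
        (-1) ^ m * (2 * π ^ (2 * m + 2)) * (eichPhi m τ τ).im) /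
        (4 ^ m * (m ! : ℝ) ^ 2 * (τ.im / 2) ^ (2 * m + 1))) := by
  have hm1 : 1 ≤ m := by
    simp only [Finset.mem_insert, Finset.mem_singleton] at hm
    omega
  have h1 := (hasSum_im (hasSum_eichPhi_self m hτ)).mul_left ((-1) ^ m * (2 * π ^ (2 * m + 2)))
  have h2 := (hasSum_odd_inv_pow (k := 2 * m + 1) (by omega)).mul_left ((2 * m)! * π)
  refine ((h2.sub h1).div_const _).congr_fun fun a => ?_
  have hw : 0 < (oddPoint τ a).im := by
    rw [im_oddPoint]
    positivity
  have h3 := (hasSum_lipschitz hm hw).tsum_eq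
  rw [tsum_neg, tsum_mul_left] at h3
  change -(_ * normSum m (oddPoint τ a)) = _ at h3
  rw [im_ofReal_mul]
  have h4 : (∑ j ∈ Finset.range (m + 1), (lipCoeff m j : ℂ) * (2 * (oddPoint τ a).im * I) ^ j *
      lipSum j (oddPoint τ a)).im = (2 * m)! * π - 4 ^ m * (m ! : ℝ) ^ 2 *
        (oddPoint τ a).im ^ (2 * m + 1) * normSum m (oddPoint τ a) := by
    linarith
  rw [h4, im_oddPoint]
  have hs : ((-1 : ℝ) ^ m) * (-1) ^ m = 1 := by rw [← mul_pow]; simp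
  have h2a : (2 * (a : ℝ) + 1) ≠ 0 := by positivity
  have hpi := Real.pi_ne_zero
  have hmf : (m ! : ℝ) ≠ 0 := by exact_mod_cast m.factorial_ne_zero
  rw [eq_div_iff (by positivity), show (2 * (a : ℝ) + 1) * τ.im / 2 = (2 * a + 1) * (τ.im / 2) by ring,
    mul_pow (2 * (a : ℝ) + 1)]
  rcases neg_one_pow_eq_or ℝ m with h | h <;> rw [h] <;> field_simp <;> ring

end EpsteinRepn

/-! ### Cosets of Γ₀(4) as primitive rows, and the Epstein series as a sum over rows -/

namespace EpsteinRepn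
open Complex hiding eta
open Filter Topology ModularForm EisensteinSeries
open scoped Real Nat
open Set

theorem four_dvd_of_mem {γ : SL(2, ℤ)} (h : γ ∈ CongruenceSubgroup.Gamma0 4) : (4 : ℤ) ∣ γ 1 0 := by
  rw [CongruenceSubgroup.Gamma0_mem] at h
  exact (ZMod.intCast_zmod_eq_zero_iff_dvd _ 4).mp h

theorem rightRel_iff {a b : CongruenceSubgroup.Gamma0 4} :
    QuotientGroup.rightRel (upperTriangular.subgroupOf (CongruenceSubgroup.Gamma0 4)) a b ↔
      (b : SL(2, ℤ)) 1 0 * (a : SL(2, ℤ)) 1 1 = (b : SL(2, ℤ)) 1 1 * (a : SL(2, ℤ)) 1 0 := by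
  rw [QuotientGroup.rightRel_apply, Subgroup.mem_subgroupOf]
  change ((b : SL(2, ℤ)) * (a : SL(2, ℤ))⁻¹) 1 0 = 0 ↔ _
  have h : ((b : SL(2, ℤ)) * (a : SL(2, ℤ))⁻¹) 1 0 = (b : SL(2, ℤ)) 1 0 * (a : SL(2, ℤ)) 1 1 -
      (b : SL(2, ℤ)) 1 1 * (a : SL(2, ℤ)) 1 0 := by
    rw [Matrix.SpecialLinearGroup.coe_mul, Matrix.SpecialLinearGroup.coe_inv, Matrix.adjugate_fin_two,
      Matrix.mul_apply, Fin.sum_univ_two]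
    simp [sub_eq_add_neg]
  rw [h, sub_eq_zero]

theorem isCoprime_row (γ : SL(2, ℤ)) : IsCoprime (γ 1 0) (γ 1 1) := by
  have hdet := γ.det_coe
  rw [Matrix.det_fin_two] at hdet
  exact ⟨-γ 0 1, γ 0 0, by linarith⟩

theorem exists_mem_Gamma0 {c d : ℤ} (h : IsCoprime (4 * c) d) :
    ∃ γ : CongruenceSubgroup.Gamma0 4, (γ : SL(2, ℤ)) 1 0 = 4 * c ∧ (γ : SL(2, ℤ)) 1 1 = d := by
  obtain ⟨u, v, e⟩ := h
  let g : SL(2, ℤ) := ⟨!![v, -u; 4 * c, d], by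
    rw [Matrix.det_fin_two_of]
    linarith⟩
  refine ⟨⟨g, ?_⟩, ?_, ?_⟩
  · rw [CongruenceSubgroup.Gamma0_mem]
    change (((4 * c : ℤ)) : ZMod 4) = 0
    rw [ZMod.intCast_zmod_eq_zero_iff_dvd]
    exact ⟨c, rfl⟩
  · rfl
  · rfl

theorem eq_or_eq_neg_of_isCoprime {c d c' d' : ℤ} (h : IsCoprime c d) (h' : IsCoprime c' d')
    (hd : d ≠ 0) (e : c' * d = d' * c) : (c' = c ∧ d' = d) ∨ (c' = -c ∧ d' = -d) := by
  have h1 : d ∣ d' := h.symm.dvd_of_dvd_mul_right ⟨c', by linarith⟩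
  have h2 : d' ∣ d := h'.symm.dvd_of_dvd_mul_left ⟨c, by linarith⟩
  rcases Int.natAbs_eq_natAbs_iff.mp (Int.natAbs_eq_of_dvd_dvd h2 h1) with h3 | h3
  · exact Or.inl ⟨mul_right_cancel₀ hd (by rw [e, h3]; ring), h3⟩
  · exact Or.inr ⟨mul_right_cancel₀ hd (by rw [e, h3]; ring), h3⟩

theorem odd_of_isCoprime {c d : ℤ} (h : IsCoprime (4 * c) d) : Odd d := by
  rw [← Int.not_even_iff_odd]
  intro he
  have h2 : (2 : ℤ) ∣ 4 * c := ⟨2 * c, by ring⟩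
  have := h.isUnit_of_dvd' h2 he.two_dvd
  rw [Int.isUnit_iff] at this
  omega

/-- The pair `(c, d)`, normalised by `d > 0`, for a coset with bottom row `(4 c, d)`. -/
def cuspRow : CuspCosets 4 → ℤ × ℕ :=
  Quotient.lift
    (fun γ : CongruenceSubgroup.Gamma0 4 =>
      (((γ : SL(2, ℤ)) 1 1).sign * ((γ : SL(2, ℤ)) 1 0 / 4), ((γ : SL(2, ℤ)) 1 1).natAbs))
    (by
      intro a b hab
      obtain ⟨c, hc⟩ := four_dvd_of_mem a.2
      obtain ⟨c', hc'⟩ := four_dvd_of_mem b.2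
      have ha := isCoprime_row a
      have hd : (a : SL(2, ℤ)) 1 1 ≠ 0 := by
        rw [hc] at ha
        have := odd_of_isCoprime ha
        intro h0
        rw [h0] at this
        exact absurd this (by decide)
      rcases eq_or_eq_neg_of_isCoprime ha (isCoprime_row b) hd (rightRel_iff.mp hab) with
        ⟨h1, h2⟩ | ⟨h1, h2⟩
      · simp only [h1, h2]
      · simp only [h1, h2, Int.sign_neg, Int.natAbs_neg, hc]
        rw [show -(4 * c) = 4 * (-c) by ring, Int.mul_ediv_cancel_left _ (by norm_num),
          Int.mul_ediv_cancel_left _ (by norm_num)]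
        simp)

theorem cuspRow_mk (γ : CongruenceSubgroup.Gamma0 4) : ∃ ε : ℤ, ε * ε = 1 ∧
    (γ : SL(2, ℤ)) 1 0 = 4 * (ε * (cuspRow (Quotient.mk _ γ)).1) ∧
    (γ : SL(2, ℤ)) 1 1 = ε * (cuspRow (Quotient.mk _ γ)).2 := by
  obtain ⟨c, hc⟩ := four_dvd_of_mem γ.2
  have ha := isCoprime_row γ
  rw [hc] at ha
  have h1 := odd_of_isCoprime ha
  have h0 : (γ : SL(2, ℤ)) 1 1 ≠ 0 := fun h => by
    rw [h] at h1
    exact absurd h1 (by decide)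
  have hs : ((γ : SL(2, ℤ)) 1 1).sign * ((γ : SL(2, ℤ)) 1 1).sign = 1 := by
    rcases lt_or_gt_of_ne h0 with h | h
    · rw [Int.sign_eq_neg_one_of_neg h]; rfl
    · rw [Int.sign_eq_one_of_pos h]; rfl
  refine ⟨((γ : SL(2, ℤ)) 1 1).sign, hs, ?_, ?_⟩
  · change _ = 4 * (_ * (_ * ((γ : SL(2, ℤ)) 1 0 / 4)))
    rw [← mul_assoc ((γ : SL(2, ℤ)) 1 1).sign, hs, hc, Int.mul_ediv_cancel_left _ (by norm_num), one_mul]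
  · exact (Int.sign_mul_natAbs _).symm

theorem isCoprime_cuspRow (q : CuspCosets 4) :
    IsCoprime (4 * (cuspRow q).1) ((cuspRow q).2 : ℤ) := by
  induction q using Quotient.inductionOn with | _ γ => ?_
  obtain ⟨ε, hε, h1, h2⟩ := cuspRow_mk γ
  obtain ⟨u, v, e⟩ := isCoprime_row γ
  exact ⟨u * ε, v * ε, by rw [h1, h2] at e; linear_combination e⟩

theorem cuspRow_injective : Function.Injective cuspRow := by
  intro p q h
  induction p using Quotient.inductionOn with | _ a => ?_
  induction q using Quotient.inductionOn with | _ b => ?_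
  obtain ⟨ε, -, h1, h2⟩ := cuspRow_mk a
  obtain ⟨ε', -, h1', h2'⟩ := cuspRow_mk b
  refine Quotient.sound (rightRel_iff.mpr ?_)
  rw [h1, h2, h1', h2', h]
  ring

theorem exists_cuspRow_eq {c : ℤ} {n : ℕ} (h : IsCoprime (4 * c) (n : ℤ)) :
    ∃ q, cuspRow q = (c, n) := by
  obtain ⟨γ, h1, h2⟩ := exists_mem_Gamma0 h
  refine ⟨Quotient.mk _ γ, ?_⟩
  have hn : 0 < (n : ℤ) := by
    have := odd_of_isCoprime h
    rcases Nat.eq_zero_or_pos n with h0 | h0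
    · rw [h0] at this
      exact absurd this (by decide)
    · exact_mod_cast h0
  change (((γ : SL(2, ℤ)) 1 1).sign * ((γ : SL(2, ℤ)) 1 0 / 4), ((γ : SL(2, ℤ)) 1 1).natAbs) = _
  rw [h1, h2, Int.mul_ediv_cancel_left _ (by norm_num), Int.sign_eq_one_of_pos hn, one_mul,
    Int.natAbs_natCast]

/-- The pair `(c, a)` with `(c, 2 a + 1)` an odd multiple of a normalised bottom row. -/
def cuspMul (p : CuspCosets 4 × ℕ) : ℤ × ℕ :=
  ((2 * p.2 + 1) * (cuspRow p.1).1, ((2 * p.2 + 1) * (cuspRow p.1).2 - 1) / 2)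

theorem cuspMul_snd (p : CuspCosets 4 × ℕ) :
    2 * (cuspMul p).2 + 1 = (2 * p.2 + 1) * (cuspRow p.1).2 := by
  have h := odd_of_isCoprime (isCoprime_cuspRow p.1)
  have h2 : Odd ((2 * p.2 + 1) * (cuspRow p.1).2) :=
    (odd_two_mul_add_one p.2).mul ((Int.odd_coe_nat _).mp h)
  obtain ⟨r, hr⟩ := h2
  change 2 * (((2 * p.2 + 1) * (cuspRow p.1).2 - 1) / 2) + 1 = _
  omega

theorem gcd_cuspMul (p : CuspCosets 4 × ℕ) :
    Int.gcd (cuspMul p).1 (2 * (cuspMul p).2 + 1 : ℕ) = 2 * p.2 + 1 := by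
  rw [cuspMul_snd]
  have h := (isCoprime_cuspRow p.1).of_mul_left_right
  change Int.gcd ((2 * p.2 + 1) * (cuspRow p.1).1) _ = _
  push_cast
  rw [Int.gcd_mul_left, Int.isCoprime_iff_gcd_eq_one.mp h, mul_one]
  rfl

/-- A pair (c, 2a + 1) is its gcd, necessarily odd, times a unique primitive pair with odd positive
second entry; as that entry is odd, coprimality to c already gives coprimality to 4c. -/
theorem cuspMul_bijective : Function.Bijective cuspMul := by
  constructor
  · intro p q h
    have hk : p.2 = q.2 := by
      have h1 := gcd_cuspMul p
      rw [h, gcd_cuspMul] at h1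
      omega
    have h2 := cuspMul_snd p
    rw [h, cuspMul_snd, hk] at h2
    have h1 : (2 * (p.2 : ℤ) + 1) * (cuspRow p.1).1 = (2 * (q.2 : ℤ) + 1) * (cuspRow q.1).1 :=
      congrArg Prod.fst h
    rw [hk] at h1
    refine Prod.ext (cuspRow_injective (Prod.ext ?_ ?_)) hk
    · exact mul_left_cancel₀ (by omega) h1
    · exact (mul_left_cancel₀ (by omega) h2).symm
  · rintro ⟨c, a⟩
    obtain ⟨g, hg⟩ : ∃ g, g = Int.gcd c (2 * a + 1 : ℕ) := ⟨_, rfl⟩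
    have hpos : 0 < g := by
      rw [hg]
      exact Int.gcd_pos_of_ne_zero_right _ (by omega)
    obtain ⟨c', hc⟩ : (g : ℤ) ∣ c := hg ▸ Int.gcd_dvd_left _ _
    obtain ⟨n, hn⟩ : g ∣ 2 * a + 1 := by
      rw [hg]
      exact_mod_cast Int.gcd_dvd_right c (2 * a + 1 : ℕ)
    have hodd : Odd (g * n) := hn ▸ odd_two_mul_add_one a
    obtain ⟨k, hk⟩ := (Nat.odd_mul.mp hodd).1
    have hcop : IsCoprime c' (n : ℤ) := by
      rw [hc, hn, Nat.cast_mul, Int.gcd_mul_left, Int.natAbs_natCast] at hg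
      rw [Int.isCoprime_iff_gcd_eq_one]
      exact Nat.eq_of_mul_eq_mul_left hpos (by rw [mul_one]; exact hg.symm)
    have hcop4 : IsCoprime (4 : ℤ) (n : ℤ) := by
      obtain ⟨r, hr⟩ := (Nat.odd_mul.mp hodd).2
      have : IsCoprime (2 : ℤ) (n : ℤ) := ⟨-r, 1, by rw [hr]; push_cast; ring⟩
      rw [show (4 : ℤ) = 2 * 2 by norm_num]
      exact this.mul_left this
    obtain ⟨q, hq⟩ := exists_cuspRow_eq (hcop4.mul_left hcop)
    refine ⟨(q, k), Prod.ext ?_ ?_⟩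
    · change (2 * (k : ℤ) + 1) * (cuspRow q).1 = c
      rw [hq, hc, hk]
      push_cast
      ring
    · change ((2 * k + 1) * (cuspRow q).2 - 1) / 2 = a
      rw [hq, ← hk]
      change (g * n - 1) / 2 = a
      omega

/-- At -1/(4z) the automorphy factor of a row (4c, d) is (dz - c)/z: the 4 dividing the lower left
entry cancels, leaving an ordinary integer shift. -/
theorem im_smul_negInvFour (γ : CongruenceSubgroup.Gamma0 4) (z : UpperHalfPlane) :
    ((γ : SL(2, ℤ)) • negInvFour z).im = z.im / 4 /
      normSq (((γ : SL(2, ℤ)) 1 1 : ℤ) * (z : ℂ) - (((γ : SL(2, ℤ)) 1 0 / 4 : ℤ) : ℂ)) := by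
  obtain ⟨c, hc⟩ := four_dvd_of_mem γ.2
  rw [ModularGroup.im_smul_eq_div_normSq, ModularGroup.denom_apply, hc,
    Int.mul_ediv_cancel_left _ (by norm_num)]
  have hz := z.ne_zero
  have e1 : (negInvFour z).im = z.im / 4 / normSq z := by
    change (-1 / (4 * (z : ℂ))).im = _
    rw [neg_div, neg_im, one_div, inv_im, normSq_mul, show (4 : ℂ) = ((4 : ℝ) : ℂ) by norm_num,
      normSq_ofReal, im_ofReal_mul]
    have : normSq (z : ℂ) ≠ 0 := (normSq_pos.mpr hz).ne'
    change -(-(4 * z.im) / _) = _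
    field_simp
  have e2 : (((4 * c : ℤ) : ℂ) * (negInvFour z : ℂ) + ((γ : SL(2, ℤ)) 1 1 : ℤ)) =
      (((γ : SL(2, ℤ)) 1 1 : ℤ) * (z : ℂ) - (c : ℂ)) / z := by
    change ((4 * c : ℤ) : ℂ) * (-1 / (4 * (z : ℂ))) + _ = _
    push_cast
    field_simp
    ring
  rw [e2, normSq_div, e1]
  have : normSq (z : ℂ) ≠ 0 := (normSq_pos.mpr hz).ne'
  field_simp

theorem epsteinTerm_negInvFour (z : UpperHalfPlane) (s : ℕ) (q : CuspCosets 4) :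
    epsteinTerm 4 (negInvFour z) s q =
      (((z.im / 4) ^ s * (normSq ((cuspRow q).2 * (z : ℂ) - (cuspRow q).1) ^ s)⁻¹ : ℝ) : ℂ) := by
  induction q using Quotient.inductionOn with | _ γ => ?_
  change ((((γ : SL(2, ℤ)) • negInvFour z).im : ℝ) : ℂ) ^ (s : ℂ) = _
  obtain ⟨ε, hε, h1, h2⟩ := cuspRow_mk γ
  rw [im_smul_negInvFour, h1, h2, Int.mul_ediv_cancel_left _ (by norm_num), cpow_natCast, ← ofReal_pow,
    div_pow, div_eq_mul_inv]
  have e : normSq (((ε * (cuspRow (Quotient.mk _ γ)).2 : ℤ) : ℂ) * (z : ℂ) -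
      ((ε * (cuspRow (Quotient.mk _ γ)).1 : ℤ) : ℂ)) =
      normSq ((cuspRow (Quotient.mk _ γ)).2 * (z : ℂ) - (cuspRow (Quotient.mk _ γ)).1) := by
    rw [show ((ε * (cuspRow (Quotient.mk _ γ)).2 : ℤ) : ℂ) * (z : ℂ) -
      ((ε * (cuspRow (Quotient.mk _ γ)).1 : ℤ) : ℂ) = ((ε : ℝ) : ℂ) *
      ((cuspRow (Quotient.mk _ γ)).2 * (z : ℂ) - (cuspRow (Quotient.mk _ γ)).1) by push_cast; ring,
      normSq_mul, normSq_ofReal]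
    have : (ε : ℝ) * ε = 1 := by exact_mod_cast hε
    rw [this, one_mul]
  rw [e]

/-- For τ = 2z + 1 the point `oddPoint τ a` is (2a + 1)z + (a + 1), an integer translate of (2a +
1)z. -/
theorem normSum_oddPoint (m : ℕ) (z : ℂ) (a : ℕ) :
    HasSum (fun c : ℤ => (normSq ((2 * a + 1 : ℕ) * z - c) ^ (m + 1))⁻¹)
      (normSum m (oddPoint (2 * z + 1) a)) := by
  have h := (summable_normSum (m := m) (oddPoint (2 * z + 1) a)).hasSum
  rw [← (Equiv.subLeft (-(a + 1 : ℤ))).hasSum_iff] at h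
  refine h.congr_fun fun c => ?_
  simp only [Function.comp_def, Equiv.subLeft_apply, oddPoint]
  congr 3
  push_cast
  ring

/-- All terms are nonnegative, so convergence of the sum of row sums gives summability over all
pairs. Regrouping the pairs by their primitive part multiplies each coset term by the sum of k^(-2(m
+ 1)) over odd k, which is then divided out. -/
theorem summable_epsteinTerm_and_eq {m : ℕ} {z : UpperHalfPlane} {S : ℝ}
    (h : HasSum (fun a : ℕ => normSum m (oddPoint (2 * z + 1) a)) S) :
    Summable (epsteinTerm 4 (negInvFour z) ((m + 1 : ℕ) : ℂ)) ∧
    epsteinZeta 4 (negInvFour z) ((m + 1 : ℕ) : ℂ) = (((z.im / 4) ^ (m + 1) * S /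
      ((1 - (2 ^ (2 * m + 2))⁻¹) * ∑' n : ℕ, ((n : ℝ) ^ (2 * m + 2))⁻¹) : ℝ) : ℂ) := by
  obtain ⟨f, hf⟩ : ∃ f : ℤ × ℕ → ℝ,
    f = fun p => (normSq ((2 * p.2 + 1 : ℕ) * (z : ℂ) - p.1) ^ (m + 1))⁻¹ := ⟨_, rfl⟩
  obtain ⟨t, ht⟩ : ∃ t : CuspCosets 4 → ℝ, t = fun q =>
    (normSq ((cuspRow q).2 * (z : ℂ) - (cuspRow q).1) ^ (m + 1))⁻¹ := ⟨_, rfl⟩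
  have hfS : HasSum f S := by
    rw [← (Equiv.prodComm ℕ ℤ).hasSum_iff]
    have hin : ∀ a : ℕ, HasSum (fun c : ℤ => (f ∘ Equiv.prodComm ℕ ℤ) (a, c))
        (normSum m (oddPoint (2 * z + 1) a)) := fun a => by
      rw [hf]
      exact normSum_oddPoint m z a
    have hs : Summable (f ∘ Equiv.prodComm ℕ ℤ) := by
      rw [summable_prod_of_nonneg fun p => by
        rw [hf]
        exact inv_nonneg.mpr (pow_nonneg (normSq_nonneg _) _)]
      exact ⟨fun a => (hin a).summable, h.summable.congr fun a => ((hin a).tsum_eq).symm⟩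
    have := hs.hasSum.prod_fiberwise hin
    rw [← this.unique h]
    exact hs.hasSum
  rw [← (Equiv.ofBijective _ cuspMul_bijective).hasSum_iff] at hfS
  have hval : ∀ q k, (f ∘ Equiv.ofBijective _ cuspMul_bijective) (q, k) =
      t q * ((2 * (k : ℝ) + 1) ^ (2 * m + 2))⁻¹ := fun q k => by
    simp only [Function.comp_def, Equiv.ofBijective_apply, hf, ht]
    rw [cuspMul_snd]
    change (normSq (_ - (((2 * (k : ℤ) + 1) * (cuspRow q).1 : ℤ) : ℂ)) ^ (m + 1))⁻¹ = _
    rw [show (((2 * k + 1) * (cuspRow q).2 : ℕ) : ℂ) * (z : ℂ) -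
      (((2 * (k : ℤ) + 1) * (cuspRow q).1 : ℤ) : ℂ) = ((2 * k + 1 : ℝ) : ℂ) *
      ((cuspRow q).2 * (z : ℂ) - (cuspRow q).1) by push_cast; ring, normSq_mul, normSq_ofReal, mul_pow,
      mul_inv, mul_comm, ← pow_two, ← pow_mul]
    ring_nf
  have hodd := hasSum_odd_inv_pow (k := 2 * m + 2) (by omega)
  have hpos : 0 < (1 - (2 ^ (2 * m + 2))⁻¹) * ∑' n : ℕ, ((n : ℝ) ^ (2 * m + 2))⁻¹ := by
    rw [← hodd.tsum_eq]
    exact hodd.summable.tsum_pos (fun k => by positivity) 0 (by norm_num)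
  have hfib := hfS.prod_fiberwise fun q => by
    simp only [hval]
    exact hodd.mul_left (t q)
  have htS : HasSum t (S / ((1 - (2 ^ (2 * m + 2))⁻¹) * ∑' n : ℕ, ((n : ℝ) ^ (2 * m + 2))⁻¹)) := by
    refine (hfib.div_const _).congr_fun fun q => ?_
    rw [mul_div_cancel_right₀ _ hpos.ne']
  have hfin : HasSum (epsteinTerm 4 (negInvFour z) ((m + 1 : ℕ) : ℂ)) (((z.im / 4) ^ (m + 1) * S /
      ((1 - (2 ^ (2 * m + 2))⁻¹) * ∑' n : ℕ, ((n : ℝ) ^ (2 * m + 2))⁻¹) : ℝ) : ℂ) := by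
    rw [mul_div_assoc]
    refine (hasSum_ofReal.mpr (htS.mul_left ((z.im / 4) ^ (m + 1)))).congr_fun fun q => ?_
    rw [epsteinTerm_negInvFour, ht]
  exact ⟨hfin.summable, hfin.tsum_eq⟩

end EpsteinRepn

/-! ### Change of variables and comparison of the two sides -/

namespace EpsteinRepn
open Complex hiding eta
open Filter Topology ModularForm EisensteinSeries
open scoped Real Nat
open MeasureTheory Set

theorem smul_modularLambda_mem_cutPlane {τ : ℂ} (hτ : τ ∈ fundDomain) {u : ℝ} (hu : u ∈ Icc (0 : ℝ) 1) :
    (u * modularLambda τ : ℂ) ∈ cutPlane := by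
  rcases hu.1.eq_or_lt with h | h
  · rw [← h, ofReal_zero, zero_mul]
    change (1 - 0 : ℂ) ∈ slitPlane
    rw [sub_zero]
    exact one_mem_slitPlane
  · obtain ⟨v, hv, e⟩ := segment_mem_image hτ ⟨h, hu.2⟩
    rw [← e]
    exact mem_cutPlane_of_mem (modularLambda_mem hv)

/-- A power of Im v is at most a constant times e^(π Im v / 2), the square root of a quantity
bounded by C/u. The resulting exponent -1/2 is integrable at 0. -/
theorem exists_norm_eval_eichPoly_segPath_le (m : ℕ) {τ : ℂ} (hτ : τ ∈ fundDomain) :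
    ∃ C : ℝ, ∀ u ∈ Ioc (0 : ℝ) 1,
      ‖(eichPoly m τ).eval (segPath τ u)‖ ≤ C * u ^ (-(1 / 2) : ℝ) := by
  obtain ⟨C, hC⟩ := exp_im_segPath_le hτ
  refine ⟨(2 * m)! * (2 / π) ^ (2 * m) * Real.exp (π / 2 * (1 + ‖τ‖)) * √C, fun u hu => ?_⟩
  obtain ⟨h0, h1, -⟩ := segPath_mem hτ hu
  have hn : ‖segPath τ u‖ ≤ 1 + (segPath τ u).im := by
    refine (norm_le_abs_re_add_abs_im _).trans ?_
    rw [abs_of_pos h0]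
    linarith
  have hx : ∀ w : ℂ, ‖w‖ = ‖τ‖ → ‖segPath τ u - w‖ ≤ (segPath τ u).im + (1 + ‖τ‖) := fun w hw => by
    refine (norm_sub_le _ _).trans ?_
    rw [hw]
    linarith
  set x := (segPath τ u).im + (1 + ‖τ‖) with hxdef
  have hx0 : 0 < x := by positivity
  have e1 : ‖(eichPoly m τ).eval (segPath τ u)‖ ≤ x ^ (2 * m) := by
    rw [eval_eichPoly, norm_mul, norm_pow, norm_pow, two_mul, pow_add]
    have hτ' := hx _ rfl
    have hτc := hx ((starRingEnd ℂ) τ) (norm_conj τ)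
    gcongr
  have e2 : x ^ (2 * m) ≤ (2 * m)! * (2 / π) ^ (2 * m) * Real.exp (π / 2 * x) := by
    have h := Real.pow_div_factorial_le_exp (π / 2 * x) (by positivity) (2 * m)
    rw [div_le_iff₀ (by positivity), mul_pow] at h
    have h2 : (2 / π) ^ (2 * m) * (π / 2) ^ (2 * m) = 1 := by
      rw [← mul_pow, div_mul_div_cancel₀ Real.pi_ne_zero, div_self two_ne_zero, one_pow]
    calc x ^ (2 * m) = (2 / π) ^ (2 * m) * ((π / 2) ^ (2 * m) * x ^ (2 * m)) := by
          rw [← mul_assoc, h2, one_mul]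
      _ ≤ (2 / π) ^ (2 * m) * (Real.exp (π / 2 * x) * (2 * m)!) := by gcongr
      _ = _ := by ring
  have e3 : Real.exp (π / 2 * x) ≤ Real.exp (π / 2 * (1 + ‖τ‖)) * (√C * u ^ (-(1 / 2) : ℝ)) := by
    rw [hxdef, mul_add, Real.exp_add, mul_comm, show π / 2 * (segPath τ u).im = π * (segPath τ u).im / 2 by ring,
      Real.exp_half]
    have h := Real.sqrt_le_sqrt (hC u hu)
    rw [Real.sqrt_div' _ hu.1.le, div_eq_mul_inv, Real.sqrt_eq_rpow u, ← Real.rpow_neg hu.1.le] at h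
    gcongr
  refine e1.trans (e2.trans ?_)
  calc _ ≤ (2 * m)! * (2 / π) ^ (2 * m) * (Real.exp (π / 2 * (1 + ‖τ‖)) * (√C * u ^ (-(1 / 2) : ℝ))) := by
        gcongr
    _ = _ := by ring

/-- Under t = λ(v), K^(2m) dt becomes a power of θ₃ times λ'(v) dv, and the hypothesis `h`
identifies the result with c times the Eisenstein series. So c `eichPhi` along the lifted path is a
primitive; it tends to 0 at i∞, and the path ends at τ. -/
theorem hasSegmentIntegral_eichPhi {m : ℕ} {τ c : ℂ} {G : ℂ → ℂ} (hG : Continuous G)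
    (hτ : τ ∈ fundDomain)
    (h : ∀ v : ℂ, v ∈ fundDomain → G (modularLambda v) * (π / 2 * theta3 v ^ 2) ^ (2 * m) *
      (π * I * modularLambda v * (1 - modularLambda v) * theta3 v ^ 4) = c * eichF m 0 v) :
    HasSegmentIntegral (fun t => G t * ellipticKsqrt t ^ (2 * m) * (periodRatio t - τ) ^ m *
      (periodRatio t - (starRingEnd ℂ) τ) ^ m) 0 (modularLambda τ) (c * eichPhi m τ τ) := by
  have hval : ∀ u : ℝ, (fun t => G t * ellipticKsqrt t ^ (2 * m) * (periodRatio t - τ) ^ m *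
      (periodRatio t - (starRingEnd ℂ) τ) ^ m) (0 + (u : ℂ) * (modularLambda τ - 0)) *
      (modularLambda τ - 0) = (G (u * modularLambda τ) * ellipticKsqrt (u * modularLambda τ) ^ (2 * m) *
      modularLambda τ) * (eichPoly m τ).eval (segPath τ u) := fun u => by
    simp only [zero_add, sub_zero, eval_eichPoly, segPath]
    ring
  have hcont : ContinuousOn (fun u : ℝ => G (u * modularLambda τ) *
      ellipticKsqrt (u * modularLambda τ) ^ (2 * m) * modularLambda τ) (Icc 0 1) := by
    intro u hu
    have hl : Continuous fun u : ℝ => (u * modularLambda τ : ℂ) := by fun_prop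
    have hK : ContinuousAt (fun u : ℝ => ellipticKsqrt (u * modularLambda τ)) u :=
      ContinuousAt.comp (f := fun u : ℝ => (u * modularLambda τ : ℂ))
        (differentiableAt_ellipticKsqrt (smul_modularLambda_mem_cutPlane hτ hu)).continuousAt
        hl.continuousAt
    exact ((((hG.comp hl).continuousAt).mul (hK.pow _)).mul continuousAt_const).continuousWithinAt
  obtain ⟨M, hM⟩ := isCompact_Icc.exists_bound_of_continuousOn hcont
  obtain ⟨C, hC⟩ := exists_norm_eval_eichPoly_segPath_le m hτ
  have hint : IntervalIntegrable (fun u : ℝ => (fun t => G t * ellipticKsqrt t ^ (2 * m) *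
      (periodRatio t - τ) ^ m * (periodRatio t - (starRingEnd ℂ) τ) ^ m)
      (0 + (u : ℂ) * (modularLambda τ - 0)) * (modularLambda τ - 0)) volume 0 1 := by
    simp only [hval]
    rw [intervalIntegrable_iff_integrableOn_Ioc_of_le zero_le_one]
    have hr : IntegrableOn (fun u : ℝ => M * (C * u ^ (-(1 / 2) : ℝ))) (Ioc 0 1) := by
      rw [← intervalIntegrable_iff_integrableOn_Ioc_of_le zero_le_one]
      exact ((intervalIntegral.intervalIntegrable_rpow' (by norm_num)).const_mul C).const_mul M
    refine Integrable.mono' hr ?_ ?_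
    · refine ContinuousOn.aestronglyMeasurable ?_ measurableSet_Ioc
      exact (hcont.mono Ioc_subset_Icc_self).mul
        ((eichPoly m τ).continuous.comp_continuousOn (continuousOn_segPath hτ))
    · refine (ae_restrict_iff' measurableSet_Ioc).mpr (Eventually.of_forall fun u hu => ?_)
      rw [norm_mul]
      exact mul_le_mul (hM u (Ioc_subset_Icc_self hu)) (hC u hu) (norm_nonneg _)
        ((norm_nonneg _).trans (hM u (Ioc_subset_Icc_self hu)))
  refine ⟨hint, ?_⟩
  have hderiv : ∀ u ∈ Ioc (0 : ℝ) 1, HasDerivAt (fun u => c * eichPhi m τ (segPath τ u))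
      ((fun t => G t * ellipticKsqrt t ^ (2 * m) * (periodRatio t - τ) ^ m *
        (periodRatio t - (starRingEnd ℂ) τ) ^ m) (0 + (u : ℂ) * (modularLambda τ - 0)) *
        (modularLambda τ - 0)) u := fun u hu => by
    rw [hval]
    obtain ⟨d, hd, e⟩ := hasDerivAt_segPath hτ hu
    have hσ := segPath_mem hτ hu
    refine (((hasDerivAt_eichPhi m τ hσ.1).comp_of_eq u hd rfl).const_mul c).congr_deriv ?_
    have hl := modularLambda_segPath hτ hu
    have h1 := h _ hσ
    rw [hl] at h1
    have hK := ellipticKsqrt_modularLambda hσ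
    rw [hl] at hK
    rw [hK]
    linear_combination -(d * (eichPoly m τ).eval (segPath τ u)) * h1 +
      (G (u * modularLambda τ) * (π / 2 * theta3 (segPath τ u) ^ 2) ^ (2 * m) *
        (eichPoly m τ).eval (segPath τ u)) * e
  have h0 : Tendsto (fun u => c * eichPhi m τ (segPath τ u)) (𝓝[>] 0) (𝓝 0) := by
    have h1 : Tendsto (segPath τ) (𝓝[>] 0) (imTop ⊓ 𝓟 fundDomain) := by
      refine tendsto_inf.mpr ⟨tendsto_segPath hτ, tendsto_principal.mpr ?_⟩
      filter_upwards [Ioc_mem_nhdsGT zero_lt_one] with u hu using segPath_mem hτ hu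
    have h2 := ((tendsto_eichPhi m τ).comp h1).const_mul c
    rwa [mul_zero] at h2
  have h1 : Tendsto (fun u => c * eichPhi m τ (segPath τ u)) (𝓝[<] 1) (𝓝 (c * eichPhi m τ τ)) := by
    have h2 := (hderiv 1 ⟨zero_lt_one, le_rfl⟩).continuousAt.tendsto
    rw [segPath_one hτ] at h2
    exact h2.mono_left nhdsWithin_le_nhds
  rw [intervalIntegral.integral_eq_sub_of_hasDerivAt_of_tendsto zero_lt_one
    (fun u hu => hderiv u (Ioo_subset_Ioc_self hu)) hint h0 h1, sub_zero]

/-- With τ = 2z + 1 the circle conditions read |τ ∓ 1/2| > 1/2, that is ±Re τ < |τ|². -/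
theorem mul_add_one_mem_fundDomain {z : UpperHalfPlane} (h_re : |(2 * (z : ℂ) + 1).re| < 1)
    (h_right : 1 / 2 < ‖2 * (z : ℂ) + 1 / 2‖) (h_left : 1 / 2 < ‖2 * (z : ℂ) + 3 / 2‖) :
    2 * (z : ℂ) + 1 ∈ fundDomain := by
  have him : 0 < (z : ℂ).im := z.im_pos
  refine ⟨by simpa using him, h_re, ?_⟩
  have h1 : (1 / 2 : ℝ) ^ 2 < ‖2 * (z : ℂ) + 1 / 2‖ ^ 2 := by gcongr
  have h2 : (1 / 2 : ℝ) ^ 2 < ‖2 * (z : ℂ) + 3 / 2‖ ^ 2 := by gcongr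
  rw [show 2 * (z : ℂ) + 1 / 2 = 2 * z + ((1 / 2 : ℝ) : ℂ) by push_cast; ring] at h1
  rw [show 2 * (z : ℂ) + 3 / 2 = 2 * z + ((3 / 2 : ℝ) : ℂ) by push_cast; ring] at h2
  rw [← normSq_eq_norm_sq, normSq_apply, add_re, add_im, ofReal_re, ofReal_im] at h1 h2
  rw [show 2 * (z : ℂ) + 1 = 2 * z + ((1 : ℝ) : ℂ) by push_cast; ring, normSq_apply, add_re, add_im,
    ofReal_re, ofReal_im, abs_lt]
  constructor <;> nlinarith

/-- The common form of the five identities, with m = s - 1. Here q and Q describe the lattice sum of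
weight 2s in terms of λ, r is ζ(2s)/π^(2s), and a, b are the coefficients of the integrand and of
ζ(2s - 1). Condition `ha` equates the multiple of `eichPhi` from the change of variables with the
one in the Epstein series; `hb` does the same for the zeta term. -/
theorem epsteinZeta_sub_eq_re {m : ℕ} (hm : m ∈ ({1, 2, 3, 4, 6} : Finset ℕ)) {q r a b : ℝ}
    {Q : ℂ → ℂ} (hQ : Continuous Q) (hq : q ≠ 0)
    (hlat : ∀ v : ℂ, 0 < v.im → latSum 1 1 (2 * m + 2) v =
      q * latUnit v ^ (m + 1) * (modularLambda v * (1 - modularLambda v)) * Q (modularLambda v))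
    (hzeta : riemannZeta (2 * m + 2 : ℕ) = ((r * π ^ (2 * m + 2) : ℝ) : ℂ)) (hr : r ≠ 0)
    (ha : a * 2 * 12 ^ (m + 1) / (4 ^ m * (2 * m + 1)! * q) =
      -(2 / (4 ^ (2 * m + 1) * (m ! : ℝ) ^ 2 * (1 - (2 ^ (2 * m + 2))⁻¹) * r)))
    (hb : b = (2 * m)! * (1 - (2 ^ (2 * m + 1))⁻¹) /
      (4 ^ (2 * m + 1) * (m ! : ℝ) ^ 2 * (1 - (2 ^ (2 * m + 2))⁻¹) * r))
    {z : UpperHalfPlane} (hz : 2 * (z : ℂ) + 1 ∈ fundDomain) :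
    ∃ J : ℂ, HasSegmentIntegral (fun t => a / ((π : ℂ) ^ (2 * m + 1) * (z.im : ℂ) ^ m) * Q t *
        ellipticKsqrt t ^ (2 * m) * (periodRatio t - (2 * z + 1)) ^ m *
        (periodRatio t - (starRingEnd ℂ) (2 * z + 1)) ^ m) 0 (modularLambda (2 * z + 1)) J ∧
      epsteinZeta 4 (negInvFour z) (m + 1 : ℕ) -
        b * riemannZeta (2 * m + 1 : ℕ) / ((π : ℂ) ^ (2 * m + 1) * (z.im : ℂ) ^ m) = ((J.re : ℝ) : ℂ) := by
  have hη : z.im ≠ 0 := z.im_pos.ne'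
  have hηc : (z.im : ℂ) ≠ 0 := by exact_mod_cast hη
  have hpi : (π : ℂ) ≠ 0 := by exact_mod_cast Real.pi_ne_zero
  have hqc : (q : ℂ) ≠ 0 := by exact_mod_cast hq
  have hm1 : 1 ≤ m := by
    simp only [Finset.mem_insert, Finset.mem_singleton] at hm
    omega
  -- The integral is κi times `eichPhi` with κ real, so its real part is -κ times the imaginary part
  -- that occurs in `hasSum_normSum`.
  obtain ⟨κ, hκ⟩ : ∃ κ : ℝ, κ = (-1) ^ (m + 1) * (a * 2 * 12 ^ (m + 1) / (4 ^ m * (2 * m + 1)! * q)) /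
    z.im ^ m := ⟨_, rfl⟩
  refine ⟨(κ * I) * eichPhi m (2 * z + 1) (2 * z + 1), ?_, ?_⟩
  · refine hasSegmentIntegral_eichPhi (G := fun t => a / ((π : ℂ) ^ (2 * m + 1) * (z.im : ℂ) ^ m) * Q t)
      (continuous_const.mul hQ) hz fun v hv => ?_
    have h1 := hlat v hv.1
    rw [hasSum_latSum_one_one (by omega) ⟨m + 1, by ring⟩ hv.1, show 2 * m + 2 - 1 = 2 * m + 1 by omega,
      show 2 * m + 2 = 2 * (m + 1) by ring, pow_mul, mul_pow, I_sq, latUnit] at h1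
    have hfac : ((2 * m + 1)! : ℂ) ≠ 0 := by exact_mod_cast (2 * m + 1).factorial_ne_zero
    have h2 : qs (2 * m + 1) 0 v = (-1) ^ (m + 1) * (2 * m + 1)! / (2 * π ^ (2 * m + 2)) *
        (q * (π ^ 2 / 12 * theta3 v ^ 4) ^ (m + 1) *
          (modularLambda v * (1 - modularLambda v)) * Q (modularLambda v)) := by
      rw [← h1, neg_sq, mul_pow, ← pow_mul]
      have : ((-1 : ℂ) ^ (m + 1)) * (-1) ^ (m + 1) = 1 := by rw [← mul_pow]; simp
      rw [show 2 * (m + 1) = 2 * m + 2 by ring]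
      field_simp
      linear_combination (-qs (2 * m + 1) 0 v) * this
    have h3 : eichF m 0 v = qs (2 * m + 1) 0 v := by simp [eichF]
    have : ((-1 : ℂ) ^ (m + 1)) * (-1) ^ (m + 1) = 1 := by rw [← mul_pow]; simp
    have h4 : (4 : ℂ) ^ m = 2 ^ (2 * m) := by rw [pow_mul]; norm_num
    rw [h3, h2, hκ]
    push_cast
    rw [h4]
    simp only [mul_pow, div_pow, ← pow_mul]
    field_simp
    rw [pow_two ((-1 : ℂ) ^ (m + 1)), this]
    ring
  · obtain ⟨-, hE⟩ := summable_epsteinTerm_and_eq (hasSum_normSum hm hz.1)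
    have hz2 := riemannZeta_eq_ofReal_tsum (k := 2 * m + 2) (by omega)
    rw [hzeta, ofReal_inj] at hz2
    have him : (2 * (z : ℂ) + 1).im / 2 = z.im := by
      simp
    have hre : (κ * I * eichPhi m (2 * z + 1) (2 * z + 1)).re =
        -κ * (eichPhi m (2 * z + 1) (2 * z + 1)).im := by
      rw [mul_assoc, re_ofReal_mul, I_mul_re]
      ring
    have hA0 : (1 - ((2 : ℝ) ^ (2 * m + 2))⁻¹) ≠ 0 := by
      have : ((2 : ℝ) ^ (2 * m + 2))⁻¹ < 1 := inv_lt_one_of_one_lt₀ (one_lt_pow₀ (by norm_num) (by omega))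
      linarith
    rw [ha] at hκ
    rw [him, ← hz2] at hE
    rw [hE, riemannZeta_eq_ofReal_tsum (by omega : 2 ≤ 2 * m + 1), hre, hκ, hb]
    clear hE ha hb hκ hre
    generalize (eichPhi m (2 * z + 1) (2 * z + 1)).im = Φ
    generalize (1 - ((2 : ℝ) ^ (2 * m + 2))⁻¹) = A at *
    generalize (1 - ((2 : ℝ) ^ (2 * m + 1))⁻¹) = B
    generalize (∑' n : ℕ, ((n : ℝ) ^ (2 * m + 1))⁻¹) = Z
    have hmf : (m ! : ℝ) ≠ 0 := by exact_mod_cast m.factorial_ne_zero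
    have hpi := Real.pi_ne_zero
    rw [← ofReal_pow, ← ofReal_pow, ← ofReal_mul, ← ofReal_mul, ← ofReal_div, ← ofReal_sub,
      ofReal_inj, div_pow, pow_succ (-1 : ℝ)]
    field_simp
    ring

end EpsteinRepn

/-! ### Even zeta values and the five cases -/

namespace EpsteinRepn
open Complex hiding eta
open Filter Topology ModularForm EisensteinSeries
open scoped Real Nat
open MeasureTheory Set

theorem bernoulli'_values : bernoulli' 6 = 1 / 42 ∧ bernoulli' 8 = -1 / 30 ∧ bernoulli' 10 = 5 / 66 ∧
    bernoulli' 14 = 7 / 6 := by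
  have h5 : bernoulli' 5 = 0 := bernoulli'_eq_zero_of_odd (by decide) (by norm_num)
  have h7 : bernoulli' 7 = 0 := bernoulli'_eq_zero_of_odd (by decide) (by norm_num)
  have h9 : bernoulli' 9 = 0 := bernoulli'_eq_zero_of_odd (by decide) (by norm_num)
  have h11 : bernoulli' 11 = 0 := bernoulli'_eq_zero_of_odd (by decide) (by norm_num)
  have h13 : bernoulli' 13 = 0 := bernoulli'_eq_zero_of_odd (by decide) (by norm_num)
  have h6 : bernoulli' 6 = 1 / 42 := by
    rw [bernoulli'_def]
    norm_num [Finset.sum_range_succ, Nat.choose, h5]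
  have h8 : bernoulli' 8 = -1 / 30 := by
    rw [bernoulli'_def]
    norm_num [Finset.sum_range_succ, Nat.choose, h5, h6, h7]
  have h10 : bernoulli' 10 = 5 / 66 := by
    rw [bernoulli'_def]
    norm_num [Finset.sum_range_succ, Nat.choose, h5, h6, h7, h8, h9]
  have h12 : bernoulli' 12 = -691 / 2730 := by
    rw [bernoulli'_def]
    norm_num [Finset.sum_range_succ, Nat.choose, h5, h6, h7, h8, h9, h10, h11]
  refine ⟨h6, h8, h10, ?_⟩
  rw [bernoulli'_def]
  norm_num [Finset.sum_range_succ, Nat.choose, h5, h6, h7, h8, h9, h10, h11, h12, h13]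

theorem riemannZeta_even_eq {m : ℕ} {β r : ℚ} (hβ : bernoulli' (2 * m + 2) = β)
    (hr : r = (-1) ^ m * 2 ^ (2 * m + 1) * β / (2 * m + 2)!) :
    riemannZeta (2 * m + 2 : ℕ) = (((r : ℝ) * π ^ (2 * m + 2) : ℝ) : ℂ) := by
  have h := riemannZeta_two_mul_nat (k := m + 1) (by omega)
  rw [show 2 * (m + 1) = 2 * m + 2 by ring, bernoulli_eq_bernoulli'_of_ne_one (by omega), hβ,
    show 2 * m + 2 - 1 = 2 * m + 1 by omega] at h
  rw [show ((2 * m + 2 : ℕ) : ℂ) = 2 * ((m + 1 : ℕ) : ℂ) by push_cast; ring, h, hr]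
  push_cast
  ring

theorem summable_epsteinTerm {m : ℕ} (hm : m ∈ ({1, 2, 3, 4, 6} : Finset ℕ)) (z : UpperHalfPlane) :
    Summable (epsteinTerm 4 (negInvFour z) ((m + 1 : ℕ) : ℂ)) := by
  have hz : 0 < (z : ℂ).im := z.im_pos
  exact (summable_epsteinTerm_and_eq (hasSum_normSum (τ := 2 * (z : ℂ) + 1) hm (by simpa using hz))).1

end EpsteinRepn

open EpsteinRepn
theorem theorem2 (z : UpperHalfPlane)
    (h_re : |(2 * (z : ℂ) + 1).re| < 1)
    (h_right : 1 / 2 < ‖2 * (z : ℂ) + 1 / 2‖)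
    (h_left : 1 / 2 < ‖2 * (z : ℂ) + 3 / 2‖) :
    -- the segments of integration lie in the domain of the integrands
    ((modularLambda (2 * (z : ℂ) + 1)).im ≠ 0 ∨
      (0 < (modularLambda (2 * (z : ℂ) + 1)).re ∧ (modularLambda (2 * (z : ℂ) + 1)).re < 1)) ∧
    -- the series that define the Epstein zeta values converge absolutely
    (∀ s ∈ ({2, 3, 4, 5, 7} : Finset ℕ), Summable (epsteinTerm 4 (negInvFour z) (s : ℂ))) ∧
    -- `s = 2`
    (∃ J : ℂ,
      HasSegmentIntegral
        (fun t : ℂ => 3 * ellipticKsqrt t ^ 2 / (4 * (Real.pi : ℂ) ^ 3 * (z.im : ℂ))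
          * (periodRatio t - 2 * (z : ℂ) - 1)
          * (periodRatio t - 2 * (starRingEnd ℂ) (z : ℂ) - 1))
        0 (modularLambda (2 * (z : ℂ) + 1)) J ∧
      epsteinZeta 4 (negInvFour z) 2
        - 21 * riemannZeta 3 / (8 * (Real.pi : ℂ) ^ 3 * (z.im : ℂ)) = ((J.re : ℝ) : ℂ)) ∧
    -- `s = 3`
    (∃ J : ℂ,
      HasSegmentIntegral
        (fun t : ℂ => 15 * (2 * t - 1) * ellipticKsqrt t ^ 4
            / (32 * (Real.pi : ℂ) ^ 5 * (z.im : ℂ) ^ 2)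
          * (periodRatio t - 2 * (z : ℂ) - 1) ^ 2
          * (periodRatio t - 2 * (starRingEnd ℂ) (z : ℂ) - 1) ^ 2)
        0 (modularLambda (2 * (z : ℂ) + 1)) J ∧
      epsteinZeta 4 (negInvFour z) 3
        - 1395 * riemannZeta 5 / (256 * (Real.pi : ℂ) ^ 5 * (z.im : ℂ) ^ 2)
          = ((J.re : ℝ) : ℂ)) ∧
    -- `s = 4`
    (∃ J : ℂ,
      HasSegmentIntegral
        (fun t : ℂ => 70 * (2 - 17 * t * (1 - t)) * ellipticKsqrt t ^ 6
            / (1088 * (Real.pi : ℂ) ^ 7 * (z.im : ℂ) ^ 3)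
          * (periodRatio t - 2 * (z : ℂ) - 1) ^ 3
          * (periodRatio t - 2 * (starRingEnd ℂ) (z : ℂ) - 1) ^ 3)
        0 (modularLambda (2 * (z : ℂ) + 1)) J ∧
      epsteinZeta 4 (negInvFour z) 4
        - 200025 * riemannZeta 7 / (17408 * (Real.pi : ℂ) ^ 7 * (z.im : ℂ) ^ 3)
          = ((J.re : ℝ) : ℂ)) ∧
    -- `s = 5`
    (∃ J : ℂ,
      HasSegmentIntegral
        (fun t : ℂ => 315 * (2 * t - 1) * (1 - 31 * t * (1 - t)) * ellipticKsqrt t ^ 8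
            / (15872 * (Real.pi : ℂ) ^ 9 * (z.im : ℂ) ^ 4)
          * (periodRatio t - 2 * (z : ℂ) - 1) ^ 4
          * (periodRatio t - 2 * (starRingEnd ℂ) (z : ℂ) - 1) ^ 4)
        0 (modularLambda (2 * (z : ℂ) + 1)) J ∧
      epsteinZeta 4 (negInvFour z) 5
        - 50703975 * riemannZeta 9 / (2031616 * (Real.pi : ℂ) ^ 9 * (z.im : ℂ) ^ 4)
          = ((J.re : ℝ) : ℂ)) ∧
    -- `s = 7`
    (∃ J : ℂ,
      HasSegmentIntegral
        (fun t : ℂ => 3003 * (2 * t - 1)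
            * (1 - 512 * t * (1 - t) + 5461 * t ^ 2 * (1 - t) ^ 2) * ellipticKsqrt t ^ 12
            / (22368256 * (Real.pi : ℂ) ^ 13 * (z.im : ℂ) ^ 6)
          * (periodRatio t - 2 * (z : ℂ) - 1) ^ 6
          * (periodRatio t - 2 * (starRingEnd ℂ) (z : ℂ) - 1) ^ 6)
        0 (modularLambda (2 * (z : ℂ) + 1)) J ∧
      epsteinZeta 4 (negInvFour z) 7
        - 11506129710075 * riemannZeta 13
            / (91620376576 * (Real.pi : ℂ) ^ 13 * (z.im : ℂ) ^ 6)
          = ((J.re : ℝ) : ℂ)) := by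
  have hz := mul_add_one_mem_fundDomain h_re h_right h_left
  obtain ⟨h6, h8, h10, h14⟩ := bernoulli'_values
  have hconj : (starRingEnd ℂ) (2 * (z : ℂ) + 1) = 2 * (starRingEnd ℂ) (z : ℂ) + 1 := by
    rw [map_add, map_mul, map_one, Complex.conj_ofNat]
  refine ⟨modularLambda_mem hz, ?_, ?_, ?_, ?_, ?_, ?_⟩
  · intro s hs
    simp only [Finset.mem_insert, Finset.mem_singleton] at hs
    rcases hs with rfl | rfl | rfl | rfl | rfl
    · exact summable_epsteinTerm (m := 1) (by decide) z
    · exact summable_epsteinTerm (m := 2) (by decide) z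
    · exact summable_epsteinTerm (m := 3) (by decide) z
    · exact summable_epsteinTerm (m := 4) (by decide) z
    · exact summable_epsteinTerm (m := 6) (by decide) z
  -- In each case q and Q are read from the formula for the lattice sum of weight 2s, r is the
  -- rational part of ζ(2s), and a and b come from the statement.
  · obtain ⟨J, h1, h2⟩ := epsteinZeta_sub_eq_re (m := 1) (q := -3) (r := ((1 / 90 : ℚ) : ℝ)) (a := 3 / 4)
      (b := 21 / 8) (Q := fun _ => 1) (by decide) (by fun_prop) (by norm_num)
      (fun v hv => by
        rw [latSum_four_eq hv]
        push_cast
        ring)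
      (riemannZeta_even_eq bernoulli'_four (by norm_num [Nat.factorial])) (by norm_num) (by norm_num [Nat.factorial])
      (by norm_num [Nat.factorial]) hz
    refine ⟨J, ?_, ?_⟩
    · convert h1 using 1
      funext t
      rw [hconj, ← sub_sub, ← sub_sub]
      generalize periodRatio t - 2 * (z : ℂ) - 1 = x
      generalize periodRatio t - 2 * (starRingEnd ℂ) (z : ℂ) - 1 = y
      push_cast
      ring
    · rw [← h2]
      push_cast
      norm_num
      ring
  · obtain ⟨J, h1, h2⟩ := epsteinZeta_sub_eq_re (m := 2) (q := -(9 / 5)) (r := ((1 / 945 : ℚ) : ℝ)) (a := 15 / 32)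
      (b := 1395 / 256) (Q := fun t => 2 * t - 1) (by decide) (by fun_prop) (by norm_num)
      (fun v hv => by
        rw [latSum_six_eq hv]
        push_cast
        ring)
      (riemannZeta_even_eq h6 (by norm_num [Nat.factorial])) (by norm_num) (by norm_num [Nat.factorial])
      (by norm_num [Nat.factorial]) hz
    refine ⟨J, ?_, ?_⟩
    · convert h1 using 1
      funext t
      rw [hconj, ← sub_sub, ← sub_sub]
      generalize periodRatio t - 2 * (z : ℂ) - 1 = x
      generalize periodRatio t - 2 * (starRingEnd ℂ) (z : ℂ) - 1 = y
      push_cast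
      ring
    · rw [← h2]
      push_cast
      norm_num
      ring
  · obtain ⟨J, h1, h2⟩ := epsteinZeta_sub_eq_re (m := 3) (q := -(9 / 35)) (r := ((1 / 9450 : ℚ) : ℝ)) (a := 70 / 1088)
      (b := 200025 / 17408) (Q := fun t => 2 - 17 * t * (1 - t)) (by decide) (by fun_prop) (by norm_num)
      (fun v hv => by
        rw [latSum_eight_eq hv]
        push_cast
        ring)
      (riemannZeta_even_eq h8 (by norm_num [Nat.factorial])) (by norm_num) (by norm_num [Nat.factorial])
      (by norm_num [Nat.factorial]) hz
    refine ⟨J, ?_, ?_⟩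
    · convert h1 using 1
      funext t
      rw [hconj, ← sub_sub, ← sub_sub]
      generalize periodRatio t - 2 * (z : ℂ) - 1 = x
      generalize periodRatio t - 2 * (starRingEnd ℂ) (z : ℂ) - 1 = y
      push_cast
      ring
    · rw [← h2]
      push_cast
      norm_num
      ring
  · obtain ⟨J, h1, h2⟩ := epsteinZeta_sub_eq_re (m := 4) (q := -(3 / 35)) (r := ((1 / 93555 : ℚ) : ℝ)) (a := 315 / 15872)
      (b := 50703975 / 2031616) (Q := fun t => (2 * t - 1) * (1 - 31 * t * (1 - t))) (by decide) (by fun_prop) (by norm_num)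
      (fun v hv => by
        rw [latSum_ten_eq hv]
        push_cast
        ring)
      (riemannZeta_even_eq h10 (by norm_num [Nat.factorial])) (by norm_num) (by norm_num [Nat.factorial])
      (by norm_num [Nat.factorial]) hz
    refine ⟨J, ?_, ?_⟩
    · convert h1 using 1
      funext t
      rw [hconj, ← sub_sub, ← sub_sub]
      generalize periodRatio t - 2 * (z : ℂ) - 1 = x
      generalize periodRatio t - 2 * (starRingEnd ℂ) (z : ℂ) - 1 = y
      push_cast
      ring
    · rw [← h2]
      push_cast
      norm_num
      ring
  · obtain ⟨J, h1, h2⟩ := epsteinZeta_sub_eq_re (m := 6) (q := -(18 / 25025)) (r := ((2 / 18243225 : ℚ) : ℝ)) (a := 3003 / 22368256)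
      (b := 11506129710075 / 91620376576) (Q := fun t => (2 * t - 1) * (1 - 512 * t * (1 - t) + 5461 * t ^ 2 * (1 - t) ^ 2)) (by decide) (by fun_prop) (by norm_num)
      (fun v hv => by
        rw [latSum_fourteen_eq hv]
        push_cast
        ring)
      (riemannZeta_even_eq h14 (by norm_num [Nat.factorial])) (by norm_num) (by norm_num [Nat.factorial])
      (by norm_num [Nat.factorial]) hz
    refine ⟨J, ?_, ?_⟩
    · convert h1 using 1
      funext t
      rw [hconj, ← sub_sub, ← sub_sub]
      generalize periodRatio t - 2 * (z : ℂ) - 1 = x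
      generalize periodRatio t - 2 * (starRingEnd ℂ) (z : ℂ) - 1 = y
      push_cast
      ring
    · rw [← h2]
      push_cast
      norm_num
      ring
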